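/- Let $\mathcal H$ be a separable complex Hilbert space, $\mathfrak T(\mathcal H)$ the space of trace-class operators on it and $\mathfrak S(\mathcal H)$ the set of density operators (positive operators of trace one). Let $\Phi:\mathfrak T(\mathcal H)\to\mathfrak T(\mathcal H)$ be a quantum channel, that is, a linear completely positive trace-preserving map, let $H$ be a (possibly unbounded) positive selfadjoint operator in $\mathcal H$ with spectral measure $E_H$, and let $E>0$. Write $S(\rho)=-\mathrm{Tr}\,\rho\log\rho\in[0,\infty]$ for the von Neumann entropy, $\mathrm{Tr}\,\rho H:=\int_0^\infty\lambda\,m_\rho(d\lambda)\in[0,\infty]$ with $m_\rho(B)=\mathrm{Tr}\,\rho E_H(B)$, and $\mathcal E_E=\{\rho\in\mathfrak S(\mathcal H):\mathrm{Tr}\,\rho H\le E\}$. A generalized ensemble is a pair $\{\pi(dx),\rho(x)\}$, where $\pi$ is a probability measure on a standard Borel space $\mathcal X$ and $x\mapsto\rho(x)\in\mathfrak S(\mathcal H)$ is measurable; its average state is $\bar\rho_\pi=\int_{\mathcal X}\rho(x)\,\pi(dx)$, and $$\chi(\pi)=S(\Phi[\bar\rho_\pi])-\int_{\mathcal X}S(\Phi[\rho(x)])\,\pi(dx)$$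 (ensembles for which both terms are infinite are disregarded, i.e. $\chi(\pi):=-\infty$ for them). The constrained $\chi$-capacity is $$C_\chi(\Phi,H,E)=\sup_{\pi:\ \mathrm{Tr}\,\bar\rho_\pi H\le E}\chi(\pi).$$ Put $H^{(n)}=H\otimes I\otimes\dots\otimes I+\dots+I\otimes\dots\otimes I\otimes H$ on $\mathcal H^{\otimes n}$, let $C_\chi(\Phi^{\otimes n},H^{(n)},nE)$ be defined in the same way on $\mathcal H^{\otimes n}$, and let $$C(\Phi,H,E)=\lim_{n\to\infty}\frac1n\,C_\chi(\Phi^{\otimes n},H^{(n)},nE)$$ be the constrained classical capacity. Assume that the minimal output entropy $\check S(\Phi)=\inf_{\rho\in\mathfrak S(\mathcal H)}S(\Phi[\rho])$ is finite, and consider the following conditions. 1. $\sup_{\rho\in\mathcal E_E}S(\Phi[\rho])$ is attained at a state $\rho_E^0\in\mathcal E_E$. 2. $\inf_{\rho}S(\Phi[\rho])$ is attained at a state $\rho_0$. 3. $\Phi$ is covariant: there are a topological group $G$, a continuous projective unitary representation $g\mapsto V_g$ of $G$ in $\mathcal H$ and unitary operators $U_g$ in $\mathcal H$ such that $\Phi[V_g\rho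 V_g^*]=U_g\Phi[\rho]U_g^*$ for all $g\in G$ and all states $\rho$; moreover there is a Borel probability measure $\pi_E^0$ on $G$ such that $\rho_E^0=\int_GV_g\rho_0V_g^*\,\pi_E^0(dg)$. 4. The minimal output entropy is additive: $\check S(\Phi^{\otimes n})=n\,\check S(\Phi)$ for all $n\ge1$. Under conditions 1–3, $$C_\chi(\Phi,H,E)=\sup_{\rho\in\mathcal E_E}S(\Phi[\rho])-\inf_\rho S(\Phi[\rho])=S(\Phi[\rho_E^0])-S(\Phi[\rho_0]),$$ and the ensemble $\{\pi_E^0(dg),\,V_g\rho_0V_g^*\}$ is optimal: its average state belongs to $\mathcal E_E$ and its $\chi$-value equals $C_\chi(\Phi,H,E)$. If in addition condition 4 holds, then $$C_\chi(\Phi^{\otimes n},H^{(n)},nE)=n\,C_\chi(\Phi,H,E)\quad\text{for all }n\ge1,$$ and the limit defining $C(\Phi,H,E)$ exists and $$C(\Phi,H,E)=C_\chi(\Phi,H,E)=S(\Phi[\rho_E^0])-S(\Phi[\rho_0]).$$ -/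

import Mathlib

open scoped InnerProductSpace ENNReal NNReal TensorProduct ComplexOrder Topology
open MeasureTheory Filter

noncomputable section

namespace QInfo

universe u v w

section Trace

variable {K : Type u} [NormedAddCommGroup K] [InnerProductSpace ℂ K] [CompleteSpace K]

variable (K) in
/-- The index set of a fixed orthonormal basis of the Hilbert space `K`. -/
def stdIndex : Set K := (exists_hilbertBasis ℂ K).choose

variable (K) in
/-- A fixed orthonormal (Hilbert) basis of `K`. -/
def stdBasis : HilbertBasis (stdIndex K) ℂ K := (exists_hilbertBasis ℂ K).choose_spec.choose

/-- The trace `∑ᵢ ⟨eᵢ, A eᵢ⟩ ∈ [0, ∞]` of a positive operator `A`. -/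
def posTrace (A : K →L[ℂ] K) : ℝ≥0∞ :=
  ∑' i, ENNReal.ofReal (⟪stdBasis K i, A (stdBasis K i)⟫_ℂ).re

theorem tsum_norm_inner_sq {M : Type*} [NormedAddCommGroup M] [InnerProductSpace ℂ M] {ι : Type*}
    (b : HilbertBasis ι ℂ M) (x : M) :
    ∑' i, ENNReal.ofReal (‖⟪b i, x⟫_ℂ‖ ^ 2) = ENNReal.ofReal (‖x‖ ^ 2) := by
  have h := b.hasSum_inner_mul_inner x x
  have h2 : HasSum (fun i => ‖⟪b i, x⟫_ℂ‖ ^ 2) (‖x‖ ^ 2) := by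
    have h3 := Complex.hasSum_re h
    convert h3 using 1
    · ext i
      rw [← inner_conj_symm x (b i), mul_comm, Complex.mul_conj, Complex.normSq_eq_norm_sq]
      norm_cast
    · rw [inner_self_eq_norm_sq_to_K]; norm_cast
  rw [← h2.tsum_eq, ENNReal.ofReal_tsum_of_nonneg (fun _ => by positivity) h2.summable]

theorem tsum_norm_sq_adjoint {ι κ : Type*} (b : HilbertBasis ι ℂ K) (c : HilbertBasis κ ℂ K)
    (A : K →L[ℂ] K) :
    ∑' i, ENNReal.ofReal (‖A (b i)‖ ^ 2) = ∑' j, ENNReal.ofReal (‖star A (c j)‖ ^ 2) := by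
  calc ∑' i, ENNReal.ofReal (‖A (b i)‖ ^ 2)
      = ∑' i, ∑' j, ENNReal.ofReal (‖⟪c j, A (b i)⟫_ℂ‖ ^ 2) := by
        simp_rw [tsum_norm_inner_sq c]
    _ = ∑' j, ∑' i, ENNReal.ofReal (‖⟪c j, A (b i)⟫_ℂ‖ ^ 2) := ENNReal.tsum_comm
    _ = ∑' j, ∑' i, ENNReal.ofReal (‖⟪b i, star A (c j)⟫_ℂ‖ ^ 2) := by
        congr 1; ext j; congr 1; ext i
        rw [ContinuousLinearMap.star_eq_adjoint, ContinuousLinearMap.adjoint_inner_right,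
          norm_inner_symm]
    _ = _ := by simp_rw [tsum_norm_inner_sq b]

theorem re_inner_star_mul_self (A : K →L[ℂ] K) (x : K) :
    (⟪x, (star A * A) x⟫_ℂ).re = ‖A x‖ ^ 2 := by
  change (⟪x, star A (A x)⟫_ℂ).re = _
  rw [ContinuousLinearMap.star_eq_adjoint,
    ContinuousLinearMap.adjoint_inner_right, inner_self_eq_norm_sq_to_K]
  norm_cast

theorem posTrace_star_mul_self {ι : Type*} (b : HilbertBasis ι ℂ K) (A : K →L[ℂ] K) :
    posTrace (star A * A) = ∑' i, ENNReal.ofReal (‖A (b i)‖ ^ 2) := by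
  simp_rw [posTrace, re_inner_star_mul_self]
  rw [tsum_norm_sq_adjoint _ (stdBasis K) A, tsum_norm_sq_adjoint b (stdBasis K) A]

theorem posTrace_star_mul_self_comm (A : K →L[ℂ] K) :
    posTrace (star A * A) = posTrace (A * star A) := by
  conv_rhs => rw [← star_star A, star_star (star A)]
  rw [posTrace_star_mul_self (stdBasis K) A, posTrace_star_mul_self (stdBasis K) (star A),
    tsum_norm_sq_adjoint _ (stdBasis K) A]

theorem sqrt_props {A : K →L[ℂ] K} (hA : A.IsPositive) :
    star (CFC.sqrt A) = CFC.sqrt A ∧ CFC.sqrt A * CFC.sqrt A = A := by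
  have h0 : 0 ≤ A := (ContinuousLinearMap.nonneg_iff_isPositive A).2 hA
  exact ⟨(IsSelfAdjoint.of_nonneg (CFC.sqrt_nonneg A)).star_eq, CFC.sqrt_mul_sqrt_self A h0⟩

/-- The trace of a positive operator does not depend on the orthonormal basis. -/
theorem posTrace_eq_tsum {ι : Type*} (b : HilbertBasis ι ℂ K) {A : K →L[ℂ] K}
    (hA : A.IsPositive) :
    posTrace A = ∑' i, ENNReal.ofReal (⟪b i, A (b i)⟫_ℂ).re := by
  obtain ⟨h1, h2⟩ := sqrt_props hA
  have h3 : star (CFC.sqrt A) * CFC.sqrt A = A := by rw [h1, h2]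
  conv_lhs => rw [← h3]
  rw [posTrace_star_mul_self b]
  simp_rw [← re_inner_star_mul_self, h3]

variable (K) in
/-- The space of trace-class operators on `K`: the linear span of the positive operators with
finite trace. -/
def traceClass : Submodule ℂ (K →L[ℂ] K) :=
  Submodule.span ℂ {A | A.IsPositive ∧ posTrace A < ∞}

/-- The trace of a trace-class operator. -/
def trace (A : traceClass K) : ℂ :=
  ∑' i, ⟪stdBasis K i, (A : K →L[ℂ] K) (stdBasis K i)⟫_ℂ

theorem summable_of_mem_traceClass {A : K →L[ℂ] K} (hA : A ∈ traceClass K) :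
    Summable fun i => ⟪stdBasis K i, A (stdBasis K i)⟫_ℂ := by
  induction hA using Submodule.span_induction with
  | mem A hA =>
    obtain ⟨hpos, htr⟩ := hA
    have hnn : ∀ i, 0 ≤ ⟪stdBasis K i, A (stdBasis K i)⟫_ℂ := fun i => hpos.inner_nonneg_right _
    have hs : Summable fun i => (⟪stdBasis K i, A (stdBasis K i)⟫_ℂ).re := by
      have := ENNReal.summable_toReal htr.ne
      refine this.congr fun i => ?_
      rw [ENNReal.toReal_ofReal (Complex.nonneg_iff.1 (hnn i)).1]
    have := Complex.ofRealCLM.summable hs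
    refine this.congr fun i => ?_
    have := (Complex.nonneg_iff.1 (hnn i)).2
    apply Complex.ext <;> simp [← this]
  | zero => simp
  | add A B _ _ hA hB => simpa [inner_add_right] using hA.add hB
  | smul c A _ hA => simpa [inner_smul_right] using hA.mul_left c

theorem ofReal_re_trace {A : traceClass K} (hA : (A : K →L[ℂ] K).IsPositive) :
    posTrace (A : K →L[ℂ] K) = ENNReal.ofReal (trace A).re := by
  have hs := summable_of_mem_traceClass A.2
  have hnn : ∀ i, 0 ≤ ⟪stdBasis K i, (A : K →L[ℂ] K) (stdBasis K i)⟫_ℂ :=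
    fun i => hA.inner_nonneg_right _
  rw [trace, Complex.re_tsum hs, ENNReal.ofReal_tsum_of_nonneg
    (fun i => (Complex.nonneg_iff.1 (hnn i)).1) (Complex.reCLM.summable hs)]
  rfl

end Trace

section States

variable {K : Type u} [NormedAddCommGroup K] [InnerProductSpace ℂ K] [CompleteSpace K]

variable (K) in
/-- Density operators (quantum states): positive operators of trace one. -/
structure DensityOperator where
  /-- the underlying operator -/
  op : K →L[ℂ] K
  isPositive : op.IsPositive
  posTrace_eq_one : posTrace op = 1

namespace DensityOperator

/-- A density operator as an element of the trace class. -/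
def toTraceClass (ρ : DensityOperator K) : traceClass K :=
  ⟨ρ.op, Submodule.subset_span ⟨ρ.isPositive, by rw [ρ.posTrace_eq_one]; exact ENNReal.one_lt_top⟩⟩

theorem trace_toTraceClass (ρ : DensityOperator K) : trace ρ.toTraceClass = 1 := by
  have hs := summable_of_mem_traceClass ρ.toTraceClass.2
  have hnn : ∀ i, 0 ≤ ⟪stdBasis K i, ρ.op (stdBasis K i)⟫_ℂ :=
    fun i => ρ.isPositive.inner_nonneg_right _
  have h0 : 0 ≤ trace ρ.toTraceClass := tsum_nonneg hnn
  have h1 := ofReal_re_trace (A := ρ.toTraceClass) ρ.isPositive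
  have h2 : posTrace (ρ.toTraceClass : K →L[ℂ] K) = 1 := ρ.posTrace_eq_one
  rw [h2] at h1
  have h3 : (trace ρ.toTraceClass).re = 1 := by
    have := congrArg ENNReal.toReal h1
    rw [ENNReal.toReal_ofReal (Complex.nonneg_iff.1 h0).1] at this
    simpa using this.symm
  exact Complex.ext (by simpa using h3) (by simpa using (Complex.nonneg_iff.1 h0).2.symm)

/-- The von Neumann entropy `S(ρ) = - Tr ρ log ρ ∈ [0, ∞]`, the trace of the positive operator
`η(ρ)`, `η(x) = - x log x`. -/
def entropy (ρ : DensityOperator K) : ℝ≥0∞ := posTrace (cfc Real.negMulLog ρ.op)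

/-- The conjugated state `V ρ V*` for a unitary operator `V`. -/
def conj (ρ : DensityOperator K) (V : unitary (K →L[ℂ] K)) : DensityOperator K where
  op := V * ρ.op * star (V : K →L[ℂ] K)
  isPositive := by
    rw [mul_assoc, ContinuousLinearMap.star_eq_adjoint]
    exact ρ.isPositive.conj_adjoint (V : K →L[ℂ] K)
  posTrace_eq_one := by
    obtain ⟨h1, h2⟩ := sqrt_props ρ.isPositive
    set R := CFC.sqrt ρ.op
    have hV : star (V : K →L[ℂ] K) * V = 1 := Unitary.coe_star_mul_self V
    have e1 : (V : K →L[ℂ] K) * ρ.op * star (V : K →L[ℂ] K) = (V * R) * star (V * R) := by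
      rw [star_mul, h1, ← h2]; simp only [mul_assoc]
    have e2 : star ((V : K →L[ℂ] K) * R) * (V * R) = ρ.op := by
      rw [star_mul, h1, mul_assoc, ← mul_assoc (star _), hV, one_mul, h2]
    rw [e1, ← posTrace_star_mul_self_comm, e2, ρ.posTrace_eq_one]

/-- The σ-algebra on the set of states generated by the matrix elements `ρ ↦ ⟨x, ρ y⟩`; on a
separable Hilbert space this is the Borel σ-algebra of the trace norm. -/
instance : MeasurableSpace (DensityOperator K) :=
  ⨆ (x : K) (y : K), MeasurableSpace.comap (fun ρ : DensityOperator K => ⟪x, ρ.op y⟫_ℂ)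
    inferInstance

theorem measurable_inner (x y : K) : Measurable fun ρ : DensityOperator K => ⟪x, ρ.op y⟫_ℂ := by
  rw [measurable_iff_comap_le]
  exact le_iSup₂ (f := fun x y : K => MeasurableSpace.comap
    (fun ρ : DensityOperator K => ⟪x, ρ.op y⟫_ℂ) inferInstance) x y

theorem measurable_iff {X : Type*} [MeasurableSpace X] {f : X → DensityOperator K} :
    Measurable f ↔ ∀ x y : K, Measurable fun t => ⟪x, (f t).op y⟫_ℂ := by
  refine ⟨fun h x y => (measurable_inner x y).comp h, fun h => ?_⟩
  rw [measurable_iff_comap_le, instMeasurableSpace, MeasurableSpace.comap_iSup]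
  refine iSup_le fun x => ?_
  rw [MeasurableSpace.comap_iSup]
  refine iSup_le fun y => ?_
  rw [MeasurableSpace.comap_comp]
  exact (h x y).comap_le

theorem norm_sqrt_apply_le (ρ : DensityOperator K) (x : K) : ‖CFC.sqrt ρ.op x‖ ≤ ‖x‖ := by
  obtain ⟨h1, h2⟩ := sqrt_props ρ.isPositive
  set R := CFC.sqrt ρ.op
  have h3 : star R * R = ρ.op := by rw [h1, h2]
  have h4 : ENNReal.ofReal (‖R x‖ ^ 2) ≤ ENNReal.ofReal (‖x‖ ^ 2) := by
    calc ENNReal.ofReal (‖R x‖ ^ 2)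
        = ∑' i, ENNReal.ofReal (‖⟪stdBasis K i, R x⟫_ℂ‖ ^ 2) := (tsum_norm_inner_sq _ _).symm
      _ = ∑' i, ENNReal.ofReal (‖⟪R (stdBasis K i), x⟫_ℂ‖ ^ 2) := by
          congr 1; ext i
          conv_rhs => rw [← h1, ContinuousLinearMap.star_eq_adjoint,
            ContinuousLinearMap.adjoint_inner_left]
      _ ≤ ∑' i, ENNReal.ofReal (‖R (stdBasis K i)‖ ^ 2) * ENNReal.ofReal (‖x‖ ^ 2) := by
          refine ENNReal.tsum_le_tsum fun i => ?_
          rw [← ENNReal.ofReal_mul (by positivity), ← mul_pow]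
          gcongr
          exact norm_inner_le_norm _ _
      _ = ENNReal.ofReal (‖x‖ ^ 2) := by
          rw [ENNReal.tsum_mul_right, ← posTrace_star_mul_self, h3, ρ.posTrace_eq_one, one_mul]
  rw [ENNReal.ofReal_le_ofReal_iff (by positivity)] at h4
  exact le_of_sq_le_sq h4 (norm_nonneg x)

theorem norm_inner_op_le (ρ : DensityOperator K) (x y : K) :
    ‖⟪x, ρ.op y⟫_ℂ‖ ≤ ‖x‖ * ‖y‖ := by
  obtain ⟨h1, h2⟩ := sqrt_props ρ.isPositive
  have : ⟪x, ρ.op y⟫_ℂ = ⟪CFC.sqrt ρ.op x, CFC.sqrt ρ.op y⟫_ℂ := by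
    conv_lhs => rw [← h2]
    conv_rhs => rw [← ContinuousLinearMap.adjoint_inner_right,
      ← ContinuousLinearMap.star_eq_adjoint, h1]
    rfl
  rw [this]
  exact (norm_inner_le_norm _ _).trans (mul_le_mul (ρ.norm_sqrt_apply_le x)
    (ρ.norm_sqrt_apply_le y) (norm_nonneg _) (norm_nonneg _))

end DensityOperator

end States

section Ensembles

variable {K : Type u} [NormedAddCommGroup K] [InnerProductSpace ℂ K] [CompleteSpace K]

instance [TopologicalSpace.SeparableSpace K] : Countable (stdIndex K) := by
  have ho : Orthonormal ℂ (stdBasis K) := (stdBasis K).orthonormal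
  have hd : Pairwise fun i j : stdIndex K =>
      Disjoint (Metric.ball (stdBasis K i) (1 / 2)) (Metric.ball (stdBasis K j) (1 / 2)) := by
    intro i j hij
    refine Metric.ball_disjoint_ball ?_
    have h0 : ⟪stdBasis K i, stdBasis K j⟫_ℂ = 0 := ho.2 hij
    have h1 := norm_sub_sq (𝕜 := ℂ) (stdBasis K i) (stdBasis K j)
    rw [h0, ho.1 i, ho.1 j] at h1
    have h2 : ‖stdBasis K i - stdBasis K j‖ ^ 2 = 2 := by rw [h1]; norm_num
    rw [dist_eq_norm]
    nlinarith [norm_nonneg (stdBasis K i - stdBasis K j)]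
  exact hd.countable_of_isOpen_disjoint (fun _ => Metric.isOpen_ball)
    (fun i => ⟨_, Metric.mem_ball_self (by norm_num)⟩)

variable (K) in
/-- A generalized ensemble: a probability measure on `X` and a measurable family of states. -/
structure GeneralizedEnsemble (X : Type v) [MeasurableSpace X] where
  /-- the probability distribution `π(dx)` -/
  prob : Measure X
  [isProbabilityMeasure : IsProbabilityMeasure prob]
  /-- the states `ρ(x)` -/
  state : X → DensityOperator K
  measurable_state : Measurable state

attribute [instance] GeneralizedEnsemble.isProbabilityMeasure

namespace GeneralizedEnsemble

variable {X : Type v} [MeasurableSpace X] (μ : GeneralizedEnsemble K X)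

theorem integrable_inner (x y : K) :
    Integrable (fun t => ⟪(μ.state t).op x, y⟫_ℂ) μ.prob := by
  have hm : Measurable fun t => ⟪(μ.state t).op x, y⟫_ℂ := by
    have := DensityOperator.measurable_iff.1 μ.measurable_state x y
    simpa only [(μ.state _).isPositive.inner_left_eq_inner_right] using this
  refine Integrable.of_bound hm.aestronglyMeasurable (‖x‖ * ‖y‖) (ae_of_all _ fun t => ?_)
  rw [norm_inner_symm, mul_comm]
  exact (μ.state t).norm_inner_op_le y x

/-- The bounded sesquilinear form `⟨ρ̄ x, y⟩ = ∫ ⟨ρ(t) x, y⟩ π(dt)`. -/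
def averageForm : K →L⋆[ℂ] K →L[ℂ] ℂ :=
  LinearMap.mkContinuous₂
    (LinearMap.mk₂'ₛₗ (starRingEnd ℂ) (RingHom.id ℂ)
      (fun x y => ∫ t, ⟪(μ.state t).op x, y⟫_ℂ ∂μ.prob)
      (fun x x' y => by
        simp only [map_add, inner_add_left]
        exact integral_add (μ.integrable_inner x y) (μ.integrable_inner x' y))
      (fun c x y => by
        simp only [map_smul, inner_smul_left]
        exact integral_const_mul _ _)
      (fun x y y' => by
        simp only [inner_add_right]
        exact integral_add (μ.integrable_inner x y) (μ.integrable_inner x y'))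
      (fun c x y => by
        simp only [inner_smul_right]
        exact integral_const_mul _ _)) 1
    (fun x y => by
      refine (norm_integral_le_of_norm_le_const (C := ‖x‖ * ‖y‖) (ae_of_all _ fun t => ?_)).trans ?_
      · rw [norm_inner_symm, mul_comm]
        exact (μ.state t).norm_inner_op_le y x
      · simp)

theorem inner_averageForm (x y : K) :
    ⟪InnerProductSpace.continuousLinearMapOfBilin μ.averageForm x, y⟫_ℂ =
      ∫ t, ⟪(μ.state t).op x, y⟫_ℂ ∂μ.prob := by
  rw [InnerProductSpace.continuousLinearMapOfBilin_apply]
  rfl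

/-- The average state (barycenter) `ρ̄ = ∫ ρ(x) π(dx)`, the operator with
`⟨ρ̄ x, y⟩ = ∫ ⟨ρ(t) x, y⟩ π(dt)` for all `x, y`. -/
def average [TopologicalSpace.SeparableSpace K] : DensityOperator K where
  op := InnerProductSpace.continuousLinearMapOfBilin μ.averageForm
  isPositive := by
    have hp : ∀ x t, 0 ≤ ⟪(μ.state t).op x, x⟫_ℂ :=
      fun x t => (μ.state t).isPositive.inner_nonneg_left x
    rw [ContinuousLinearMap.isPositive_iff_complex]
    intro x
    have h1 : 0 ≤ ⟪InnerProductSpace.continuousLinearMapOfBilin μ.averageForm x, x⟫_ℂ := by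
      rw [μ.inner_averageForm]
      exact integral_nonneg (hp x)
    exact ⟨Complex.ext (by simp) (by simpa using (Complex.nonneg_iff.1 h1).2),
      (Complex.nonneg_iff.1 h1).1⟩
  posTrace_eq_one := by
    have hp : ∀ x t, 0 ≤ ⟪(μ.state t).op x, x⟫_ℂ :=
      fun x t => (μ.state t).isPositive.inner_nonneg_left x
    have key : ∀ x, ENNReal.ofReal
        (⟪x, InnerProductSpace.continuousLinearMapOfBilin μ.averageForm x⟫_ℂ).re =
        ∫⁻ t, ENNReal.ofReal (⟪x, (μ.state t).op x⟫_ℂ).re ∂μ.prob := by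
      intro x
      rw [← inner_conj_symm, Complex.conj_re, μ.inner_averageForm,
        ← RCLike.re_eq_complex_re, ← integral_re (μ.integrable_inner x x),
        ofReal_integral_eq_lintegral_ofReal (μ.integrable_inner x x).re
          (ae_of_all _ fun t => (Complex.nonneg_iff.1 (hp x t)).1)]
      refine lintegral_congr fun t => ?_
      rw [(μ.state t).isPositive.inner_left_eq_inner_right]
    rw [posTrace]
    simp_rw [key]
    rw [← lintegral_tsum]
    · have : ∀ t, ∑' i, ENNReal.ofReal
          (⟪stdBasis K i, (μ.state t).op (stdBasis K i)⟫_ℂ).re = 1 :=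
        fun t => (μ.state t).posTrace_eq_one
      simp_rw [this]
      simp
    · intro i
      have := DensityOperator.measurable_iff.1 μ.measurable_state (stdBasis K i) (stdBasis K i)
      exact (Complex.measurable_re.comp this).ennreal_ofReal.aemeasurable

end GeneralizedEnsemble

end Ensembles


section Channels

variable {K : Type u} [NormedAddCommGroup K] [InnerProductSpace ℂ K] [CompleteSpace K]

/-- Positivity of an operator matrix `(A i j)`, acting on the direct sum of `m` copies of `K`. -/
def BlockPositive {m : ℕ} (A : Fin m → Fin m → K →L[ℂ] K) : Prop :=
  ∀ x : Fin m → K, 0 ≤ ∑ i, ∑ j, ⟪x i, A i j (x j)⟫_ℂ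

variable (K) in
/-- Quantum channels: linear completely positive trace-preserving maps of the space of trace-class
operators. Complete positivity: for every `m`, applying the map entrywise takes positive `m × m`
operator matrices to positive ones. -/
structure QuantumChannel where
  /-- the linear map of the trace class -/
  toLinearMap : traceClass K →ₗ[ℂ] traceClass K
  completely_positive : ∀ (m : ℕ) (A : Fin m → Fin m → traceClass K),
    BlockPositive (fun i j => (A i j : K →L[ℂ] K)) →
      BlockPositive (fun i j => (toLinearMap (A i j) : K →L[ℂ] K))
  trace_preserving : ∀ A, trace (toLinearMap A) = trace A

namespace QuantumChannel

variable (K) in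
/-- The identity channel. -/
protected def id : QuantumChannel K where
  toLinearMap := LinearMap.id
  completely_positive _ _ h := h
  trace_preserving _ := rfl

theorem isPositive_apply (Φ : QuantumChannel K) (ρ : DensityOperator K) :
    (Φ.toLinearMap ρ.toTraceClass : K →L[ℂ] K).IsPositive := by
  have h := Φ.completely_positive 1 (fun _ _ => ρ.toTraceClass) (by
    intro x
    simp only [Finset.univ_unique, Finset.sum_singleton]
    exact ρ.isPositive.inner_nonneg_right _)
  rw [ContinuousLinearMap.isPositive_iff_complex]
  intro x
  have h1 : 0 ≤ ⟪x, (Φ.toLinearMap ρ.toTraceClass : K →L[ℂ] K) x⟫_ℂ := by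
    simpa [BlockPositive] using h (fun _ => x)
  obtain ⟨h2, h3⟩ := Complex.nonneg_iff.1 h1
  have h4 : ⟪(Φ.toLinearMap ρ.toTraceClass : K →L[ℂ] K) x, x⟫_ℂ =
      ⟪x, (Φ.toLinearMap ρ.toTraceClass : K →L[ℂ] K) x⟫_ℂ := by
    rw [← inner_conj_symm]
    exact Complex.conj_eq_iff_im.2 h3.symm
  rw [h4]
  exact ⟨Complex.ext (by simp) (by simpa using h3), h2⟩

/-- The output state `Φ[ρ]`. -/
def apply (Φ : QuantumChannel K) (ρ : DensityOperator K) : DensityOperator K where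
  op := Φ.toLinearMap ρ.toTraceClass
  isPositive := Φ.isPositive_apply ρ
  posTrace_eq_one := by
    rw [ofReal_re_trace (Φ.isPositive_apply ρ), Φ.trace_preserving, ρ.trace_toTraceClass]
    simp

/-- The output entropy `S(Φ[ρ])`. -/
def outputEntropy (Φ : QuantumChannel K) (ρ : DensityOperator K) : ℝ≥0∞ := (Φ.apply ρ).entropy

/-- The minimal output entropy `inf_ρ S(Φ[ρ])`. -/
def minOutputEntropy (Φ : QuantumChannel K) : ℝ≥0∞ := ⨅ ρ, Φ.outputEntropy ρ

end QuantumChannel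

end Channels

section Spectral

variable {K : Type u} [NormedAddCommGroup K] [InnerProductSpace ℂ K] [CompleteSpace K]

/-- Spectral measures (orthogonal projection-valued measures) on `Ω`. Only the values on measurable
sets are meaningful. -/
structure SpectralMeasure (Ω : Type v) [MeasurableSpace Ω] (K : Type u) [NormedAddCommGroup K]
    [InnerProductSpace ℂ K] [CompleteSpace K] where
  /-- the projection `E(s)` -/
  proj : Set Ω → K →L[ℂ] K
  isStarProjection : ∀ s, MeasurableSet s → IsStarProjection (proj s)
  proj_univ : proj Set.univ = 1
  proj_inter : ∀ s t, MeasurableSet s → MeasurableSet t → proj (s ∩ t) = proj s * proj t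
  hasSum_inner : ∀ (x : K) (f : ℕ → Set Ω), (∀ i, MeasurableSet (f i)) →
    Pairwise (Function.onFun Disjoint f) →
      HasSum (fun i => ⟪x, proj (f i) x⟫_ℂ) ⟪x, proj (⋃ i, f i) x⟫_ℂ

namespace SpectralMeasure

variable {Ω : Type v} [MeasurableSpace Ω] {Ω' : Type w} [MeasurableSpace Ω']

theorem inner_proj (E : SpectralMeasure Ω K) (x : K) {s : Set Ω} (hs : MeasurableSet s) :
    ⟪x, E.proj s x⟫_ℂ = ((‖E.proj s x‖ ^ 2 : ℝ) : ℂ) := by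
  have h1 := (E.isStarProjection s hs).isIdempotentElem.eq
  have h2 := (E.isStarProjection s hs).isSelfAdjoint.star_eq
  have h3 : star (E.proj s) * E.proj s = E.proj s := by rw [h2, h1]
  conv_lhs => rw [← h3]
  change ⟪x, (star (E.proj s)) (E.proj s x)⟫_ℂ = _
  rw [ContinuousLinearMap.star_eq_adjoint, ContinuousLinearMap.adjoint_inner_right,
    inner_self_eq_norm_sq_to_K]
  norm_cast

/-- The finite measure `s ↦ ⟨x, E(s) x⟩ = ‖E(s) x‖²`. -/
def scalarMeasure (E : SpectralMeasure Ω K) (x : K) : Measure Ω :=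
  Measure.ofMeasurable (fun s _ => ENNReal.ofReal (‖E.proj s x‖ ^ 2))
    (by
      have h := E.hasSum_inner x (fun _ => ∅) (fun _ => MeasurableSet.empty)
        (fun _ _ _ => by simp [Function.onFun])
      have h1 := h.summable.tendsto_atTop_zero
      have h2 : ⟪x, E.proj ∅ x⟫_ℂ = 0 := tendsto_nhds_unique tendsto_const_nhds h1
      rw [E.inner_proj x MeasurableSet.empty] at h2
      have h3 : ‖E.proj ∅ x‖ ^ 2 = 0 := by exact_mod_cast h2
      simp only [h3, ENNReal.ofReal_zero])
    (fun f hf hd => by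
      have h := E.hasSum_inner x f hf hd
      rw [E.inner_proj x (MeasurableSet.iUnion hf)] at h
      simp_rw [E.inner_proj x (hf _)] at h
      have h1 := Complex.hasSum_ofReal.1 h
      rw [← h1.tsum_eq, ENNReal.ofReal_tsum_of_nonneg (fun _ => by positivity) h1.summable])

theorem scalarMeasure_apply (E : SpectralMeasure Ω K) (x : K) {s : Set Ω}
    (hs : MeasurableSet s) : E.scalarMeasure x s = ENNReal.ofReal (‖E.proj s x‖ ^ 2) :=
  Measure.ofMeasurable_apply s hs

/-- The distribution `s ↦ Tr ρ E(s)` of the spectral measure in the state `ρ`, computed as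
`∑ᵢ ⟨√ρ eᵢ, E(s) √ρ eᵢ⟩ = Tr √ρ E(s) √ρ`. -/
def distribution (E : SpectralMeasure Ω K) (ρ : DensityOperator K) : Measure Ω :=
  Measure.sum fun i => E.scalarMeasure (CFC.sqrt ρ.op (stdBasis K i))

theorem distribution_apply (E : SpectralMeasure Ω K) (ρ : DensityOperator K) {s : Set Ω}
    (hs : MeasurableSet s) :
    E.distribution ρ s = posTrace (CFC.sqrt ρ.op * E.proj s * CFC.sqrt ρ.op) := by
  obtain ⟨h1, -⟩ := sqrt_props ρ.isPositive
  rw [distribution, Measure.sum_apply _ hs, posTrace]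
  congr 1; ext i
  rw [E.scalarMeasure_apply _ hs]
  congr 1
  change _ = (⟪stdBasis K i, CFC.sqrt ρ.op (E.proj s (CFC.sqrt ρ.op (stdBasis K i)))⟫_ℂ).re
  rw [← ContinuousLinearMap.adjoint_inner_left, ← ContinuousLinearMap.star_eq_adjoint, h1,
    E.inner_proj _ hs, Complex.ofReal_re]

/-- The image of a spectral measure under a measurable map. -/
def map (E : SpectralMeasure Ω K) (f : Ω → Ω') (hf : Measurable f) : SpectralMeasure Ω' K where
  proj s := E.proj (f ⁻¹' s)
  isStarProjection s hs := E.isStarProjection _ (hf hs)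
  proj_univ := E.proj_univ
  proj_inter s t hs ht := E.proj_inter _ _ (hf hs) (hf ht)
  hasSum_inner x g hg hd := by
    rw [Set.preimage_iUnion]
    exact E.hasSum_inner x _ (fun i => hf (hg i)) (fun i j hij => (hd hij).preimage f)

variable (K) in
open Classical in
/-- The spectral measure concentrated at a point. -/
def dirac (ω : Ω) : SpectralMeasure Ω K where
  proj s := if ω ∈ s then 1 else 0
  isStarProjection s _ := by
    split_ifs
    · exact .one _
    · exact .zero _
  proj_univ := by simp
  proj_inter s t _ _ := by
    by_cases h1 : ω ∈ s <;> by_cases h2 : ω ∈ t <;> simp [h1, h2]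
  hasSum_inner x f _ hd := by
    by_cases h : ∃ i, ω ∈ f i
    · obtain ⟨i, hi⟩ := h
      have h1 : ω ∈ ⋃ i, f i := Set.mem_iUnion.2 ⟨i, hi⟩
      simp only [h1, if_true]
      have := hasSum_single (f := fun j => ⟪x, (if ω ∈ f j then (1 : K →L[ℂ] K) else 0) x⟫_ℂ) i
        (fun j hj => by
          have : ω ∉ f j := fun h2 => Set.disjoint_left.1 (hd hj) h2 hi
          simp [this])
      simpa [hi] using this
    · have h1 : ω ∉ ⋃ i, f i := by simpa using h
      push Not at h
      simp [h]

end SpectralMeasure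

/-- `E` is the spectral measure of the (unbounded) positive selfadjoint operator `H`, that is,
`H = ∫ t E(dt)`: the domain of `H` is `{x | ∫ t² ⟨x, E(dt) x⟩ < ∞}` and
`⟨x, H x⟩ = ∫ t ⟨x, E(dt) x⟩` for `x` in the domain. -/
def IsSpectralMeasureOf (E : SpectralMeasure ℝ≥0 K) (H : K →ₗ.[ℂ] K) : Prop :=
  (∀ x, x ∈ H.domain ↔ ∫⁻ t, (t : ℝ≥0∞) ^ 2 ∂(E.scalarMeasure x) < ∞) ∧
  ∀ x : H.domain, ⟪(x : K), H x⟫_ℂ = ((∫ t, (t : ℝ) ∂(E.scalarMeasure (x : K)) : ℝ) : ℂ)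

open Classical in
/-- The spectral measure on `[0, ∞)` of a positive selfadjoint operator `H`, which exists and is
unique by the spectral theorem. (For other `H` the value is meaningless.) -/
def spectralMeasure (H : K →ₗ.[ℂ] K) : SpectralMeasure ℝ≥0 K :=
  if h : ∃ E : SpectralMeasure ℝ≥0 K, IsSpectralMeasureOf E H then h.choose
  else SpectralMeasure.dirac K 0

/-- The mean energy `Tr ρ H = ∫ t m_ρ(dt)`, where `m_ρ(s) = Tr ρ E(s)` and `E` is the spectral
measure of `H`. -/
def SpectralMeasure.energy (E : SpectralMeasure ℝ≥0 K) (ρ : DensityOperator K) : ℝ≥0∞ :=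
  ∫⁻ t, (t : ℝ≥0∞) ∂(E.distribution ρ)

/-- The set of states with energy constraint `Tr ρ H ≤ c`. -/
def constrainedStates (E : SpectralMeasure ℝ≥0 K) (c : ℝ) : Set (DensityOperator K) :=
  {ρ | E.energy ρ ≤ ENNReal.ofReal c}

end Spectral

section Capacity

variable {K : Type u} [NormedAddCommGroup K] [InnerProductSpace ℂ K] [CompleteSpace K]
  [TopologicalSpace.SeparableSpace K]

/-- The Holevo quantity `χ(π) = S(Φ[ρ̄_π]) - ∫ S(Φ[ρ(x)]) π(dx)` of a generalized ensemble. In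
the indeterminate case `∞ - ∞` the value is `-∞`. -/
def chi (Φ : QuantumChannel K) {X : Type v} [MeasurableSpace X] (μ : GeneralizedEnsemble K X) :
    EReal :=
  (Φ.outputEntropy μ.average : EReal) - ((∫⁻ x, Φ.outputEntropy (μ.state x) ∂μ.prob : ℝ≥0∞) : EReal)

/-- The constrained `χ`-capacity: the supremum of `χ(π)` over the generalized ensembles (on standard
Borel spaces) with `Tr ρ̄_π H ≤ c`, where `E` is the spectral measure of `H`. -/
def chiCapacity (Φ : QuantumChannel K) (E : SpectralMeasure ℝ≥0 K) (c : ℝ) : EReal :=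
  ⨆ (X : Type) (_ : MeasurableSpace X) (_ : StandardBorelSpace X)
    (μ : GeneralizedEnsemble K X) (_ : μ.average ∈ constrainedStates E c), chi Φ μ

end Capacity

section Tensor

variable (K : Type u) [NormedAddCommGroup K] [InnerProductSpace ℂ K] [CompleteSpace K]
  (L : Type u) [NormedAddCommGroup L] [InnerProductSpace ℂ L] [CompleteSpace L]

/-- The Hilbert space tensor product: the completion of the algebraic tensor product with
`⟨x ⊗ y, x' ⊗ y'⟩ = ⟨x, x'⟩ ⟨y, y'⟩`. -/
abbrev HilbertTensor : Type u := UniformSpace.Completion (K ⊗[ℂ] L)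

instance [TopologicalSpace.SeparableSpace K] [TopologicalSpace.SeparableSpace L] :
    TopologicalSpace.SeparableSpace (HilbertTensor K L) := by
  have h1 : TopologicalSpace.IsSeparable (Set.range fun p : K × L => p.1 ⊗ₜ[ℂ] p.2) :=
    TopologicalSpace.isSeparable_range TensorProduct.continuous_tmul
  have h2 : TopologicalSpace.IsSeparable (Set.univ : Set (K ⊗[ℂ] L)) := by
    have h3 := h1.span (R := ℂ)
    have h4 : Submodule.span ℂ (Set.range fun p : K × L => p.1 ⊗ₜ[ℂ] p.2) = ⊤ := by
      rw [← TensorProduct.span_tmul_eq_top]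
      congr 1
      ext t
      simp
    rwa [h4, Submodule.top_coe] at h3
  have h5 : TopologicalSpace.SeparableSpace (K ⊗[ℂ] L) :=
    TopologicalSpace.isSeparable_univ_iff.1 h2
  infer_instance

variable {K L}

/-- The tensor product `A ⊗ B` of bounded operators. -/
def opTensor (A : K →L[ℂ] K) (B : L →L[ℂ] L) : HilbertTensor K L →L[ℂ] HilbertTensor K L :=
  (TensorProduct.mapL A B).completion

/-- The defining property `Ξ[A ⊗ B] = Φ[A] ⊗ Ψ[B]` of the tensor product of two channels. -/
def IsChannelTensor (Φ : QuantumChannel K) (Ψ : QuantumChannel L)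
    (Ξ : QuantumChannel (HilbertTensor K L)) : Prop :=
  ∀ (A : traceClass K) (B : traceClass L) (C : traceClass (HilbertTensor K L)),
    (C : HilbertTensor K L →L[ℂ] HilbertTensor K L) = opTensor (A : K →L[ℂ] K) (B : L →L[ℂ] L) →
      (Ξ.toLinearMap C : HilbertTensor K L →L[ℂ] HilbertTensor K L) =
        opTensor (Φ.toLinearMap A : K →L[ℂ] K) (Ψ.toLinearMap B : L →L[ℂ] L)

open Classical in
/-- The tensor product `Φ ⊗ Ψ` of two channels, the unique channel `Ξ` such that
`Ξ[A ⊗ B] = Φ[A] ⊗ Ψ[B]` for all trace-class `A`, `B`. -/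
def QuantumChannel.tensor (Φ : QuantumChannel K) (Ψ : QuantumChannel L) :
    QuantumChannel (HilbertTensor K L) :=
  if h : ∃ Ξ, IsChannelTensor Φ Ψ Ξ then h.choose else QuantumChannel.id _

open Classical in
/-- The product `G = E ⊗ F` of two spectral measures, the unique spectral measure on `Ω × Ω'` such
that `G(s × t) = E(s) ⊗ F(t)` for all measurable `s`, `t`. -/
def SpectralMeasure.prod {Ω : Type v} [MeasurableSpace Ω] {Ω' : Type w} [MeasurableSpace Ω']
    [Nonempty (Ω × Ω')]
    (E : SpectralMeasure Ω K) (F : SpectralMeasure Ω' L) :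
    SpectralMeasure (Ω × Ω') (HilbertTensor K L) :=
  if h : ∃ G : SpectralMeasure (Ω × Ω') (HilbertTensor K L), ∀ s t, MeasurableSet s →
    MeasurableSet t → G.proj (s ×ˢ t) = opTensor (E.proj s) (F.proj t) then h.choose
  else SpectralMeasure.dirac _ (Classical.arbitrary _)

/-- If `E`, `F` are the spectral measures of `H₁` on `K` and `H₂` on `L`, this is the spectral
measure of `H₁ ⊗ I + I ⊗ H₂`. -/
def SpectralMeasure.tensorSum (E : SpectralMeasure ℝ≥0 K) (F : SpectralMeasure ℝ≥0 L) :
    SpectralMeasure ℝ≥0 (HilbertTensor K L) :=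
  (E.prod F).map (fun p => p.1 + p.2) (measurable_fst.add measurable_snd)

end Tensor

section Powers

/-- A bundled separable complex Hilbert space. -/
structure HilbertSp : Type (u + 1) where
  /-- the underlying type -/
  carrier : Type u
  [normedAddCommGroup : NormedAddCommGroup carrier]
  [innerProductSpace : InnerProductSpace ℂ carrier]
  [completeSpace : CompleteSpace carrier]
  [separableSpace : TopologicalSpace.SeparableSpace carrier]

attribute [instance] HilbertSp.normedAddCommGroup HilbertSp.innerProductSpace
  HilbertSp.completeSpace HilbertSp.separableSpace

variable (K : Type u) [NormedAddCommGroup K] [InnerProductSpace ℂ K] [CompleteSpace K]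
  [TopologicalSpace.SeparableSpace K]

/-- The tensor powers `K^{⊗ n}`: `ℂ`, `K`, `K ⊗ K`, `(K ⊗ K) ⊗ K`, ... -/
def tensorPower : ℕ → HilbertSp.{u}
  | 0 => ⟨EuclideanSpace ℂ PUnit.{u + 1}⟩
  | 1 => ⟨K⟩
  | n + 2 => ⟨HilbertTensor (tensorPower (n + 1)).carrier K⟩

variable {K}

/-- The channel `Φ^{⊗ n}` on `K^{⊗ n}`. -/
def QuantumChannel.tensorPow (Φ : QuantumChannel K) :
    (n : ℕ) → QuantumChannel (tensorPower K n).carrier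
  | 0 => QuantumChannel.id _
  | 1 => Φ
  | n + 2 => (Φ.tensorPow (n + 1)).tensor Φ

/-- The spectral measure of `H^{(n)} = H ⊗ I ⊗ ⋯ ⊗ I + ⋯ + I ⊗ ⋯ ⊗ I ⊗ H` on `K^{⊗ n}`, where `E`
is the spectral measure of `H`. -/
def SpectralMeasure.tensorPow (E : SpectralMeasure ℝ≥0 K) :
    (n : ℕ) → SpectralMeasure ℝ≥0 (tensorPower K n).carrier
  | 0 => SpectralMeasure.dirac _ 0
  | 1 => E
  | n + 2 => (E.tensorPow (n + 1)).tensorSum E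

/-- `C` is the constrained classical capacity `C(Φ, H, c) = lim (1/n) C_χ(Φ^{⊗ n}, H^{(n)}, n c)`,
where `E` is the spectral measure of `H`. -/
def IsClassicalCapacity (Φ : QuantumChannel K) (E : SpectralMeasure ℝ≥0 K) (c : ℝ) (C : EReal) :
    Prop :=
  Tendsto (fun n : ℕ => (((n : ℝ)⁻¹ : ℝ) : EReal) *
    chiCapacity (Φ.tensorPow n) (E.tensorPow n) (n * c)) atTop (𝓝 C)

end Powers

section Covariance

variable {K : Type u} [NormedAddCommGroup K] [InnerProductSpace ℂ K] [CompleteSpace K]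
variable (G : Type v) [Group G] [TopologicalSpace G]

variable (K) in
/-- Continuous projective unitary representations `g ↦ V_g` of `G` in `K`. -/
structure ProjectiveUnitaryRep where
  /-- the unitary operators `V_g` -/
  V : G → unitary (K →L[ℂ] K)
  map_mul : ∀ g h, ∃ c : ℂ, ‖c‖ = 1 ∧
    (V (g * h) : K →L[ℂ] K) = c • ((V g : K →L[ℂ] K) * (V h : K →L[ℂ] K))
  continuous : ∀ x y : K, Continuous fun g => ‖⟪x, (V g : K →L[ℂ] K) y⟫_ℂ‖

variable {G}

/-- Covariance `Φ[V_g ρ V_g*] = U_g Φ[ρ] U_g*` of a channel. -/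
def QuantumChannel.IsCovariant (Φ : QuantumChannel K) (V : ProjectiveUnitaryRep K G)
    (U : G → unitary (K →L[ℂ] K)) : Prop :=
  ∀ g ρ, Φ.apply (ρ.conj (V.V g)) = (Φ.apply ρ).conj (U g)

theorem ProjectiveUnitaryRep.measurable_conj [TopologicalSpace.SeparableSpace K]
    [MeasurableSpace G] [BorelSpace G]
    (V : ProjectiveUnitaryRep K G) (ρ : DensityOperator K) :
    Measurable fun g => ρ.conj (V.V g) := by
  obtain ⟨h1, h2⟩ := sqrt_props ρ.isPositive
  set R := CFC.sqrt ρ.op with hR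
  have hdiag : ∀ x : K, Measurable fun g => ⟪(ρ.conj (V.V g)).op x, x⟫_ℂ := by
    intro x
    have e : ∀ g, ⟪(ρ.conj (V.V g)).op x, x⟫_ℂ = ((∑' i, ENNReal.ofReal
        (‖⟪x, (V.V g : K →L[ℂ] K) (R (stdBasis K i))⟫_ℂ‖ ^ 2)).toReal : ℂ) := by
      intro g
      have e0 : (ρ.conj (V.V g)).op = star (R * star (V.V g : K →L[ℂ] K)) *
          (R * star (V.V g : K →L[ℂ] K)) := by
        change (V.V g : K →L[ℂ] K) * ρ.op * star (V.V g : K →L[ℂ] K) = _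
        rw [star_mul, star_star, h1, ← h2]; simp only [mul_assoc]
      have e1 : ∀ i, ‖⟪x, (V.V g : K →L[ℂ] K) (R (stdBasis K i))⟫_ℂ‖ =
          ‖⟪stdBasis K i, (R * star (V.V g : K →L[ℂ] K)) x⟫_ℂ‖ := by
        intro i
        change _ = ‖⟪stdBasis K i, R (star (V.V g : K →L[ℂ] K) x)⟫_ℂ‖
        rw [← ContinuousLinearMap.adjoint_inner_left, ← ContinuousLinearMap.star_eq_adjoint,
          ← ContinuousLinearMap.adjoint_inner_left R, ← ContinuousLinearMap.star_eq_adjoint, h1,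
          norm_inner_symm, ← ContinuousLinearMap.adjoint_inner_left R,
          ← ContinuousLinearMap.star_eq_adjoint, h1]
      simp_rw [e1]
      rw [tsum_norm_inner_sq, ENNReal.toReal_ofReal (by positivity), e0,
        ContinuousLinearMap.star_eq_adjoint]
      change ⟪(ContinuousLinearMap.adjoint (R * star (V.V g : K →L[ℂ] K)))
        ((R * star (V.V g : K →L[ℂ] K)) x), x⟫_ℂ = _
      rw [ContinuousLinearMap.adjoint_inner_left, inner_self_eq_norm_sq_to_K]
      norm_cast
    simp_rw [e]
    refine Complex.measurable_ofReal.comp (Measurable.ennreal_toReal ?_)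
    refine Measurable.tsum fun i => ?_
    exact (((V.continuous x _).pow 2).measurable).ennreal_ofReal
  rw [DensityOperator.measurable_iff]
  intro x y
  have hpol : ∀ g, ⟪x, (ρ.conj (V.V g)).op y⟫_ℂ = ⟪(ρ.conj (V.V g)).op x, y⟫_ℂ := fun g =>
    ((ρ.conj (V.V g)).isPositive.inner_left_eq_inner_right x y).symm
  simp_rw [hpol]
  have hp := fun g => inner_map_polarization' ((ρ.conj (V.V g)).op : K →ₗ[ℂ] K) x y
  simp only [ContinuousLinearMap.coe_coe] at hp
  simp_rw [hp]
  exact ((((hdiag _).sub (hdiag _)).sub ((hdiag _).const_mul _)).add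
    ((hdiag _).const_mul _)).div_const _

/-- The generalized ensemble of the states `V_g ρ V_g*` with distribution `π(dg)`. -/
def ProjectiveUnitaryRep.orbitEnsemble [TopologicalSpace.SeparableSpace K]
    [MeasurableSpace G] [BorelSpace G] (V : ProjectiveUnitaryRep K G)
    (π : Measure G) [IsProbabilityMeasure π] (ρ : DensityOperator K) :
    GeneralizedEnsemble K G where
  prob := π
  state g := ρ.conj (V.V g)
  measurable_state := V.measurable_conj ρ

end Covariance

end QInfo

end

open QInfo

noncomputable section

namespace QInfo

universe u v w

set_option linter.unusedSectionVars false

/-! ### Trace-class operators: basis independence of the trace and norm bounds -/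

section TraceClass

variable {K : Type u} [NormedAddCommGroup K] [InnerProductSpace ℂ K] [CompleteSpace K]

/-! For an ensemble obeying the constraint, the average state lies in the constrained set and each
member has output entropy at least the minimum, so χ is at most the maximal minus the minimal output
entropy. Covariance makes this bound attained: conjugation by unitaries preserves entropy, so every
state V_g ρ₀ V_g* has minimal output entropy, while the average of the orbit is ρ_E⁰, whose output
entropy is maximal (`chiCapacity_eq_of_optimal`). The group G need not be a standard Borel space;
`chi_le_chiCapacity` therefore replaces an ensemble by its image on the space of matrices of states.

For n copies the same criterion is applied to the n-fold product ensemble. Its members have output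
entropy n S(Φ[ρ₀]), which is minimal by the additivity assumption. Its average is the n-fold power
of ρ_E⁰, and it has to be shown that this state maximizes the output entropy under the constraint
nE. For a state ω of n copies, subadditivity of entropy bounds S(Φ^{⊗n}[ω]) by the sum of the output
entropies of its one-copy marginals, and concavity bounds that sum by n S(Φ[τ]), where τ is the mean
of the marginals. Energy is additive over marginals and affine, so n Tr τH equals the energy of ω,
and τ obeys the one-copy constraint (`exists_outputEntropy_tensorPow_le`). The normalized capacities
are then constant for n ≥ 1.

Much of the work lies beneath this argument. The channel Φ ⊗ Ψ is constructed as a composition of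
two amplifications (`exists_isChannelTensor`), and its compatibility with partial traces follows
from testing on products (`traceClass_map_ext`). The product spectral measure comes from a π-λ
induction (`exists_isProdValue`). The entropy inequalities (`entropy_mix_ge`, `entropy_tensor`,
`entropy_le_add`) reduce to scalar inequalities for η(x) = -x log x, because the entropy is at most
the entropy of the diagonal in any orthonormal basis, with equality in an eigenbasis. -/

theorem isPositive_of_inner_nonneg {A : K →L[ℂ] K} (h : ∀ x, 0 ≤ ⟪x, A x⟫_ℂ) : A.IsPositive := by
  rw [ContinuousLinearMap.isPositive_iff_complex]
  intro x
  obtain ⟨h2, h3⟩ := Complex.nonneg_iff.1 (h x)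
  have h4 : ⟪A x, x⟫_ℂ = ⟪x, A x⟫_ℂ := by
    rw [← inner_conj_symm]
    exact Complex.conj_eq_iff_im.2 h3.symm
  rw [h4]
  exact ⟨Complex.ext (by simp) (by simpa using h3), h2⟩

theorem inner_eq_ofReal {A : K →L[ℂ] K} (hA : A.IsPositive) (x : K) :
    ⟪x, A x⟫_ℂ = ((⟪x, A x⟫_ℂ).re : ℂ) :=
  Complex.ext (by simp) (by simpa using (Complex.nonneg_iff.1 (hA.inner_nonneg_right x)).2.symm)

theorem re_inner_nonneg {A : K →L[ℂ] K} (hA : A.IsPositive) (x : K) : 0 ≤ (⟪x, A x⟫_ℂ).re :=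
  (Complex.nonneg_iff.1 (hA.inner_nonneg_right x)).1

theorem inner_star_left (A : K →L[ℂ] K) (x y : K) : ⟪star A x, y⟫_ℂ = ⟪x, A y⟫_ℂ := by
  rw [ContinuousLinearMap.star_eq_adjoint, ContinuousLinearMap.adjoint_inner_left]

theorem inner_star_right (A : K →L[ℂ] K) (x y : K) : ⟪x, star A y⟫_ℂ = ⟪A x, y⟫_ℂ := by
  rw [ContinuousLinearMap.star_eq_adjoint, ContinuousLinearMap.adjoint_inner_right]

theorem isPositive_star_mul_self (A : K →L[ℂ] K) : (star A * A).IsPositive :=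
  isPositive_of_inner_nonneg fun x => by
    change 0 ≤ ⟪x, star A (A x)⟫_ℂ
    rw [inner_star_right, inner_self_eq_norm_sq_to_K]
    positivity

theorem hasSum_inner_of_isPositive {ι : Type*} (b : HilbertBasis ι ℂ K) {A : K →L[ℂ] K}
    (hA : A.IsPositive) (hfin : posTrace A ≠ ∞) :
    HasSum (fun i => ⟪b i, A (b i)⟫_ℂ) ((posTrace A).toReal : ℂ) := by
  rw [posTrace_eq_tsum b hA] at hfin ⊢
  have h := ENNReal.hasSum_toReal hfin
  rw [ENNReal.tsum_toReal_eq (fun i => ENNReal.ofReal_ne_top)]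
  have h2 := Complex.hasSum_ofReal.2 h
  convert h2 using 2 with i
  rw [ENNReal.toReal_ofReal (re_inner_nonneg hA _)]
  exact inner_eq_ofReal hA _

/-- On the positive generators both diagonal series sum to `posTrace`; a common value of the two
series is preserved by linear combinations. -/
theorem hasSum_trace {ι : Type*} (b : HilbertBasis ι ℂ K) (A : traceClass K) :
    HasSum (fun i => ⟪b i, (A : K →L[ℂ] K) (b i)⟫_ℂ) (trace A) := by
  have key : ∀ A ∈ traceClass K, ∃ t, HasSum (fun i => ⟪b i, A (b i)⟫_ℂ) t ∧
      HasSum (fun i => ⟪stdBasis K i, A (stdBasis K i)⟫_ℂ) t := by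
    intro A hA
    induction hA using Submodule.span_induction with
    | mem A hA => exact ⟨_, hasSum_inner_of_isPositive b hA.1 hA.2.ne,
        hasSum_inner_of_isPositive _ hA.1 hA.2.ne⟩
    | zero => exact ⟨0, by simp, by simp⟩
    | add A B _ _ hA hB =>
      obtain ⟨s, h1, h2⟩ := hA
      obtain ⟨t, h3, h4⟩ := hB
      exact ⟨s + t, by simpa [inner_add_right] using h1.add h3,
        by simpa [inner_add_right] using h2.add h4⟩
    | smul c A _ hA =>
      obtain ⟨s, h1, h2⟩ := hA
      exact ⟨c * s, by simpa [inner_smul_right] using h1.mul_left c,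
        by simpa [inner_smul_right] using h2.mul_left c⟩
  obtain ⟨t, h1, h2⟩ := key A A.2
  rwa [trace, h2.tsum_eq]

theorem trace_add (A B : traceClass K) : trace (A + B) = trace A + trace B :=
  (hasSum_trace (stdBasis K) (A + B)).unique <| by
    simpa [inner_add_right] using (hasSum_trace (stdBasis K) A).add (hasSum_trace (stdBasis K) B)

theorem trace_smul (c : ℂ) (A : traceClass K) : trace (c • A) = c * trace A :=
  (hasSum_trace (stdBasis K) (c • A)).unique <| by
    simpa [inner_smul_right] using (hasSum_trace (stdBasis K) A).mul_left c

theorem posTrace_lt_top {A : traceClass K} (hA : (A : K →L[ℂ] K).IsPositive) :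
    posTrace (A : K →L[ℂ] K) < ∞ := by
  rw [ofReal_re_trace hA]; exact ENNReal.ofReal_lt_top

theorem trace_eq_posTrace {A : traceClass K} (hA : (A : K →L[ℂ] K).IsPositive) :
    trace A = ((posTrace (A : K →L[ℂ] K)).toReal : ℂ) :=
  (hasSum_trace (stdBasis K) A).unique
    (hasSum_inner_of_isPositive (stdBasis K) hA (posTrace_lt_top hA).ne)

theorem mem_traceClass {A : K →L[ℂ] K} (hA : A.IsPositive) (h : posTrace A ≠ ∞) :
    A ∈ traceClass K := Submodule.subset_span ⟨hA, h.lt_top⟩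

/-- A property of trace-class operators that is stable under linear combinations holds for all of
them as soon as it holds for the positive ones. -/
theorem traceClass_induction {p : traceClass K → Prop}
    (pos : ∀ A : traceClass K, (A : K →L[ℂ] K).IsPositive → p A)
    (add : ∀ A B, p A → p B → p (A + B)) (smul : ∀ (c : ℂ) A, p A → p (c • A))
    (A : traceClass K) : p A := by
  obtain ⟨A, hA⟩ := A
  induction hA using Submodule.span_induction with
  | mem A hA => exact pos _ hA.1
  | zero => exact pos _ ContinuousLinearMap.isPositive_zero
  | add A B _ _ hA hB => exact add ⟨A, _⟩ ⟨B, _⟩ hA hB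
  | smul c A _ hA => exact smul c ⟨A, _⟩ hA

/-- The operator norm is at most the Hilbert–Schmidt norm: expand `R x` in the basis and apply
Cauchy–Schwarz to each coefficient ⟨R* eᵢ, x⟩. -/
theorem ofReal_norm_sq_apply_le (R : K →L[ℂ] K) (x : K) :
    ENNReal.ofReal (‖R x‖ ^ 2) ≤ posTrace (star R * R) * ENNReal.ofReal (‖x‖ ^ 2) := by
  calc ENNReal.ofReal (‖R x‖ ^ 2)
      = ∑' i, ENNReal.ofReal (‖⟪stdBasis K i, R x⟫_ℂ‖ ^ 2) := (tsum_norm_inner_sq _ _).symm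
    _ = ∑' i, ENNReal.ofReal (‖⟪star R (stdBasis K i), x⟫_ℂ‖ ^ 2) := by
        simp_rw [inner_star_left]
    _ ≤ ∑' i, ENNReal.ofReal (‖star R (stdBasis K i)‖ ^ 2) * ENNReal.ofReal (‖x‖ ^ 2) := by
        refine ENNReal.tsum_le_tsum fun i => ?_
        rw [← ENNReal.ofReal_mul (by positivity), ← mul_pow]
        gcongr
        exact norm_inner_le_norm _ _
    _ = _ := by
        rw [ENNReal.tsum_mul_right, posTrace_star_mul_self (stdBasis K) R,
          ← tsum_norm_sq_adjoint]

theorem re_inner_sqrt {A : K →L[ℂ] K} (hA : A.IsPositive) (x : K) :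
    (⟪x, A x⟫_ℂ).re = ‖CFC.sqrt A x‖ ^ 2 := by
  obtain ⟨h1, h2⟩ := sqrt_props hA
  conv_lhs => rw [← h2]
  rw [← re_inner_star_mul_self, h1]

theorem posTrace_eq_tsum_sqrt {ι : Type*} (b : HilbertBasis ι ℂ K) {A : K →L[ℂ] K}
    (hA : A.IsPositive) :
    posTrace A = ∑' i, ENNReal.ofReal (‖CFC.sqrt A (b i)‖ ^ 2) := by
  rw [posTrace_eq_tsum b hA]
  simp_rw [re_inner_sqrt hA]

theorem norm_sqrt_apply_sq_le {A : K →L[ℂ] K} (hA : A.IsPositive) (hfin : posTrace A ≠ ∞) (x : K) :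
    ‖CFC.sqrt A x‖ ^ 2 ≤ (posTrace A).toReal * ‖x‖ ^ 2 := by
  obtain ⟨h1, h2⟩ := sqrt_props hA
  have h := ofReal_norm_sq_apply_le (CFC.sqrt A) x
  rw [h1, h2, ← ENNReal.ofReal_toReal hfin, ← ENNReal.ofReal_mul (by positivity),
    ENNReal.ofReal_le_ofReal_iff (by positivity)] at h
  exact h

/-- ‖A‖ ≤ ‖√A‖², and the squared Hilbert–Schmidt norm of √A is Tr A. This gives norm convergence of
partial traces and compactness of states. -/
theorem norm_le_posTrace {A : K →L[ℂ] K} (hA : A.IsPositive) (hfin : posTrace A ≠ ∞) :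
    ‖A‖ ≤ (posTrace A).toReal := by
  obtain ⟨h1, h2⟩ := sqrt_props hA
  have h3 : ‖CFC.sqrt A‖ ≤ √(posTrace A).toReal := by
    refine ContinuousLinearMap.opNorm_le_bound _ (by positivity) fun x => ?_
    refine le_of_sq_le_sq ?_ (by positivity)
    rw [mul_pow, Real.sq_sqrt (by positivity)]
    exact norm_sqrt_apply_sq_le hA hfin x
  calc ‖A‖ = ‖CFC.sqrt A * CFC.sqrt A‖ := by rw [h2]
    _ ≤ ‖CFC.sqrt A‖ * ‖CFC.sqrt A‖ := norm_mul_le _ _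
    _ ≤ √(posTrace A).toReal * √(posTrace A).toReal := by gcongr
    _ = _ := Real.mul_self_sqrt (by positivity)

end TraceClass

/-! ### Positive semidefinite infinite matrices and the operators they define -/

section Matrix

variable {K : Type u} [NormedAddCommGroup K] [InnerProductSpace ℂ K] [CompleteSpace K]
variable {ι : Type v}

/-- Positive semidefiniteness of an infinite matrix. -/
def PosSemidefMatrix (x : ι → ι → ℂ) : Prop :=
  ∀ (s : Finset ι) (v : ι → ℂ), 0 ≤ ∑ i ∈ s, ∑ j ∈ s, starRingEnd ℂ (v i) * (x i j * v j)

open Classical in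
theorem PosSemidefMatrix.two {x : ι → ι → ℂ} (h : PosSemidefMatrix x) {i j : ι} (hij : i ≠ j)
    (a c : ℂ) : 0 ≤ starRingEnd ℂ a * (x i i * a) + starRingEnd ℂ a * (x i j * c) +
      (starRingEnd ℂ c * (x j i * a) + starRingEnd ℂ c * (x j j * c)) := by
  have := h {i, j} (fun k => if k = i then a else c)
  simpa [Finset.sum_pair hij, hij.symm] using this

theorem PosSemidefMatrix.diag {x : ι → ι → ℂ} (h : PosSemidefMatrix x) (i : ι) : 0 ≤ x i i := by
  simpa using h {i} (fun _ => 1)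

/-- The quadratic form takes real values; the vectors (1, 1) and (1, i) compare the imaginary and
the real parts of the two off-diagonal entries. -/
theorem PosSemidefMatrix.conj_symm {x : ι → ι → ℂ} (h : PosSemidefMatrix x) (i j : ι) :
    starRingEnd ℂ (x i j) = x j i := by
  by_cases hij : i = j
  · subst hij
    exact Complex.conj_eq_iff_im.2 (Complex.nonneg_iff.1 (h.diag i)).2.symm
  · have hi := (Complex.nonneg_iff.1 (h.diag i)).2
    have hj := (Complex.nonneg_iff.1 (h.diag j)).2
    have h1 := (Complex.nonneg_iff.1 (h.two hij 1 1)).2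
    have h2 := (Complex.nonneg_iff.1 (h.two hij 1 Complex.I)).2
    simp at h1 h2
    apply Complex.ext <;> simp <;> linarith

/-- This is nonnegativity of the 2 × 2 minors. Evaluating the form at (t xᵢⱼ, 1) gives a real
quadratic in t without sign change, whose discriminant is nonpositive; a factor ‖xᵢⱼ‖² is then
cancelled. -/
theorem PosSemidefMatrix.norm_sq_le {x : ι → ι → ℂ} (h : PosSemidefMatrix x) (i j : ι) :
    ‖x i j‖ ^ 2 ≤ (x i i).re * (x j j).re := by
  have hi := (Complex.nonneg_iff.1 (h.diag i)).2
  have hj := (Complex.nonneg_iff.1 (h.diag j)).2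
  have ei : x i i = ((x i i).re : ℂ) := Complex.ext (by simp) (by simpa using hi.symm)
  have ej : x j j = ((x j j).re : ℂ) := Complex.ext (by simp) (by simpa using hj.symm)
  by_cases hij : i = j
  · subst hij
    rw [ei]
    simp [sq]
  · have hs := h.conj_symm i j
    have key : ∀ t : ℝ, 0 ≤ (x i i).re * ‖x i j‖ ^ 2 * (t * t) +
        2 * ‖x i j‖ ^ 2 * t + (x j j).re := by
      intro t
      have h1 := h.two hij (t * x i j) 1
      have e : starRingEnd ℂ (t * x i j) * (x i i * (t * x i j)) +
          starRingEnd ℂ (t * x i j) * (x i j * 1) +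
          (starRingEnd ℂ (1 : ℂ) * (x j i * (t * x i j)) + starRingEnd ℂ (1 : ℂ) * (x j j * 1)) =
          (((x i i).re * ‖x i j‖ ^ 2 * (t * t) + 2 * ‖x i j‖ ^ 2 * t + (x j j).re : ℝ) : ℂ) := by
        rw [← hs]
        simp only [map_mul, Complex.conj_ofReal, map_one]
        have e2 : starRingEnd ℂ (x i j) * x i j = ((‖x i j‖ ^ 2 : ℝ) : ℂ) := by
          rw [mul_comm, Complex.mul_conj, Complex.normSq_eq_norm_sq]
        push_cast at e2 ⊢
        rw [← ei, ← ej]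
        linear_combination ((t : ℂ) * t * x i i + 2 * t) * e2
      rw [e] at h1
      exact_mod_cast h1
    have hd := discrim_le_zero key
    rw [discrim] at hd
    have hnn : 0 ≤ ‖x i j‖ ^ 2 := by positivity
    have hii := (Complex.nonneg_iff.1 (h.diag i)).1
    have hjj := (Complex.nonneg_iff.1 (h.diag j)).1
    rcases hnn.eq_or_lt with h0 | h0
    · rw [← h0]; positivity
    · nlinarith

/-- A positive semidefinite infinite matrix with summable diagonal is the matrix of a positive
operator in a given orthonormal basis. -/
theorem PosSemidefMatrix.exists_isPositive {x : ι → ι → ℂ} (h : PosSemidefMatrix x)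
    (hs : Summable fun i => (x i i).re) (b : HilbertBasis ι ℂ K) :
    ∃ T : K →L[ℂ] K, T.IsPositive ∧ ∀ i j, ⟪b i, T (b j)⟫_ℂ = x i j := by
  classical
  set τ : ℝ := ∑' i, (x i i).re
  have hd : ∀ i, 0 ≤ (x i i).re := fun i => (Complex.nonneg_iff.1 (h.diag i)).1
  have hcol : ∀ j, Summable fun i => ‖x i j‖ ^ 2 := fun j =>
    Summable.of_nonneg_of_le (fun _ => by positivity) (fun i => h.norm_sq_le i j)
      (hs.mul_right _)
  have hmem : ∀ j, Memℓp (fun i => x i j) 2 := fun j => memℓp_gen (by simpa using hcol j)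
  -- The intended columns of the operator. They are square summable because the minor inequality
  -- bounds |xᵢⱼ|² by xᵢᵢ xⱼⱼ.
  set c : ι → K := fun j => b.repr.symm ⟨fun i => x i j, hmem j⟩ with hc
  have hbc : ∀ i j, ⟪b i, c j⟫_ℂ = x i j := by
    intro i j
    rw [← b.repr_apply_apply, hc]
    simp
  have hcn : ∀ j, ‖c j‖ ^ 2 ≤ τ * (x j j).re := by
    intro j
    have h1 := tsum_norm_inner_sq b (c j)
    simp_rw [hbc] at h1
    rw [← ENNReal.ofReal_tsum_of_nonneg (fun _ => by positivity) (hcol j),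
      ENNReal.ofReal_eq_ofReal_iff (tsum_nonneg fun _ => by positivity) (by positivity)] at h1
    rw [← h1, ← tsum_mul_right]
    exact (hcol j).tsum_le_tsum (fun i => h.norm_sq_le i j) (hs.mul_right _)
  have hcs : Summable fun j => ‖c j‖ ^ 2 :=
    Summable.of_nonneg_of_le (fun _ => by positivity) hcn (hs.mul_left _)
  have hvs : ∀ v : K, HasSum (fun j => ‖⟪b j, v⟫_ℂ‖ ^ 2) (‖v‖ ^ 2) := by
    intro v
    have h1 := tsum_norm_inner_sq b v
    have h2 : Summable fun j => ‖⟪b j, v⟫_ℂ‖ ^ 2 := b.orthonormal.inner_products_summable v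
    rw [← ENNReal.ofReal_tsum_of_nonneg (fun _ => by positivity) h2,
      ENNReal.ofReal_eq_ofReal_iff (tsum_nonneg fun _ => by positivity) (by positivity)] at h1
    rw [← h1]
    exact h2.hasSum
  have hns : ∀ v : K, Summable fun j => ‖⟪b j, v⟫_ℂ‖ * ‖c j‖ := by
    intro v
    refine Summable.of_nonneg_of_le (fun _ => by positivity) (fun j => ?_)
      ((hvs v).summable.add hcs)
    nlinarith [sq_nonneg (‖⟪b j, v⟫_ℂ‖ - ‖c j‖), sq_nonneg (‖⟪b j, v⟫_ℂ‖ + ‖c j‖)]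
  have hsum : ∀ v : K, Summable fun j => ⟪b j, v⟫_ℂ • c j := fun v =>
    Summable.of_norm (by simpa only [norm_smul] using hns v)
  let T₀ : K →ₗ[ℂ] K :=
    { toFun := fun v => ∑' j, ⟪b j, v⟫_ℂ • c j
      map_add' := fun v w => by
        simp only [inner_add_right, add_smul]
        exact (hsum v).tsum_add (hsum w)
      map_smul' := fun a v => by
        simp only [inner_smul_right, mul_smul, RingHom.id_apply]
        exact (hsum v).tsum_const_smul a }
  -- Cauchy–Schwarz between the coefficients of `v` and the column norms bounds the operator by the
  -- Hilbert–Schmidt norm of the matrix.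
  let T : K →L[ℂ] K := T₀.mkContinuous (√(∑' j, ‖c j‖ ^ 2)) (fun v => by
    have h1 := Real.inner_le_Lp_mul_Lq_tsum_of_nonneg (p := 2) (q := 2)
      (Real.holderConjugate_iff.2 ⟨by norm_num, by norm_num⟩)
      (f := fun j => ‖⟪b j, v⟫_ℂ‖) (g := fun j => ‖c j‖)
      (fun _ => norm_nonneg _) (fun _ => norm_nonneg _)
      (by simpa using (hvs v).summable) (by simpa using hcs)
    simp only [Real.rpow_ofNat, (hvs v).tsum_eq, ← Real.sqrt_eq_rpow] at h1
    rw [Real.sqrt_sq (norm_nonneg v), mul_comm] at h1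
    refine le_trans ?_ h1
    have h2 : Summable fun j => ‖⟪b j, v⟫_ℂ • c j‖ := by simpa only [norm_smul] using hns v
    refine (norm_tsum_le_tsum_norm h2).trans ?_
    simp only [norm_smul]
    exact le_rfl)
  have hT : ∀ j, T (b j) = c j := by
    intro j
    change ∑' k, ⟪b k, b j⟫_ℂ • c k = c j
    rw [tsum_eq_single j]
    · rw [inner_self_eq_norm_sq_to_K, b.orthonormal.1 j]; simp
    · intro k hk
      rw [b.orthonormal.2 hk, zero_smul]
  have hTx : ∀ i j, ⟪b i, T (b j)⟫_ℂ = x i j := fun i j => by rw [hT, hbc]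
  refine ⟨T, isPositive_of_inner_nonneg fun v => ?_, hTx⟩
  -- Finite truncations of `v` converge to `v`, and on them the form of `T` is a finite section of
  -- the matrix.
  have hlim : Tendsto (fun s : Finset ι => ∑ i ∈ s, ⟪b i, v⟫_ℂ • b i) atTop (𝓝 v) := by
    have := b.hasSum_repr v
    simp_rw [b.repr_apply_apply] at this
    exact this
  have hlim2 : Tendsto (fun s : Finset ι =>
      ⟪∑ i ∈ s, ⟪b i, v⟫_ℂ • b i, T (∑ i ∈ s, ⟪b i, v⟫_ℂ • b i)⟫_ℂ) atTop (𝓝 ⟪v, T v⟫_ℂ) :=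
    hlim.inner ((T.continuous.tendsto v).comp hlim)
  refine ge_of_tendsto' hlim2 fun s => ?_
  convert h s (fun i => ⟪b i, v⟫_ℂ) using 1
  simp only [map_sum, map_smul, sum_inner, inner_sum, inner_smul_left, inner_smul_right, hTx,
    Finset.mul_sum]
  rw [Finset.sum_comm]
  refine Finset.sum_congr rfl fun i _ => Finset.sum_congr rfl fun j _ => ?_
  ring

theorem clm_ext_basis {T S : K →L[ℂ] K} (b : HilbertBasis ι ℂ K)
    (h : ∀ i j, ⟪b i, T (b j)⟫_ℂ = ⟪b i, S (b j)⟫_ℂ) : T = S := by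
  have h1 : ∀ j, T (b j) = S (b j) := fun j => by
    apply b.repr.injective
    ext i
    rw [b.repr_apply_apply, b.repr_apply_apply, h]
  refine ContinuousLinearMap.ext_on (s := Set.range b) ?_ ?_
  · exact (Submodule.dense_iff_topologicalClosure_eq_top).2 b.dense_span
  · rintro _ ⟨j, rfl⟩
    exact h1 j

end Matrix

/-! ### Compressions A ↦ B* A C between trace classes -/

section Sandwich

variable {K : Type u} [NormedAddCommGroup K] [InnerProductSpace ℂ K] [CompleteSpace K]
variable {M : Type v} [NormedAddCommGroup M] [InnerProductSpace ℂ M] [CompleteSpace M]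

/-- The operator `B* A C`. -/
def sandwich (B C : K →L[ℂ] M) (A : M →L[ℂ] M) : K →L[ℂ] K :=
  (ContinuousLinearMap.adjoint B).comp (A.comp C)

theorem inner_sandwich (B C : K →L[ℂ] M) (A : M →L[ℂ] M) (x y : K) :
    ⟪x, sandwich B C A y⟫_ℂ = ⟪B x, A (C y)⟫_ℂ := by
  rw [sandwich, ContinuousLinearMap.comp_apply, ContinuousLinearMap.adjoint_inner_right]
  rfl

theorem sandwich_add (B C : K →L[ℂ] M) (A A' : M →L[ℂ] M) :
    sandwich B C (A + A') = sandwich B C A + sandwich B C A' := by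
  ext x; simp [sandwich]

theorem sandwich_smul (B C : K →L[ℂ] M) (c : ℂ) (A : M →L[ℂ] M) :
    sandwich B C (c • A) = c • sandwich B C A := by
  ext x; simp [sandwich]

theorem isPositive_sandwich (W : K →L[ℂ] M) {A : M →L[ℂ] M} (hA : A.IsPositive) :
    (sandwich W W A).IsPositive :=
  isPositive_of_inner_nonneg fun x => by
    rw [inner_sandwich]; exact hA.inner_nonneg_right _

/-- Tr W* A W is the squared Hilbert–Schmidt norm of √A W, hence that of its adjoint W* √A, where
‖W‖² can be pulled out of each term. -/
theorem posTrace_sandwich_le (W : K →L[ℂ] M) {A : M →L[ℂ] M} (hA : A.IsPositive) :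
    posTrace (sandwich W W A) ≤ ENNReal.ofReal (‖W‖ ^ 2) * posTrace A := by
  obtain ⟨h1, -⟩ := sqrt_props hA
  set R := CFC.sqrt A
  calc posTrace (sandwich W W A)
      = ∑' k, ENNReal.ofReal (‖R (W (stdBasis K k))‖ ^ 2) := by
        simp_rw [posTrace, inner_sandwich, re_inner_sqrt hA]; rfl
    _ = ∑' k, ∑' l, ENNReal.ofReal (‖⟪stdBasis M l, R (W (stdBasis K k))⟫_ℂ‖ ^ 2) := by
        simp_rw [tsum_norm_inner_sq]
    _ = ∑' l, ∑' k, ENNReal.ofReal (‖⟪stdBasis M l, R (W (stdBasis K k))⟫_ℂ‖ ^ 2) :=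
        ENNReal.tsum_comm
    _ = ∑' l, ENNReal.ofReal (‖ContinuousLinearMap.adjoint W (R (stdBasis M l))‖ ^ 2) := by
        congr 1; ext l
        rw [← tsum_norm_inner_sq (stdBasis K)]
        congr 1; ext k
        rw [ContinuousLinearMap.adjoint_inner_right, norm_inner_symm, ← h1, inner_star_right, h1]
    _ ≤ ∑' l, ENNReal.ofReal (‖W‖ ^ 2) * ENNReal.ofReal (‖R (stdBasis M l)‖ ^ 2) := by
        refine ENNReal.tsum_le_tsum fun l => ?_
        rw [← ENNReal.ofReal_mul (by positivity), ← mul_pow]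
        gcongr
        refine (ContinuousLinearMap.le_opNorm _ _).trans (le_of_eq ?_)
        rw [LinearIsometryEquiv.norm_map]
    _ = _ := by rw [ENNReal.tsum_mul_left, ← posTrace_eq_tsum_sqrt _ hA]

theorem sandwich_mem_traceClass_self (W : K →L[ℂ] M) (A : traceClass M) :
    sandwich W W (A : M →L[ℂ] M) ∈ traceClass K := by
  induction A using traceClass_induction with
  | pos A hA =>
    exact mem_traceClass (isPositive_sandwich W hA)
      ((posTrace_sandwich_le W hA).trans_lt
        (ENNReal.mul_lt_top ENNReal.ofReal_lt_top (posTrace_lt_top hA))).ne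
  | add A B hA hB => rw [Submodule.coe_add, sandwich_add]; exact Submodule.add_mem _ hA hB
  | smul c A hA => rw [Submodule.coe_smul, sandwich_smul]; exact Submodule.smul_mem _ _ hA

/-- Reduces trace-class membership for different outer operators to the case B = C, which preserves
positivity. -/
theorem sandwich_polarization (B C : K →L[ℂ] M) (A : M →L[ℂ] M) :
    sandwich B C A = (1 / 4 : ℂ) • (sandwich (B + C) (B + C) A - sandwich (B - C) (B - C) A
      - Complex.I • sandwich (B + Complex.I • C) (B + Complex.I • C) A
      + Complex.I • sandwich (B - Complex.I • C) (B - Complex.I • C) A) := by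
  refine ContinuousLinearMap.ext fun y => ext_inner_left ℂ fun x => ?_
  simp only [smul_apply, add_apply,
    sub_apply, inner_smul_right, inner_add_right, inner_sub_right,
    inner_sandwich, inner_add_left, inner_sub_left, map_add, map_sub, map_smul, inner_smul_left,
    Complex.conj_I]
  linear_combination (1 / 4) * (2 * ⟪B x, A (C y)⟫_ℂ - 2 * ⟪C x, A (B y)⟫_ℂ) * Complex.I_mul_I

theorem sandwich_mem_traceClass (B C : K →L[ℂ] M) (A : traceClass M) :
    sandwich B C (A : M →L[ℂ] M) ∈ traceClass K := by
  have h := fun W : K →L[ℂ] M => sandwich_mem_traceClass_self W A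
  rw [sandwich_polarization]
  exact Submodule.smul_mem _ _ (Submodule.add_mem _ (Submodule.sub_mem _ (Submodule.sub_mem _
    (h _) (h _)) (Submodule.smul_mem _ _ (h _))) (Submodule.smul_mem _ _ (h _)))

/-- `A ↦ B* A C` as a linear map of trace classes. -/
def sandwichₗ (B C : K →L[ℂ] M) : traceClass M →ₗ[ℂ] traceClass K where
  toFun A := ⟨sandwich B C A, sandwich_mem_traceClass B C A⟩
  map_add' A A' := Subtype.ext (sandwich_add B C A A')
  map_smul' c A := Subtype.ext (sandwich_smul B C c A)

@[simp]
theorem coe_sandwichₗ (B C : K →L[ℂ] M) (A : traceClass M) :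
    (sandwichₗ B C A : K →L[ℂ] K) = sandwich B C A := rfl

end Sandwich

/-! ### Complete positivity over arbitrary finite index sets -/

section CompletePositivity

variable {K : Type u} [NormedAddCommGroup K] [InnerProductSpace ℂ K] [CompleteSpace K]

/-- Transport of the `Fin m` formulation along a numbering of `s`; vectors given on `s` are extended
by zero to test the hypothesis. -/
theorem QuantumChannel.sum_inner_nonneg (Φ : QuantumChannel K) {α : Type*} (s : Finset α)
    (A : α → α → traceClass K)
    (h : ∀ x : α → K, 0 ≤ ∑ i ∈ s, ∑ j ∈ s, ⟪x i, (A i j : K →L[ℂ] K) (x j)⟫_ℂ) (x : α → K) :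
    0 ≤ ∑ i ∈ s, ∑ j ∈ s, ⟪x i, (Φ.toLinearMap (A i j) : K →L[ℂ] K) (x j)⟫_ℂ := by
  classical
  have key : ∀ F : α → α → ℂ, ∑ i ∈ s, ∑ j ∈ s, F i j =
      ∑ a : Fin s.card, ∑ c : Fin s.card, F (s.equivFin.symm a) (s.equivFin.symm c) := by
    intro F
    rw [← Finset.sum_coe_sort s, ← Equiv.sum_comp s.equivFin.symm]
    refine Finset.sum_congr rfl fun a _ => ?_
    rw [← Finset.sum_coe_sort s, ← Equiv.sum_comp s.equivFin.symm]
  rw [key]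
  refine Φ.completely_positive s.card
    (fun a c => A (s.equivFin.symm a) (s.equivFin.symm c)) (fun y => ?_)
    (fun a => x (s.equivFin.symm a))
  have h1 := h (fun i => if hi : i ∈ s then y (s.equivFin ⟨i, hi⟩) else 0)
  rw [key] at h1
  simpa using h1

theorem QuantumChannel.isPositive (Φ : QuantumChannel K) {A : traceClass K}
    (hA : (A : K →L[ℂ] K).IsPositive) : (Φ.toLinearMap A : K →L[ℂ] K).IsPositive :=
  isPositive_of_inner_nonneg fun x => by
    simpa using Φ.sum_inner_nonneg {()} (fun _ _ => A)
      (fun y => by simpa using hA.inner_nonneg_right _) (fun _ => x)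

theorem QuantumChannel.posTrace_apply (Φ : QuantumChannel K) {A : traceClass K}
    (hA : (A : K →L[ℂ] K).IsPositive) :
    posTrace (Φ.toLinearMap A : K →L[ℂ] K) = posTrace (A : K →L[ℂ] K) := by
  rw [ofReal_re_trace hA, ofReal_re_trace (Φ.isPositive hA), Φ.trace_preserving]

end CompletePositivity

/-! ### Direct sums of copies of a space: partial trace and amplification -/

section IsometricSum

variable {K : Type u} [NormedAddCommGroup K] [InnerProductSpace ℂ K] [CompleteSpace K]
variable {M : Type v} [NormedAddCommGroup M] [InnerProductSpace ℂ M] [CompleteSpace M]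
variable {ι : Type w}

/-- Isometries `J i : K → M` with pairwise orthogonal ranges spanning `M`, which identify `M` with
a direct sum of copies of `K`. -/
structure IsIsometricSum (J : ι → K →L[ℂ] M) : Prop where
  inner_self : ∀ i x y, ⟪J i x, J i y⟫_ℂ = ⟪x, y⟫_ℂ
  inner_ne : ∀ i j x y, i ≠ j → ⟪J i x, J j y⟫_ℂ = 0
  total : ∀ z, (∀ i x, ⟪J i x, z⟫_ℂ = 0) → z = 0

namespace IsIsometricSum

variable {J : ι → K →L[ℂ] M} (hJ : IsIsometricSum J)
include hJ

theorem orthonormal {κ : Type*} (b : HilbertBasis κ ℂ K) :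
    Orthonormal ℂ fun p : ι × κ => J p.1 (b p.2) := by
  refine ⟨fun p => ?_, fun p q hpq => ?_⟩
  · have h1 : ‖J p.1 (b p.2)‖ ^ 2 = ‖b p.2‖ ^ 2 := by
      rw [← inner_self_eq_norm_sq (𝕜 := ℂ), hJ.inner_self, inner_self_eq_norm_sq]
    rw [b.orthonormal.1] at h1
    nlinarith [norm_nonneg (J p.1 (b p.2))]
  · by_cases h1 : p.1 = q.1
    · have h2 : p.2 ≠ q.2 := fun h2 => hpq (Prod.ext h1 h2)
      simp only [h1, hJ.inner_self]
      exact b.orthonormal.2 h2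
    · exact hJ.inner_ne _ _ _ _ h1

/-- The orthonormal basis `J i (b k)` of `M`. -/
def basis {κ : Type*} (b : HilbertBasis κ ℂ K) : HilbertBasis (ι × κ) ℂ M :=
  HilbertBasis.mkOfOrthogonalEqBot (hJ.orthonormal b) <| by
    rw [Submodule.eq_bot_iff]
    intro z hz
    refine hJ.total z fun i x => ?_
    have h0 : ∀ k, ⟪b k, ContinuousLinearMap.adjoint (J i) z⟫_ℂ = 0 := fun k => by
      rw [ContinuousLinearMap.adjoint_inner_right]
      exact Submodule.inner_right_of_mem_orthogonal (Submodule.subset_span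
        (Set.mem_range_self (i, k))) hz
    have h1 : ContinuousLinearMap.adjoint (J i) z = 0 := by
      apply b.repr.injective
      ext k
      rw [b.repr_apply_apply, h0]
      simp
    rw [← ContinuousLinearMap.adjoint_inner_right, h1, inner_zero_right]

theorem basis_apply {κ : Type*} (b : HilbertBasis κ ℂ K) (i : ι) (k : κ) :
    hJ.basis b (i, k) = J i (b k) := by
  rw [basis, HilbertBasis.coe_mkOfOrthogonalEqBot]

theorem hasSum_proj (z : M) :
    HasSum (fun i => J i (ContinuousLinearMap.adjoint (J i) z)) z := by
  have h := (hJ.basis (stdBasis K)).hasSum_repr z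
  simp_rw [HilbertBasis.repr_apply_apply] at h
  refine HasSum.prod_fiberwise h fun i => ?_
  have h1 := ((stdBasis K).hasSum_repr (ContinuousLinearMap.adjoint (J i) z)).mapL (J i)
  simp_rw [HilbertBasis.repr_apply_apply, ContinuousLinearMap.adjoint_inner_right, map_smul] at h1
  simpa only [hJ.basis_apply] using h1

/-- The trace of `A` in the basis `J i (b k)`, summed over `k` first. -/
theorem tsum_posTrace_sandwich {A : M →L[ℂ] M} (hA : A.IsPositive) :
    ∑' i, posTrace (sandwich (J i) (J i) A) = posTrace A := by
  rw [posTrace_eq_tsum (hJ.basis (stdBasis K)) hA, ENNReal.tsum_prod']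
  simp_rw [hJ.basis_apply, posTrace, inner_sandwich]

theorem clm_ext {T S : M →L[ℂ] M}
    (h : ∀ i j, sandwich (J i) (J j) T = sandwich (J i) (J j) S) : T = S := by
  refine clm_ext_basis (hJ.basis (stdBasis K)) ?_
  rintro ⟨i, k⟩ ⟨j, l⟩
  rw [hJ.basis_apply, hJ.basis_apply, ← inner_sandwich, h, inner_sandwich]

/-- For positive A the blocks Jᵢ* A Jᵢ are positive with traces summing to Tr A, and norms are
bounded by traces, so the series converges absolutely in norm. Interchanging two nonnegative sums
computes its trace. Convergence and membership extend to all of the trace class by linearity. -/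
theorem partialTrace_aux (A : traceClass M) :
    (Summable fun i => sandwich (J i) (J i) (A : M →L[ℂ] M)) ∧
      ∑' i, sandwich (J i) (J i) (A : M →L[ℂ] M) ∈ traceClass K ∧
      ((A : M →L[ℂ] M).IsPositive → (∑' i, sandwich (J i) (J i) (A : M →L[ℂ] M)).IsPositive ∧
        posTrace (∑' i, sandwich (J i) (J i) (A : M →L[ℂ] M)) = posTrace (A : M →L[ℂ] M)) := by
  have pos : ∀ A : traceClass M, (A : M →L[ℂ] M).IsPositive →
      (Summable fun i => sandwich (J i) (J i) (A : M →L[ℂ] M)) ∧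
      (∑' i, sandwich (J i) (J i) (A : M →L[ℂ] M)).IsPositive ∧
        posTrace (∑' i, sandwich (J i) (J i) (A : M →L[ℂ] M)) = posTrace (A : M →L[ℂ] M) := by
    intro A hA
    have hp := fun i => isPositive_sandwich (J i) hA
    have ht := hJ.tsum_posTrace_sandwich hA
    have hfin : ∑' i, posTrace (sandwich (J i) (J i) (A : M →L[ℂ] M)) ≠ ∞ := by
      rw [ht]; exact (posTrace_lt_top hA).ne
    have hs : Summable fun i => sandwich (J i) (J i) (A : M →L[ℂ] M) :=
      Summable.of_norm_bounded (ENNReal.summable_toReal hfin) fun i =>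
        norm_le_posTrace (hp i) (ENNReal.ne_top_of_tsum_ne_top hfin i)
    have hin : ∀ x, HasSum (fun i => ⟪x, sandwich (J i) (J i) (A : M →L[ℂ] M) x⟫_ℂ)
        ⟪x, (∑' i, sandwich (J i) (J i) (A : M →L[ℂ] M)) x⟫_ℂ := fun x =>
      hs.hasSum.mapL ((innerSL ℂ x).comp (ContinuousLinearMap.apply ℂ K x))
    refine ⟨hs, isPositive_of_inner_nonneg fun x => ?_, ?_⟩
    · rw [← (hin x).tsum_eq]
      exact tsum_nonneg fun i => (hp i).inner_nonneg_right x
    · rw [← ht]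
      simp_rw [posTrace]
      rw [ENNReal.tsum_comm]
      congr 1; ext k
      have h1 := Complex.hasSum_re (hin (stdBasis K k))
      rw [← h1.tsum_eq, ENNReal.ofReal_tsum_of_nonneg (fun i => re_inner_nonneg (hp i) _)
        h1.summable]
  have gen : (Summable fun i => sandwich (J i) (J i) (A : M →L[ℂ] M)) ∧
      ∑' i, sandwich (J i) (J i) (A : M →L[ℂ] M) ∈ traceClass K := by
    induction A using traceClass_induction with
    | pos A hA =>
      obtain ⟨h1, h2, h3⟩ := pos A hA
      exact ⟨h1, mem_traceClass h2 (h3.trans_ne (posTrace_lt_top hA).ne)⟩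
    | add A B hA hB =>
      simp_rw [Submodule.coe_add, sandwich_add]
      exact ⟨hA.1.add hB.1, by rw [hA.1.tsum_add hB.1]; exact Submodule.add_mem _ hA.2 hB.2⟩
    | smul c A hA =>
      simp_rw [Submodule.coe_smul, sandwich_smul]
      exact ⟨hA.1.const_smul c, by rw [hA.1.tsum_const_smul c]; exact Submodule.smul_mem _ _ hA.2⟩
  exact ⟨gen.1, gen.2, fun hA => (pos A hA).2⟩

/-- The partial trace `A ↦ ∑ᵢ Jᵢ* A Jᵢ`. -/
def partialTrace : traceClass M →ₗ[ℂ] traceClass K where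
  toFun A := ⟨∑' i, sandwich (J i) (J i) (A : M →L[ℂ] M), (hJ.partialTrace_aux A).2.1⟩
  map_add' A B := Subtype.ext <| by
    simp only [Submodule.coe_add, sandwich_add]
    exact (hJ.partialTrace_aux A).1.tsum_add (hJ.partialTrace_aux B).1
  map_smul' c A := Subtype.ext <| by
    simp only [Submodule.coe_smul, sandwich_smul]
    exact (hJ.partialTrace_aux A).1.tsum_const_smul c

theorem hasSum_partialTrace (A : traceClass M) :
    HasSum (fun i => sandwich (J i) (J i) (A : M →L[ℂ] M)) (hJ.partialTrace A : K →L[ℂ] K) :=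
  (hJ.partialTrace_aux A).1.hasSum

theorem hasSum_inner_partialTrace (A : traceClass M) (x y : K) :
    HasSum (fun i => ⟪J i x, (A : M →L[ℂ] M) (J i y)⟫_ℂ)
      ⟪x, (hJ.partialTrace A : K →L[ℂ] K) y⟫_ℂ := by
  simp_rw [← inner_sandwich]
  exact (hJ.hasSum_partialTrace A).mapL ((innerSL ℂ x).comp (ContinuousLinearMap.apply ℂ K y))

theorem isPositive_partialTrace {A : traceClass M} (hA : (A : M →L[ℂ] M).IsPositive) :
    (hJ.partialTrace A : K →L[ℂ] K).IsPositive := ((hJ.partialTrace_aux A).2.2 hA).1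

theorem posTrace_partialTrace {A : traceClass M} (hA : (A : M →L[ℂ] M).IsPositive) :
    posTrace (hJ.partialTrace A : K →L[ℂ] K) = posTrace (A : M →L[ℂ] M) :=
  ((hJ.partialTrace_aux A).2.2 hA).2

/-- The partial trace of a state. -/
def marginal (ρ : DensityOperator M) : DensityOperator K where
  op := hJ.partialTrace ρ.toTraceClass
  isPositive := hJ.isPositive_partialTrace ρ.isPositive
  posTrace_eq_one := by rw [hJ.posTrace_partialTrace ρ.isPositive]; exact ρ.posTrace_eq_one

/-- The operator with blocks Φ[Jᵢ* A Jⱼ] is built from its matrix elements. For positive A, complete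
positivity makes this infinite matrix positive semidefinite, since a finite section meets finitely
many blocks, and trace preservation makes its diagonal sum to Tr A. -/
theorem exists_amplification (Φ : QuantumChannel K) (A : traceClass M) :
    ∃ T : traceClass M, (∀ i j, sandwichₗ (J i) (J j) T =
      Φ.toLinearMap (sandwichₗ (J i) (J j) A)) ∧ trace T = trace A := by
  induction A using traceClass_induction with
  | pos A hA =>
    let b := stdBasis K
    let x : ι × stdIndex K → ι × stdIndex K → ℂ := fun p q =>
      ⟪b p.2, (Φ.toLinearMap (sandwichₗ (J p.1) (J q.1) A) : K →L[ℂ] K) (b q.2)⟫_ℂ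
    have hΦ : ∀ i, (Φ.toLinearMap (sandwichₗ (J i) (J i) A) : K →L[ℂ] K).IsPositive :=
      fun i => Φ.isPositive (isPositive_sandwich (J i) hA)
    have hx : PosSemidefMatrix x := by
      intro s v
      -- Positivity of `A` at the vectors Σ J(y) is exactly positivity of the block matrix to which
      -- complete positivity is applied.
      have h1 := Φ.sum_inner_nonneg s (fun p q => sandwichₗ (J p.1) (J q.1) A) (fun y => by
        have h2 := hA.inner_nonneg_right (∑ p ∈ s, J p.1 (y p))
        simp only [map_sum, sum_inner, inner_sum] at h2
        rw [Finset.sum_comm] at h2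
        simpa only [coe_sandwichₗ, inner_sandwich] using h2) (fun p => v p • b p.2)
      simp only [map_smul, inner_smul_left, inner_smul_right] at h1
      refine h1.trans_eq (Finset.sum_congr rfl fun p _ => Finset.sum_congr rfl fun q _ => ?_)
      simp only [x]
      ring
    have htr : ∑' p : ι × stdIndex K, ENNReal.ofReal (x p p).re = posTrace (A : M →L[ℂ] M) := by
      rw [ENNReal.tsum_prod', ← hJ.tsum_posTrace_sandwich hA]
      congr 1; ext i
      rw [← coe_sandwichₗ, ← Φ.posTrace_apply (isPositive_sandwich (J i) hA)]
      rfl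
    have hsum : Summable fun p => (x p p).re := by
      have h1 := ENNReal.summable_toReal (htr.trans_ne (posTrace_lt_top hA).ne)
      refine h1.congr fun p => ?_
      exact ENNReal.toReal_ofReal (re_inner_nonneg (hΦ p.1) _)
    obtain ⟨T, hT, hTx⟩ := hx.exists_isPositive hsum (hJ.basis b)
    have hTtr : posTrace T = posTrace (A : M →L[ℂ] M) := by
      rw [posTrace_eq_tsum (hJ.basis b) hT, ← htr]
      simp_rw [hTx]
    have hTm : T ∈ traceClass M := mem_traceClass hT (hTtr.trans_ne (posTrace_lt_top hA).ne)
    refine ⟨⟨T, hTm⟩, fun i j => Subtype.ext (clm_ext_basis b fun k l => ?_), ?_⟩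
    · rw [coe_sandwichₗ, inner_sandwich, ← hJ.basis_apply, ← hJ.basis_apply, hTx]
    · rw [trace_eq_posTrace hA, trace_eq_posTrace (A := ⟨T, hTm⟩) hT, hTtr]
  | add A B hA hB =>
    obtain ⟨T, h1, h2⟩ := hA
    obtain ⟨S, h3, h4⟩ := hB
    exact ⟨T + S, fun i j => by simp only [map_add, h1, h3], by rw [trace_add, trace_add, h2, h4]⟩
  | smul c A hA =>
    obtain ⟨T, h1, h2⟩ := hA
    exact ⟨c • T, fun i j => by simp only [map_smul, h1], by rw [trace_smul, trace_smul, h2]⟩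

theorem traceClass_ext {T S : traceClass M}
    (h : ∀ i j, sandwichₗ (J i) (J j) T = sandwichₗ (J i) (J j) S) : T = S :=
  Subtype.ext (hJ.clm_ext fun i j => congrArg Subtype.val (h i j))

/-- The channel `Φ ⊗ Id` on a direct sum of copies of `K`, which acts entrywise. -/
def amplify (Φ : QuantumChannel K) : QuantumChannel M where
  toLinearMap :=
    { toFun := fun A => (hJ.exists_amplification Φ A).choose
      map_add' := fun A B => hJ.traceClass_ext fun i j => by
        rw [map_add, (hJ.exists_amplification Φ (A + B)).choose_spec.1,
          (hJ.exists_amplification Φ A).choose_spec.1,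
          (hJ.exists_amplification Φ B).choose_spec.1, map_add, map_add]
      map_smul' := fun c A => hJ.traceClass_ext fun i j => by
        rw [RingHom.id_apply, map_smul, (hJ.exists_amplification Φ (c • A)).choose_spec.1,
          (hJ.exists_amplification Φ A).choose_spec.1, map_smul, map_smul] }
  trace_preserving A := (hJ.exists_amplification Φ A).choose_spec.2
  completely_positive m A hA x := by
    have spec : ∀ a c i j, sandwich (J i) (J j)
        ((hJ.exists_amplification Φ (A a c)).choose : M →L[ℂ] M) =
        Φ.toLinearMap (sandwichₗ (J i) (J j) (A a c)) := fun a c i j =>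
      congrArg Subtype.val ((hJ.exists_amplification Φ (A a c)).choose_spec.1 i j)
    -- Truncation to finitely many summands. There the claim is complete positivity of Φ over the
    -- index set Fin m × s, and the truncations converge strongly to the identity.
    let P : Finset ι → M → M := fun s z =>
      ∑ i ∈ s, J i (ContinuousLinearMap.adjoint (J i) z)
    have hP : ∀ z, Tendsto (fun s => P s z) atTop (𝓝 z) := fun z => hJ.hasSum_proj z
    have hlim : Tendsto (fun s => ∑ a, ∑ c, ⟪P s (x a),
        ((hJ.exists_amplification Φ (A a c)).choose : M →L[ℂ] M) (P s (x c))⟫_ℂ) atTop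
        (𝓝 (∑ a, ∑ c, ⟪x a,
          ((hJ.exists_amplification Φ (A a c)).choose : M →L[ℂ] M) (x c)⟫_ℂ)) :=
      tendsto_finsetSum _ fun a _ => tendsto_finsetSum _ fun c _ =>
        (hP (x a)).inner (((ContinuousLinearMap.continuous _).tendsto (x c)).comp (hP (x c)))
    refine ge_of_tendsto' hlim fun s => ?_
    have h1 := Φ.sum_inner_nonneg (Finset.univ ×ˢ s)
      (fun p q : Fin m × ι => sandwichₗ (J p.2) (J q.2) (A p.1 q.1)) (fun y => by
        have h2 := hA (fun a => ∑ i ∈ s, J i (y (a, i)))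
        simp only [map_sum, sum_inner, inner_sum] at h2
        simp only [Finset.sum_product, coe_sandwichₗ, inner_sandwich]
        convert h2 using 2 with a _
        rw [Finset.sum_comm]
        refine Finset.sum_congr rfl fun c _ => ?_
        rw [Finset.sum_comm])
      (fun p => ContinuousLinearMap.adjoint (J p.2) (x p.1))
    simp only [← spec, inner_sandwich, Finset.sum_product] at h1
    simp only [P, map_sum, sum_inner, inner_sum]
    convert h1 using 2 with a _
    rw [Finset.sum_comm (s := s)]
    refine Finset.sum_congr rfl fun c _ => ?_
    rw [Finset.sum_comm]

theorem sandwich_amplify (Φ : QuantumChannel K) (A : traceClass M) (i j : ι) :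
    sandwichₗ (J i) (J j) ((hJ.amplify Φ).toLinearMap A) =
      Φ.toLinearMap (sandwichₗ (J i) (J j) A) :=
  (hJ.exists_amplification Φ A).choose_spec.1 i j

end IsIsometricSum

end IsometricSum

/-! ### Functionals on the trace class are determined by rank one operators -/

section Functionals

variable {M : Type u} [NormedAddCommGroup M] [InnerProductSpace ℂ M] [CompleteSpace M]

/-- Apply the hypothesis to the normalized vectors and rescale. -/
theorem sesquilinear_bound (B : M →ₗ⋆[ℂ] M →ₗ[ℂ] ℂ) {C : ℝ}
    (h : ∀ z w, ‖B z w‖ ≤ C * (‖z‖ ^ 2 + ‖w‖ ^ 2)) (z w : M) :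
    ‖B z w‖ ≤ 2 * C * ‖z‖ * ‖w‖ := by
  rcases eq_or_ne z 0 with rfl | hz
  · simp
  rcases eq_or_ne w 0 with rfl | hw
  · simp
  have hz' : 0 < ‖z‖ := norm_pos_iff.2 hz
  have hw' : 0 < ‖w‖ := norm_pos_iff.2 hw
  have h1 := h (((‖z‖⁻¹ : ℝ) : ℂ) • z) (((‖w‖⁻¹ : ℝ) : ℂ) • w)
  rw [map_smul, map_smulₛₗ, LinearMap.smul_apply] at h1
  simp only [norm_smul, Complex.conj_ofReal, Complex.norm_real, norm_inv,
    norm_norm] at h1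
  rw [inv_mul_cancel₀ hz'.ne', inv_mul_cancel₀ hw'.ne'] at h1
  have h2 : ‖B z w‖ = ‖z‖ * ‖w‖ * (‖z‖⁻¹ * (‖w‖⁻¹ * ‖B z w‖)) := by field_simp
  rw [h2]
  nlinarith [mul_le_mul_of_nonneg_left h1 (mul_pos hz' hw').le]

theorem posTrace_rankOne (z : M) :
    posTrace (InnerProductSpace.rankOne ℂ z z) = ENNReal.ofReal (‖z‖ ^ 2) := by
  rw [posTrace, ← tsum_norm_inner_sq (stdBasis M)]
  congr 1; ext i
  rw [InnerProductSpace.inner_right_rankOne_apply, ← inner_conj_symm z, Complex.mul_conj,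
    Complex.normSq_eq_norm_sq, Complex.ofReal_re]

theorem rankOne_polarization (z w : M) :
    InnerProductSpace.rankOne ℂ z w = (1 / 4 : ℂ) • (InnerProductSpace.rankOne ℂ (z + w) (z + w)
      - InnerProductSpace.rankOne ℂ (z - w) (z - w)
      + Complex.I • InnerProductSpace.rankOne ℂ (z + Complex.I • w) (z + Complex.I • w)
      - Complex.I • InnerProductSpace.rankOne ℂ (z - Complex.I • w) (z - Complex.I • w)) := by
  refine ContinuousLinearMap.ext fun y => ext_inner_left ℂ fun x => ?_
  simp only [smul_apply, add_apply, sub_apply, inner_smul_right, inner_add_right, inner_sub_right,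
    InnerProductSpace.rankOne_apply, inner_add_left, inner_sub_left, inner_smul_left,
    Complex.conj_I]
  linear_combination (1 / 2) * (⟪x, z⟫_ℂ * ⟪w, y⟫_ℂ - ⟪x, w⟫_ℂ * ⟪z, y⟫_ℂ) * Complex.I_mul_I

/-- The rank one operator `|z⟩⟨z|` as a trace-class operator. -/
def rankOneSelf (z : M) : traceClass M :=
  ⟨InnerProductSpace.rankOne ℂ z z, mem_traceClass (InnerProductSpace.isPositive_rankOne_self z)
    (by rw [posTrace_rankOne]; exact ENNReal.ofReal_ne_top)⟩

theorem rankOne_mem_traceClass (z w : M) : InnerProductSpace.rankOne ℂ z w ∈ traceClass M := by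
  have h := fun x : M => (rankOneSelf x).2
  rw [rankOne_polarization]
  exact Submodule.smul_mem _ _ (Submodule.sub_mem _ (Submodule.add_mem _ (Submodule.sub_mem _
    (h _) (h _)) (Submodule.smul_mem _ _ (h _))) (Submodule.smul_mem _ _ (h _)))

/-- The rank one operator `|z⟩⟨w|` as a trace-class operator. -/
def rankOneTC (z w : M) : traceClass M :=
  ⟨InnerProductSpace.rankOne ℂ z w, rankOne_mem_traceClass z w⟩

theorem trace_rankOneTC_self (z : M) : trace (rankOneTC z z) = ((‖z‖ ^ 2 : ℝ) : ℂ) := by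
  rw [trace_eq_posTrace (InnerProductSpace.isPositive_rankOne_self z)]
  change ((posTrace (InnerProductSpace.rankOne ℂ z z)).toReal : ℂ) = _
  rw [posTrace_rankOne, ENNReal.toReal_ofReal (by positivity)]

theorem rankOneTC_polarization (z w : M) :
    rankOneTC z w = (1 / 4 : ℂ) • (rankOneTC (z + w) (z + w) - rankOneTC (z - w) (z - w)
      + Complex.I • rankOneTC (z + Complex.I • w) (z + Complex.I • w)
      - Complex.I • rankOneTC (z - Complex.I • w) (z - Complex.I • w)) :=
  Subtype.ext (rankOne_polarization z w)

/-- The trace as a linear functional. -/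
def traceₗ : traceClass M →ₗ[ℂ] ℂ where
  toFun := trace
  map_add' := trace_add
  map_smul' := trace_smul

/-- The remainder of the expansion of a positive trace-class operator `A` into the rank one
operators `|√A eₖ⟩⟨√A eₖ|`. -/
def remainder (A : traceClass M) (s : Finset (stdIndex M)) : traceClass M :=
  A - ∑ k ∈ s, rankOneTC (CFC.sqrt (A : M →L[ℂ] M) (stdBasis M k))
    (CFC.sqrt (A : M →L[ℂ] M) (stdBasis M k))

/-- This is Bessel's inequality for the vector √A x. -/
theorem isPositive_remainder {A : traceClass M} (hA : (A : M →L[ℂ] M).IsPositive)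
    (s : Finset (stdIndex M)) : (remainder A s : M →L[ℂ] M).IsPositive := by
  obtain ⟨h1, h2⟩ := sqrt_props hA
  refine isPositive_of_inner_nonneg fun x => ?_
  have e2 : (remainder A s : M →L[ℂ] M) x = (A : M →L[ℂ] M) x -
      ∑ k ∈ s, ⟪CFC.sqrt (A : M →L[ℂ] M) (stdBasis M k), x⟫_ℂ •
        CFC.sqrt (A : M →L[ℂ] M) (stdBasis M k) := by
    simp [remainder, rankOneTC]
  set R := CFC.sqrt (A : M →L[ℂ] M)
  have e1 : ⟪x, (remainder A s : M →L[ℂ] M) x⟫_ℂ =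
      ((‖R x‖ ^ 2 - ∑ k ∈ s, ‖⟪stdBasis M k, R x⟫_ℂ‖ ^ 2 : ℝ) : ℂ) := by
    rw [e2, inner_sub_right, inner_sum, inner_eq_ofReal hA, re_inner_sqrt hA]
    push_cast
    congr 1
    refine Finset.sum_congr rfl fun k _ => ?_
    rw [inner_smul_right, ← h1, inner_star_left, inner_star_right, h1,
      ← inner_conj_symm (R x), Complex.mul_conj, Complex.normSq_eq_norm_sq]
    push_cast; rfl
  rw [e1]
  exact_mod_cast sub_nonneg.2 ((stdBasis M).orthonormal.sum_inner_products_le (R x))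

/-- The removed rank one operators have traces ‖√A eₖ‖², and these sum to Tr A. -/
theorem tendsto_trace_remainder {A : traceClass M} (hA : (A : M →L[ℂ] M).IsPositive) :
    Tendsto (fun s => (trace (remainder A s)).re) atTop (𝓝 0) := by
  set R := CFC.sqrt (A : M →L[ℂ] M) with hR
  have htr : ∀ s, (trace (remainder A s)).re = (trace A).re - ∑ k ∈ s, ‖R (stdBasis M k)‖ ^ 2 :=
    fun s => by
      change (traceₗ (remainder A s)).re = (traceₗ A).re - _
      simp only [remainder, map_sub, map_sum]
      change ((traceₗ A) -
        ∑ k ∈ s, trace (rankOneTC (R (stdBasis M k)) (R (stdBasis M k)))).re = _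
      simp_rw [trace_rankOneTC_self]
      rw [Complex.sub_re, Complex.re_sum]
      simp only [Complex.ofReal_re]
  have hsum : HasSum (fun k => ‖R (stdBasis M k)‖ ^ 2) (trace A).re := by
    have := Complex.hasSum_re (hasSum_trace (stdBasis M) A)
    simpa only [re_inner_sqrt hA] using this
  have h3 : Tendsto (fun s => ∑ k ∈ s, ‖R (stdBasis M k)‖ ^ 2) atTop (𝓝 (trace A).re) := hsum
  simp_rw [htr]
  simpa using h3.const_sub (trace A).re

/-- A linear functional on the trace class that is bounded on positive operators by a multiple of
the trace vanishes if it vanishes on the rank one operators built from a total set. -/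
theorem functional_eq_zero (d : traceClass M →ₗ[ℂ] ℂ) (C : ℝ)
    (hC : ∀ A : traceClass M, (A : M →L[ℂ] M).IsPositive → ‖d A‖ ≤ C * (trace A).re)
    (S : Set M) (hS : Dense (Submodule.span ℂ S : Set M))
    (h : ∀ z ∈ S, ∀ w ∈ S, d (rankOneTC z w) = 0) : d = 0 := by
  let B₀ : M →ₗ⋆[ℂ] M →ₗ[ℂ] ℂ := LinearMap.mk₂'ₛₗ (starRingEnd ℂ) (RingHom.id ℂ)
    (fun w z => d (rankOneTC z w))
    (fun w w' z => by
      rw [← map_add]; congr 1; apply Subtype.ext; simp [rankOneTC])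
    (fun c w z => by
      rw [← map_smul]; congr 1; apply Subtype.ext; simp [rankOneTC])
    (fun w z z' => by
      rw [← map_add]; congr 1; apply Subtype.ext; simp [rankOneTC])
    (fun c w z => by
      rw [← map_smul]; congr 1; apply Subtype.ext; simp [rankOneTC])
  have hq : ∀ z, ‖d (rankOneTC z z)‖ ≤ C * ‖z‖ ^ 2 := fun z => by
    have := hC (rankOneTC z z) (InnerProductSpace.isPositive_rankOne_self z)
    rwa [trace_rankOneTC_self, Complex.ofReal_re] at this
  -- Polarization expresses the form through its diagonal, which is bounded by C‖z‖²; the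
  -- parallelogram law adds up the four squares.
  have hB₀ : ∀ w z, ‖B₀ w z‖ ≤ C * (‖w‖ ^ 2 + ‖z‖ ^ 2) := by
    intro w z
    change ‖d (rankOneTC z w)‖ ≤ _
    rw [rankOneTC_polarization, map_smul, map_sub, map_add, map_sub, map_smul, map_smul]
    have p1 := parallelogram_law_with_norm ℂ z w
    have p2 := parallelogram_law_with_norm ℂ z (Complex.I • w)
    have p3 : ‖Complex.I • w‖ = ‖w‖ := by rw [norm_smul, Complex.norm_I, one_mul]
    rw [p3] at p2
    have q1 := hq (z + w)
    have q2 := hq (z - w)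
    have q3 := hq (z + Complex.I • w)
    have q4 := hq (z - Complex.I • w)
    rw [norm_smul]
    have t1 := norm_sub_le (d (rankOneTC (z + w) (z + w)) - d (rankOneTC (z - w) (z - w)) +
      Complex.I • d (rankOneTC (z + Complex.I • w) (z + Complex.I • w)))
      (Complex.I • d (rankOneTC (z - Complex.I • w) (z - Complex.I • w)))
    have t2 := norm_add_le (d (rankOneTC (z + w) (z + w)) - d (rankOneTC (z - w) (z - w)))
      (Complex.I • d (rankOneTC (z + Complex.I • w) (z + Complex.I • w)))
    have t3 := norm_sub_le (d (rankOneTC (z + w) (z + w))) (d (rankOneTC (z - w) (z - w)))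
    rw [norm_smul Complex.I, Complex.norm_I, one_mul] at t1 t2
    have e : ‖(1 / 4 : ℂ)‖ = 1 / 4 := by norm_num
    rw [e]
    have p4 : C * (‖z + w‖ ^ 2 + ‖z - w‖ ^ 2 + (‖z + Complex.I • w‖ ^ 2 +
        ‖z - Complex.I • w‖ ^ 2)) = C * (4 * (‖w‖ ^ 2 + ‖z‖ ^ 2)) := by
      congr 1; nlinarith
    linarith
  let B : M →L⋆[ℂ] M →L[ℂ] ℂ := B₀.mkContinuous₂ (2 * C) (sesquilinear_bound B₀ hB₀)
  have hB : B = 0 := by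
    refine ContinuousLinearMap.ext_on hS fun w hw => ContinuousLinearMap.ext_on hS fun z hz => ?_
    exact h z hz w hw
  have hrank : ∀ z w, d (rankOneTC z w) = 0 := fun z w => by
    change B w z = 0
    rw [hB]; rfl
  -- Since `d` kills rank one operators, it takes the same value at `A` and at every remainder, and
  -- the traces of the remainders tend to zero.
  have hpos : ∀ A : traceClass M, (A : M →L[ℂ] M).IsPositive → d A = 0 := by
    intro A hA
    have hQd : ∀ s, d (remainder A s) = d A := fun s => by
      simp [remainder, map_sub, map_sum, hrank]
    have hlim := (tendsto_trace_remainder hA).const_mul C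
    rw [mul_zero] at hlim
    refine norm_le_zero_iff.1 (ge_of_tendsto' hlim fun s => ?_)
    rw [← hQd s]
    exact hC _ (isPositive_remainder hA s)
  refine LinearMap.ext fun A => ?_
  induction A using traceClass_induction with
  | pos A hA => simpa using hpos A hA
  | add A B hA hB => rw [map_add, map_add, hA, hB]
  | smul c A hA => rw [map_smul, map_smul, hA]

end Functionals

/-! ### The Hilbert space tensor product: pure tensors, operators, marginals -/

section HilbertTensor

variable {K : Type u} [NormedAddCommGroup K] [InnerProductSpace ℂ K] [CompleteSpace K]
variable {L : Type u} [NormedAddCommGroup L] [InnerProductSpace ℂ L] [CompleteSpace L]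

/-- The pure tensor `x ⊗ y` in the Hilbert space tensor product. -/
def pureTensor (x : K) (y : L) : HilbertTensor K L := ((x ⊗ₜ[ℂ] y : K ⊗[ℂ] L) : HilbertTensor K L)

@[simp]
theorem inner_pure (x x' : K) (y y' : L) :
    ⟪pureTensor x y, pureTensor x' y'⟫_ℂ = ⟪x, x'⟫_ℂ * ⟪y, y'⟫_ℂ := by
  rw [pureTensor, pureTensor, UniformSpace.Completion.inner_coe, TensorProduct.inner_tmul]

theorem norm_pure (x : K) (y : L) : ‖pureTensor x y‖ = ‖x‖ * ‖y‖ := by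
  rw [pureTensor, UniformSpace.Completion.norm_coe, TensorProduct.norm_tmul]

variable (K L) in
/-- The set of pure tensors. -/
def pureTensors : Set (HilbertTensor K L) := Set.range fun p : K × L => pureTensor p.1 p.2

variable (K L) in
theorem dense_span_pureTensors :
    Dense (Submodule.span ℂ (pureTensors K L) : Set (HilbertTensor K L)) := by
  have h1 : Set.range ((↑) : K ⊗[ℂ] L → HilbertTensor K L) ⊆
      (Submodule.span ℂ (pureTensors K L) : Set (HilbertTensor K L)) := by
    rintro _ ⟨t, rfl⟩
    induction t using TensorProduct.induction_on with
    | zero => rw [UniformSpace.Completion.coe_zero]; exact Submodule.zero_mem _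
    | tmul x y => exact Submodule.subset_span ⟨(x, y), rfl⟩
    | add a b ha hb =>
      rw [UniformSpace.Completion.coe_add]
      exact Submodule.add_mem _ ha hb
  exact UniformSpace.Completion.denseRange_coe.mono h1

theorem pure_add_left (x x' : K) (y : L) :
    pureTensor (x + x') y = pureTensor x y + pureTensor x' y := by
  rw [pureTensor, TensorProduct.add_tmul, UniformSpace.Completion.coe_add]; rfl

theorem pure_add_right (x : K) (y y' : L) :
    pureTensor x (y + y') = pureTensor x y + pureTensor x y' := by
  rw [pureTensor, TensorProduct.tmul_add, UniformSpace.Completion.coe_add]; rfl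

theorem pure_smul_left (c : ℂ) (x : K) (y : L) : pureTensor (c • x) y = c • pureTensor x y := by
  rw [pureTensor, ← TensorProduct.smul_tmul', UniformSpace.Completion.coe_smul]; rfl

theorem pure_smul_right (c : ℂ) (x : K) (y : L) : pureTensor x (c • y) = c • pureTensor x y := by
  rw [pureTensor, TensorProduct.tmul_smul, UniformSpace.Completion.coe_smul]; rfl

/-- The map `x ↦ x ⊗ y`. -/
def tensorRight (y : L) : K →L[ℂ] HilbertTensor K L :=
  LinearMap.mkContinuous
    { toFun := fun x => pureTensor x y
      map_add' := fun x x' => pure_add_left x x' y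
      map_smul' := fun c x => pure_smul_left c x y } ‖y‖
    (fun x => by rw [mul_comm]; exact (norm_pure x y).le)

/-- The map `y ↦ x ⊗ y`. -/
def tensorLeft (x : K) : L →L[ℂ] HilbertTensor K L :=
  LinearMap.mkContinuous
    { toFun := fun y => pureTensor x y
      map_add' := fun y y' => pure_add_right x y y'
      map_smul' := fun c y => pure_smul_right c x y } ‖x‖
    (fun y => (norm_pure x y).le)

@[simp]
theorem tensorRight_apply (x : K) (y : L) : tensorRight y x = pureTensor x y := rfl

@[simp]
theorem tensorLeft_apply (x : K) (y : L) : tensorLeft x y = pureTensor x y := rfl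

theorem eq_zero_of_inner_pure {z : HilbertTensor K L}
    (h : ∀ x y, ⟪pureTensor x y, z⟫_ℂ = 0) : z = 0 := by
  refine (dense_span_pureTensors K L).eq_zero_of_inner_right ℂ fun v hv => ?_
  induction hv using Submodule.span_induction with
  | mem v hv => obtain ⟨p, rfl⟩ := hv; exact h _ _
  | zero => simp
  | add a b _ _ ha hb => simpa [inner_add_left] using by rw [ha, hb, add_zero]
  | smul c a _ ha => simpa [inner_smul_left] using Or.inr ha

theorem clm_ext_pure {T S : HilbertTensor K L →L[ℂ] HilbertTensor K L}
    (h : ∀ x y, T (pureTensor x y) = S (pureTensor x y)) : T = S := by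
  refine ContinuousLinearMap.ext_on (dense_span_pureTensors K L) ?_
  rintro _ ⟨p, rfl⟩
  exact h _ _

theorem clm_ext_inner_pure {T S : HilbertTensor K L →L[ℂ] HilbertTensor K L}
    (h : ∀ x y x' y', ⟪pureTensor x y, T (pureTensor x' y')⟫_ℂ =
      ⟪pureTensor x y, S (pureTensor x' y')⟫_ℂ) : T = S := by
  refine clm_ext_pure fun x' y' => sub_eq_zero.1 (eq_zero_of_inner_pure fun x y => ?_)
  rw [inner_sub_right, h, sub_self]

theorem clm_ext_quad {E : Type*} [NormedAddCommGroup E] [InnerProductSpace ℂ E]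
    {T S : E →L[ℂ] E} (h : ∀ x, ⟪x, T x⟫_ℂ = ⟪x, S x⟫_ℂ) : T = S := by
  have h1 : (T : E →ₗ[ℂ] E) = S := (ext_inner_map _ _).1 fun x => by
    rw [← inner_conj_symm, ← inner_conj_symm _ x]
    exact congrArg _ (h x)
  exact ContinuousLinearMap.coe_injective h1

/-- Polarize in the first factor with `y` fixed, then in the second with `x` and `x'` fixed. -/
theorem clm_ext_quad_pure {T S : HilbertTensor K L →L[ℂ] HilbertTensor K L}
    (h : ∀ x y, ⟪pureTensor x y, T (pureTensor x y)⟫_ℂ =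
      ⟪pureTensor x y, S (pureTensor x y)⟫_ℂ) : T = S := by
  have h1 : ∀ y : L, sandwich (tensorRight (K := K) y) (tensorRight y) T =
      sandwich (tensorRight y) (tensorRight y) S := fun y => clm_ext_quad fun x => by
    rw [inner_sandwich, inner_sandwich]; exact h x y
  have h2 : ∀ x x' : K, sandwich (tensorLeft (L := L) x) (tensorLeft x') T =
      sandwich (tensorLeft x) (tensorLeft x') S := fun x x' => clm_ext_quad fun y => by
    have := congrArg (fun A : K →L[ℂ] K => ⟪x, A x'⟫_ℂ) (h1 y)
    simp only [inner_sandwich, tensorRight_apply] at this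
    rw [inner_sandwich, inner_sandwich]; exact this
  refine clm_ext_inner_pure fun x y x' y' => ?_
  have := congrArg (fun A : L →L[ℂ] L => ⟪y, A y'⟫_ℂ) (h2 x x')
  simpa only [inner_sandwich, tensorLeft_apply] using this

/-- Presents K ⊗ L as a direct sum of copies of K labelled by a basis of L. A vector orthogonal to
all x ⊗ fⱼ is sent to zero by the adjoint of each map y ↦ x ⊗ y, hence is orthogonal to all pure
tensors. -/
theorem isIsometricSum_tensorRight {κ : Type*} (f : HilbertBasis κ ℂ L) :
    IsIsometricSum fun j => tensorRight (K := K) (f j) where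
  inner_self j x y := by
    simp only [tensorRight_apply, inner_pure]
    rw [inner_self_eq_norm_sq_to_K, f.orthonormal.1]
    simp
  inner_ne i j x y hij := by
    simp only [tensorRight_apply, inner_pure]
    rw [f.orthonormal.2 hij, mul_zero]
  total z hz := eq_zero_of_inner_pure fun x y => by
    have h1 : ContinuousLinearMap.adjoint (tensorLeft (L := L) x) z = 0 := by
      apply f.repr.injective
      ext j
      rw [f.repr_apply_apply, ContinuousLinearMap.adjoint_inner_right, tensorLeft_apply]
      simpa using hz j x
    rw [← tensorLeft_apply, ← ContinuousLinearMap.adjoint_inner_right, h1, inner_zero_right]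

theorem isIsometricSum_tensorLeft {κ : Type*} (e : HilbertBasis κ ℂ K) :
    IsIsometricSum fun j => tensorLeft (L := L) (e j) where
  inner_self j x y := by
    simp only [tensorLeft_apply, inner_pure]
    rw [inner_self_eq_norm_sq_to_K, e.orthonormal.1]
    simp
  inner_ne i j x y hij := by
    simp only [tensorLeft_apply, inner_pure]
    rw [e.orthonormal.2 hij, zero_mul]
  total z hz := eq_zero_of_inner_pure fun x y => by
    have h1 : ContinuousLinearMap.adjoint (tensorRight (K := K) y) z = 0 := by
      apply e.repr.injective
      ext j
      rw [e.repr_apply_apply, ContinuousLinearMap.adjoint_inner_right, tensorRight_apply]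
      simpa using hz j y
    rw [← tensorRight_apply, ← ContinuousLinearMap.adjoint_inner_right, h1, inner_zero_right]

/-- The tensor product of two orthonormal bases. -/
def tensorBasis {κ κ' : Type*} (e : HilbertBasis κ ℂ K) (f : HilbertBasis κ' ℂ L) :
    HilbertBasis (κ × κ') ℂ (HilbertTensor K L) := (isIsometricSum_tensorLeft e).basis f

theorem tensorBasis_apply {κ κ' : Type*} (e : HilbertBasis κ ℂ K) (f : HilbertBasis κ' ℂ L)
    (i : κ) (j : κ') : tensorBasis e f (i, j) = pureTensor (e i) (f j) :=
  (isIsometricSum_tensorLeft e).basis_apply f i j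

@[simp]
theorem opTensor_pure (A : K →L[ℂ] K) (B : L →L[ℂ] L) (x : K) (y : L) :
    opTensor A B (pureTensor x y) = pureTensor (A x) (B y) := by
  rw [opTensor, pureTensor, ContinuousLinearMap.completion_apply_coe, TensorProduct.mapL_tmul]; rfl

theorem opTensor_mul (A A' : K →L[ℂ] K) (B B' : L →L[ℂ] L) :
    opTensor (A * A') (B * B') = opTensor A B * opTensor A' B' :=
  clm_ext_pure fun x y => by
    rw [mul_apply_eq_comp, opTensor_pure, opTensor_pure, opTensor_pure]; rfl

theorem star_opTensor (A : K →L[ℂ] K) (B : L →L[ℂ] L) :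
    star (opTensor A B) = opTensor (star A) (star B) :=
  clm_ext_inner_pure fun x y x' y' => by
    rw [inner_star_right, opTensor_pure, opTensor_pure, inner_pure, inner_pure, inner_star_right,
      inner_star_right]

theorem opTensor_add_left (A A' : K →L[ℂ] K) (B : L →L[ℂ] L) :
    opTensor (A + A') B = opTensor A B + opTensor A' B :=
  clm_ext_pure fun x y => by simp [pure_add_left]

theorem opTensor_add_right (A : K →L[ℂ] K) (B B' : L →L[ℂ] L) :
    opTensor A (B + B') = opTensor A B + opTensor A B' :=
  clm_ext_pure fun x y => by simp [pure_add_right]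

theorem opTensor_smul_left (c : ℂ) (A : K →L[ℂ] K) (B : L →L[ℂ] L) :
    opTensor (c • A) B = c • opTensor A B :=
  clm_ext_pure fun x y => by simp [pure_smul_left]

theorem opTensor_smul_right (c : ℂ) (A : K →L[ℂ] K) (B : L →L[ℂ] L) :
    opTensor A (c • B) = c • opTensor A B :=
  clm_ext_pure fun x y => by simp [pure_smul_right]

theorem isPositive_opTensor {A : K →L[ℂ] K} {B : L →L[ℂ] L} (hA : A.IsPositive)
    (hB : B.IsPositive) : (opTensor A B).IsPositive := by
  obtain ⟨h1, h2⟩ := sqrt_props hA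
  obtain ⟨h3, h4⟩ := sqrt_props hB
  have h5 : opTensor A B = star (opTensor (CFC.sqrt A) (CFC.sqrt B)) *
      opTensor (CFC.sqrt A) (CFC.sqrt B) := by
    rw [star_opTensor, h1, h3, ← opTensor_mul, h2, h4]
  rw [h5]
  exact isPositive_star_mul_self _

theorem posTrace_opTensor {A : K →L[ℂ] K} {B : L →L[ℂ] L} (hA : A.IsPositive)
    (hB : B.IsPositive) : posTrace (opTensor A B) = posTrace A * posTrace B := by
  rw [posTrace_eq_tsum (tensorBasis (stdBasis K) (stdBasis L)) (isPositive_opTensor hA hB),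
    ENNReal.tsum_prod', posTrace, posTrace, ← ENNReal.tsum_mul_right]
  congr 1; ext i
  rw [← ENNReal.tsum_mul_left]
  congr 1; ext j
  rw [tensorBasis_apply, opTensor_pure, inner_pure, ← ENNReal.ofReal_mul (re_inner_nonneg hA _),
    inner_eq_ofReal hA, inner_eq_ofReal hB, ← Complex.ofReal_mul]
  simp only [Complex.ofReal_re]

theorem opTensor_mem_traceClass (A : traceClass K) (B : traceClass L) :
    opTensor (A : K →L[ℂ] K) (B : L →L[ℂ] L) ∈ traceClass (HilbertTensor K L) := by
  induction A using traceClass_induction with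
  | pos A hA =>
    induction B using traceClass_induction with
    | pos B hB =>
      refine mem_traceClass (isPositive_opTensor hA hB) ?_
      rw [posTrace_opTensor hA hB]
      exact ENNReal.mul_ne_top (posTrace_lt_top hA).ne (posTrace_lt_top hB).ne
    | add B B' h h' =>
      rw [Submodule.coe_add, opTensor_add_right]; exact Submodule.add_mem _ h h'
    | smul c B h => rw [Submodule.coe_smul, opTensor_smul_right]; exact Submodule.smul_mem _ _ h
  | add A A' h h' => rw [Submodule.coe_add, opTensor_add_left]; exact Submodule.add_mem _ h h'
  | smul c A h => rw [Submodule.coe_smul, opTensor_smul_left]; exact Submodule.smul_mem _ _ h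

/-- The tensor product of trace-class operators. -/
def tensorTC (A : traceClass K) (B : traceClass L) : traceClass (HilbertTensor K L) :=
  ⟨opTensor (A : K →L[ℂ] K) (B : L →L[ℂ] L), opTensor_mem_traceClass A B⟩

/-- The product state `ρ ⊗ σ`. -/
def DensityOperator.tensor (ρ : DensityOperator K) (σ : DensityOperator L) :
    DensityOperator (HilbertTensor K L) where
  op := opTensor ρ.op σ.op
  isPositive := isPositive_opTensor ρ.isPositive σ.isPositive
  posTrace_eq_one := by
    rw [posTrace_opTensor ρ.isPositive σ.isPositive, ρ.posTrace_eq_one, σ.posTrace_eq_one, one_mul]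

theorem sandwich_tensorLeft (x x' : K) (A : K →L[ℂ] K) (B : L →L[ℂ] L) :
    sandwich (tensorLeft x) (tensorLeft x') (opTensor A B) = ⟪x, A x'⟫_ℂ • B := by
  refine ContinuousLinearMap.ext fun y => ext_inner_left ℂ fun y' => ?_
  rw [inner_sandwich]
  simp [inner_smul_right]

theorem sandwich_tensorRight (y y' : L) (A : K →L[ℂ] K) (B : L →L[ℂ] L) :
    sandwich (tensorRight y) (tensorRight y') (opTensor A B) = ⟪y, B y'⟫_ℂ • A := by
  refine ContinuousLinearMap.ext fun x => ext_inner_left ℂ fun x' => ?_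
  rw [inner_sandwich]
  simp [inner_smul_right, mul_comm]

variable (K L) in
/-- The partial trace over the second factor. -/
def ptr₁ : traceClass (HilbertTensor K L) →ₗ[ℂ] traceClass K :=
  (isIsometricSum_tensorRight (K := K) (stdBasis L)).partialTrace

variable (K L) in
/-- The partial trace over the first factor. -/
def ptr₂ : traceClass (HilbertTensor K L) →ₗ[ℂ] traceClass L :=
  (isIsometricSum_tensorLeft (L := L) (stdBasis K)).partialTrace

/-- The diagonal blocks of A ⊗ B along a basis of L are ⟨fⱼ, B fⱼ⟩ A. -/
theorem ptr₁_tensorTC (A : traceClass K) (B : traceClass L) :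
    ptr₁ K L (tensorTC A B) = trace B • A := by
  refine Subtype.ext (HasSum.unique
    ((isIsometricSum_tensorRight (K := K) (stdBasis L)).hasSum_partialTrace (tensorTC A B)) ?_)
  have h := (hasSum_trace (stdBasis L) B).smul_const (A : K →L[ℂ] K)
  convert h using 2 with j
  · exact sandwich_tensorRight _ _ _ _
  · rfl

theorem ptr₂_tensorTC (A : traceClass K) (B : traceClass L) :
    ptr₂ K L (tensorTC A B) = trace A • B := by
  refine Subtype.ext (HasSum.unique
    ((isIsometricSum_tensorLeft (L := L) (stdBasis K)).hasSum_partialTrace (tensorTC A B)) ?_)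
  have h := (hasSum_trace (stdBasis K) A).smul_const (B : L →L[ℂ] L)
  convert h using 2 with j
  · exact sandwich_tensorLeft _ _ _ _
  · rfl

/-- The first marginal of a state. -/
def DensityOperator.fst (ρ : DensityOperator (HilbertTensor K L)) : DensityOperator K :=
  (isIsometricSum_tensorRight (K := K) (stdBasis L)).marginal ρ

/-- The second marginal of a state. -/
def DensityOperator.snd (ρ : DensityOperator (HilbertTensor K L)) : DensityOperator L :=
  (isIsometricSum_tensorLeft (L := L) (stdBasis K)).marginal ρ

theorem rankOneTC_pure (x x' : K) (y y' : L) :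
    rankOneTC (pureTensor x y) (pureTensor x' y') = tensorTC (rankOneTC x x') (rankOneTC y y') := by
  refine Subtype.ext (clm_ext_pure fun z w => ?_)
  change InnerProductSpace.rankOne ℂ (pureTensor x y) (pureTensor x' y') (pureTensor z w) =
    opTensor (InnerProductSpace.rankOne ℂ x x') (InnerProductSpace.rankOne ℂ y y') (pureTensor z w)
  rw [opTensor_pure]
  simp only [InnerProductSpace.rankOne_apply, inner_pure, pure_smul_left, pure_smul_right,
    smul_smul, mul_comm]

end HilbertTensor

/-! ### Tensor products of channels and their marginals -/

section TensorChannels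

variable {K : Type u} [NormedAddCommGroup K] [InnerProductSpace ℂ K] [CompleteSpace K]
variable {L : Type u} [NormedAddCommGroup L] [InnerProductSpace ℂ L] [CompleteSpace L]

theorem DensityOperator.ext_op {ρ σ : DensityOperator K} (h : ρ.op = σ.op) : ρ = σ := by
  cases ρ; cases σ; cases h; rfl

/-- The composition of two channels. -/
def QuantumChannel.comp (Φ Ψ : QuantumChannel K) : QuantumChannel K where
  toLinearMap := Φ.toLinearMap.comp Ψ.toLinearMap
  completely_positive m A hA := Φ.completely_positive m _ (Ψ.completely_positive m A hA)
  trace_preserving A := (Φ.trace_preserving _).trans (Ψ.trace_preserving A)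

/-- Φ ⊗ Ψ is Φ ⊗ Id after Id ⊗ Ψ, each factor being an amplification over one of the two
decompositions of K ⊗ L. On A ⊗ B the blocks are scalar multiples of A or of B, so linearity
identifies the result. -/
theorem exists_isChannelTensor (Φ : QuantumChannel K) (Ψ : QuantumChannel L) :
    ∃ Ξ, IsChannelTensor Φ Ψ Ξ := by
  have hK := isIsometricSum_tensorRight (K := K) (stdBasis L)
  have hL := isIsometricSum_tensorLeft (L := L) (stdBasis K)
  refine ⟨(hK.amplify Φ).comp (hL.amplify Ψ), fun A B C hC => ?_⟩
  have hC' : C = tensorTC A B := Subtype.ext hC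
  subst hC'
  have h1 : (hL.amplify Ψ).toLinearMap (tensorTC A B) = tensorTC A (Ψ.toLinearMap B) := by
    refine hL.traceClass_ext fun i j => ?_
    have e : ∀ B : traceClass L, sandwichₗ (tensorLeft (stdBasis K i)) (tensorLeft (stdBasis K j))
        (tensorTC A B) = ⟪stdBasis K i, (A : K →L[ℂ] K) (stdBasis K j)⟫_ℂ • B :=
      fun B => Subtype.ext (sandwich_tensorLeft _ _ _ _)
    rw [hL.sandwich_amplify, e, e, map_smul]
  have h2 : (hK.amplify Φ).toLinearMap (tensorTC A (Ψ.toLinearMap B)) =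
      tensorTC (Φ.toLinearMap A) (Ψ.toLinearMap B) := by
    refine hK.traceClass_ext fun i j => ?_
    have e : ∀ A : traceClass K, ∀ B : traceClass L,
        sandwichₗ (tensorRight (stdBasis L i)) (tensorRight (stdBasis L j))
        (tensorTC A B) = ⟪stdBasis L i, (B : L →L[ℂ] L) (stdBasis L j)⟫_ℂ • A :=
      fun A B => Subtype.ext (sandwich_tensorRight _ _ _ _)
    rw [hK.sandwich_amplify, e, e, map_smul]
  change ((hK.amplify Φ).toLinearMap ((hL.amplify Ψ).toLinearMap (tensorTC A B)) :
    HilbertTensor K L →L[ℂ] HilbertTensor K L) = _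
  rw [h1, h2]
  rfl

theorem isChannelTensor_tensor (Φ : QuantumChannel K) (Ψ : QuantumChannel L) :
    IsChannelTensor Φ Ψ (Φ.tensor Ψ) := by
  rw [QuantumChannel.tensor, dif_pos (exists_isChannelTensor Φ Ψ)]
  exact (exists_isChannelTensor Φ Ψ).choose_spec

theorem QuantumChannel.tensor_tensorTC (Φ : QuantumChannel K) (Ψ : QuantumChannel L)
    (A : traceClass K) (B : traceClass L) :
    (Φ.tensor Ψ).toLinearMap (tensorTC A B) = tensorTC (Φ.toLinearMap A) (Ψ.toLinearMap B) :=
  Subtype.ext (isChannelTensor_tensor Φ Ψ A B _ rfl)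

theorem QuantumChannel.tensor_apply_tensor (Φ : QuantumChannel K) (Ψ : QuantumChannel L)
    (ρ : DensityOperator K) (σ : DensityOperator L) :
    (Φ.tensor Ψ).apply (ρ.tensor σ) = (Φ.apply ρ).tensor (Ψ.apply σ) :=
  DensityOperator.ext_op
    (isChannelTensor_tensor Φ Ψ ρ.toTraceClass σ.toTraceClass (ρ.tensor σ).toTraceClass rfl)

theorem re_trace_eq {A : traceClass K} (hA : (A : K →L[ℂ] K).IsPositive) :
    (trace A).re = (posTrace (A : K →L[ℂ] K)).toReal := by
  rw [trace_eq_posTrace hA, Complex.ofReal_re]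

theorem norm_inner_le_trace {A : traceClass K} (hA : (A : K →L[ℂ] K).IsPositive) (x : K) :
    ‖⟪x, (A : K →L[ℂ] K) x⟫_ℂ‖ ≤ ‖x‖ ^ 2 * (trace A).re := by
  rw [re_trace_eq hA]
  calc ‖⟪x, (A : K →L[ℂ] K) x⟫_ℂ‖ ≤ ‖x‖ * ‖(A : K →L[ℂ] K) x‖ := norm_inner_le_norm _ _
    _ ≤ ‖x‖ * (‖(A : K →L[ℂ] K)‖ * ‖x‖) := by gcongr; exact ContinuousLinearMap.le_opNorm _ _
    _ ≤ ‖x‖ * ((posTrace (A : K →L[ℂ] K)).toReal * ‖x‖) := by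
        gcongr; exact norm_le_posTrace hA (posTrace_lt_top hA).ne
    _ = _ := by ring

/-- Two positive trace-preserving linear maps of the trace class of a tensor product are equal
if they agree on products. -/
theorem traceClass_map_ext {N : Type v} [NormedAddCommGroup N] [InnerProductSpace ℂ N]
    [CompleteSpace N] {α β : traceClass (HilbertTensor K L) →ₗ[ℂ] traceClass N}
    (hα : ∀ A : traceClass (HilbertTensor K L),
      (A : HilbertTensor K L →L[ℂ] HilbertTensor K L).IsPositive →
        (α A : N →L[ℂ] N).IsPositive ∧
          posTrace (α A : N →L[ℂ] N) = posTrace (A : HilbertTensor K L →L[ℂ] HilbertTensor K L))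
    (hβ : ∀ A : traceClass (HilbertTensor K L),
      (A : HilbertTensor K L →L[ℂ] HilbertTensor K L).IsPositive →
        (β A : N →L[ℂ] N).IsPositive ∧
          posTrace (β A : N →L[ℂ] N) = posTrace (A : HilbertTensor K L →L[ℂ] HilbertTensor K L))
    (h : ∀ (A : traceClass K) (B : traceClass L), α (tensorTC A B) = β (tensorTC A B)) :
    α = β := by
  refine LinearMap.ext fun A => Subtype.ext (clm_ext_quad fun u => ?_)
  let q : traceClass N →ₗ[ℂ] ℂ :=
    { toFun := fun T => ⟪u, (T : N →L[ℂ] N) u⟫_ℂ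
      map_add' := fun T S => by simp
      map_smul' := fun c T => by simp }
  -- Each diagonal form of α - β is bounded by the trace on positive operators, and rank one
  -- operators between pure tensors are themselves tensor products.
  have hd : q.comp α - q.comp β = 0 := by
    refine functional_eq_zero _ (2 * ‖u‖ ^ 2) (fun A hA => ?_) _ (dense_span_pureTensors K L) ?_
    · have h1 := norm_inner_le_trace (hα A hA).1 u
      have h2 := norm_inner_le_trace (hβ A hA).1 u
      rw [re_trace_eq (hα A hA).1, (hα A hA).2, ← re_trace_eq hA] at h1
      rw [re_trace_eq (hβ A hA).1, (hβ A hA).2, ← re_trace_eq hA] at h2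
      refine (norm_sub_le _ _).trans ((add_le_add h1 h2).trans (le_of_eq ?_))
      ring
    · rintro _ ⟨p, rfl⟩ _ ⟨p', rfl⟩
      rw [rankOneTC_pure, LinearMap.sub_apply, LinearMap.comp_apply, LinearMap.comp_apply, h,
        sub_self]
  exact sub_eq_zero.1 (LinearMap.congr_fun hd A)

/-- Both sides are positive and trace preserving, and both send A ⊗ B to (Tr B) Φ[A]. -/
theorem QuantumChannel.ptr₁_tensor (Φ : QuantumChannel K) (Ψ : QuantumChannel L) :
    (ptr₁ K L).comp (Φ.tensor Ψ).toLinearMap = Φ.toLinearMap.comp (ptr₁ K L) := by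
  have hK := isIsometricSum_tensorRight (K := K) (stdBasis L)
  refine traceClass_map_ext (fun A hA => ?_) (fun A hA => ?_) fun A B => ?_
  · have h1 := (Φ.tensor Ψ).isPositive hA
    exact ⟨hK.isPositive_partialTrace h1,
      (hK.posTrace_partialTrace h1).trans ((Φ.tensor Ψ).posTrace_apply hA)⟩
  · have h1 := hK.isPositive_partialTrace hA
    exact ⟨Φ.isPositive h1, (Φ.posTrace_apply h1).trans (hK.posTrace_partialTrace hA)⟩
  · rw [LinearMap.comp_apply, LinearMap.comp_apply, Φ.tensor_tensorTC, ptr₁_tensorTC,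
      ptr₁_tensorTC, map_smul, Ψ.trace_preserving]

theorem QuantumChannel.ptr₂_tensor (Φ : QuantumChannel K) (Ψ : QuantumChannel L) :
    (ptr₂ K L).comp (Φ.tensor Ψ).toLinearMap = Ψ.toLinearMap.comp (ptr₂ K L) := by
  have hL := isIsometricSum_tensorLeft (L := L) (stdBasis K)
  refine traceClass_map_ext (fun A hA => ?_) (fun A hA => ?_) fun A B => ?_
  · have h1 := (Φ.tensor Ψ).isPositive hA
    exact ⟨hL.isPositive_partialTrace h1,
      (hL.posTrace_partialTrace h1).trans ((Φ.tensor Ψ).posTrace_apply hA)⟩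
  · have h1 := hL.isPositive_partialTrace hA
    exact ⟨Ψ.isPositive h1, (Ψ.posTrace_apply h1).trans (hL.posTrace_partialTrace hA)⟩
  · rw [LinearMap.comp_apply, LinearMap.comp_apply, Φ.tensor_tensorTC, ptr₂_tensorTC,
      ptr₂_tensorTC, map_smul, Φ.trace_preserving]

theorem QuantumChannel.fst_tensor_apply (Φ : QuantumChannel K) (Ψ : QuantumChannel L)
    (ρ : DensityOperator (HilbertTensor K L)) :
    ((Φ.tensor Ψ).apply ρ).fst = Φ.apply ρ.fst :=
  DensityOperator.ext_op (congrArg Subtype.val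
    (LinearMap.congr_fun (Φ.ptr₁_tensor Ψ) ρ.toTraceClass))

theorem QuantumChannel.snd_tensor_apply (Φ : QuantumChannel K) (Ψ : QuantumChannel L)
    (ρ : DensityOperator (HilbertTensor K L)) :
    ((Φ.tensor Ψ).apply ρ).snd = Ψ.apply ρ.snd :=
  DensityOperator.ext_op (congrArg Subtype.val
    (LinearMap.congr_fun (Φ.ptr₂_tensor Ψ) ρ.toTraceClass))

theorem DensityOperator.fst_tensor (ρ : DensityOperator K) (σ : DensityOperator L) :
    (ρ.tensor σ).fst = ρ := by
  refine DensityOperator.ext_op ?_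
  have h := congrArg Subtype.val (ptr₁_tensorTC ρ.toTraceClass σ.toTraceClass)
  rw [σ.trace_toTraceClass, one_smul] at h
  exact h

theorem DensityOperator.snd_tensor (ρ : DensityOperator K) (σ : DensityOperator L) :
    (ρ.tensor σ).snd = σ := by
  refine DensityOperator.ext_op ?_
  have h := congrArg Subtype.val (ptr₂_tensorTC ρ.toTraceClass σ.toTraceClass)
  rw [ρ.trace_toTraceClass, one_smul] at h
  exact h

end TensorChannels

/-! ### Eigenbases of states -/

section Eigenbasis

variable {K : Type u} [NormedAddCommGroup K] [InnerProductSpace ℂ K] [CompleteSpace K]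

theorem isCompactOperator_rankOne (z w : K) :
    IsCompactOperator (InnerProductSpace.rankOne ℂ z w) := by
  rw [InnerProductSpace.rankOne_def']
  exact (isCompactOperator_of_locallyCompactSpace_rng
    (ContinuousLinearMap.toSpanSingleton ℂ z)).comp_clm (innerSL ℂ w)

/-- `A` is a norm limit of finite rank operators: the error is a positive remainder, whose norm is
at most its trace. -/
theorem isCompactOperator_of_isPositive {A : traceClass K} (hA : (A : K →L[ℂ] K).IsPositive) :
    IsCompactOperator (A : K →L[ℂ] K) := by
  let F : Finset (stdIndex K) → K →L[ℂ] K := fun s => ((A - remainder A s : traceClass K) :)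
  have hF : ∀ s, IsCompactOperator (F s) := fun s => by
    have e : F s = ∑ k ∈ s, InnerProductSpace.rankOne ℂ (CFC.sqrt (A : K →L[ℂ] K) (stdBasis K k))
        (CFC.sqrt (A : K →L[ℂ] K) (stdBasis K k)) := by
      simp [F, remainder, rankOneTC]
    rw [e]
    exact (compactOperator (RingHom.id ℂ) K K).sum_mem fun k _ => isCompactOperator_rankOne _ _
  refine isCompactOperator_of_tendsto (l := atTop) (F := F) ?_ (Eventually.of_forall hF)
  rw [tendsto_iff_norm_sub_tendsto_zero]
  refine squeeze_zero (fun _ => norm_nonneg _) (fun s => ?_) (tendsto_trace_remainder hA)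
  have h1 := isPositive_remainder hA s
  have e : F s - A = -(remainder A s : K →L[ℂ] K) := by simp [F]
  rw [e, norm_neg, re_trace_eq h1]
  exact norm_le_posTrace h1 (posTrace_lt_top h1).ne

/-- A state has an orthonormal basis of eigenvectors. -/
theorem DensityOperator.exists_eigenbasis (ρ : DensityOperator K) :
    ∃ (ι : Type u) (b : HilbertBasis ι ℂ K), ∀ i, ∃ c : ℂ, ρ.op (b i) = c • b i := by
  have hsym : (ρ.op : K →ₗ[ℂ] K).IsSymmetric := ρ.isPositive.isSymmetric
  have hc : IsCompactOperator ρ.op := isCompactOperator_of_isPositive (A := ρ.toTraceClass)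
    ρ.isPositive
  let V : ℂ → Submodule ℂ K := fun μ => Module.End.eigenspace (ρ.op : K →ₗ[ℂ] K) μ
  have hV : ∀ μ, CompleteSpace (V μ) := fun μ => by
    have : V μ = LinearMap.ker ((ρ.op - μ • (1 : K →L[ℂ] K) : K →L[ℂ] K) : K →ₗ[ℂ] K) := by
      ext x
      simp [V, sub_eq_zero]
    rw [this]
    exact (ContinuousLinearMap.isClosed_ker _).completeSpace_coe
  -- Orthonormal bases of all eigenspaces are put together; completeness is the spectral theorem for
  -- compact selfadjoint operators.
  have ho := hsym.orthogonalFamily_eigenspaces.orthonormal_sigma_orthonormal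
    (v_family := fun μ => (stdBasis (V μ) : stdIndex (V μ) → V μ))
    (fun μ => (stdBasis (V μ)).orthonormal)
  refine ⟨_, HilbertBasis.mkOfOrthogonalEqBot ho ?_, ?_⟩
  · rw [eq_bot_iff, ← ContinuousLinearMap.orthogonalComplement_iSup_eigenspaces_eq_bot hc hsym]
    intro z hz
    rw [Submodule.mem_orthogonal]
    intro y hy
    refine Submodule.iSup_induction _ (motive := fun y => ⟪y, z⟫_ℂ = 0) hy (fun μ y hy => ?_)
      (by simp) (fun a b ha hb => by rw [inner_add_left, ha, hb, add_zero])
    have h1 : (V μ).subtypeL.adjoint z = 0 := by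
      apply (stdBasis (V μ)).repr.injective
      ext k
      rw [HilbertBasis.repr_apply_apply, ContinuousLinearMap.adjoint_inner_right]
      have := Submodule.inner_right_of_mem_orthogonal
        (Submodule.subset_span (Set.mem_range_self (⟨μ, k⟩ : Σ μ, stdIndex (V μ)))) hz
      simpa using this
    have h2 := (V μ).subtypeL.adjoint_inner_right ⟨y, hy⟩ z
    rw [h1, inner_zero_right] at h2
    exact h2.symm
  · rintro ⟨μ, k⟩
    refine ⟨μ, ?_⟩
    rw [HilbertBasis.coe_mkOfOrthogonalEqBot]
    exact Module.End.mem_eigenspace_iff.1 (stdBasis (V μ) k).2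

end Eigenbasis

/-! ### Entropy: diagonal formulas, concavity, additivity, subadditivity -/

section Entropy

variable {K : Type u} [NormedAddCommGroup K] [InnerProductSpace ℂ K] [CompleteSpace K]

namespace DensityOperator

variable (ρ : DensityOperator K)

theorem spectrum_subset : ∀ x ∈ spectrum ℝ ρ.op, 0 ≤ x ∧ x ≤ 1 := by
  intro x hx
  have h0 : 0 ≤ ρ.op := (ContinuousLinearMap.nonneg_iff_isPositive _).2 ρ.isPositive
  refine ⟨spectrum_nonneg_of_nonneg h0 hx, ?_⟩
  have hn : Nontrivial (K →L[ℂ] K) := by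
    by_contra h
    rw [not_nontrivial_iff_subsingleton] at h
    rw [spectrum.of_subsingleton] at hx
    exact hx
  have : Nontrivial K := by
    by_contra h
    rw [not_nontrivial_iff_subsingleton] at h
    exact (not_subsingleton (K →L[ℂ] K)) ⟨fun a b => ContinuousLinearMap.ext fun x =>
      Subsingleton.elim _ _⟩
  have h1 := spectrum.norm_le_norm_of_mem hx
  have h2 := norm_le_posTrace ρ.isPositive (ρ.posTrace_eq_one.trans_ne ENNReal.one_ne_top)
  rw [ρ.posTrace_eq_one, ENNReal.toReal_one] at h2
  exact (le_abs_self x).trans (h1.trans h2)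

/-- The diagonal matrix element `⟨e, ρ e⟩`. -/
def diag (e : K) : ℝ := (⟪e, ρ.op e⟫_ℂ).re

theorem diag_nonneg (e : K) : 0 ≤ ρ.diag e := re_inner_nonneg ρ.isPositive e

theorem tsum_diag {ι : Type*} (b : HilbertBasis ι ℂ K) :
    ∑' i, ENNReal.ofReal (ρ.diag (b i)) = 1 := by
  rw [← ρ.posTrace_eq_one, posTrace_eq_tsum b ρ.isPositive]; rfl

theorem diag_le_one {e : K} (he : ‖e‖ = 1) : ρ.diag e ≤ 1 := by
  have h := ρ.norm_inner_op_le e e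
  rw [he, mul_one] at h
  exact (Complex.re_le_norm _).trans h

theorem isPositive_negMulLog : (cfc Real.negMulLog ρ.op).IsPositive :=
  (ContinuousLinearMap.nonneg_iff_isPositive _).1 <| cfc_nonneg fun x hx =>
    Real.negMulLog_nonneg (ρ.spectrum_subset x hx).1 (ρ.spectrum_subset x hx).2

theorem re_inner_cfc_mono {f g : ℝ → ℝ} (hf : Continuous f) (hg : Continuous g)
    (h : ∀ x, 0 ≤ x → x ≤ 1 → f x ≤ g x) (e : K) :
    (⟪e, cfc f ρ.op e⟫_ℂ).re ≤ (⟪e, cfc g ρ.op e⟫_ℂ).re := by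
  have h1 : cfc f ρ.op ≤ cfc g ρ.op := cfc_mono
    (fun x hx => h x (ρ.spectrum_subset x hx).1 (ρ.spectrum_subset x hx).2)
    hf.continuousOn hg.continuousOn
  have h2 := re_inner_nonneg ((ContinuousLinearMap.le_def _ _).1 h1) e
  rw [sub_apply, inner_sub_right, Complex.sub_re] at h2
  linarith

/-- Jensen's inequality for the concave function η. Its tangent at y is x ↦ y + (-log y - 1) x,
which dominates η on [0, 1]; the functional calculus carries this to operators, and y = ⟨e, ρ e⟩
gives the bound. -/
theorem re_inner_negMulLog_le {e : K} (he : ‖e‖ = 1) :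
    (⟪e, cfc Real.negMulLog ρ.op e⟫_ℂ).re ≤ Real.negMulLog (ρ.diag e) := by
  have key : ∀ y : ℝ, 0 < y → (⟪e, cfc Real.negMulLog ρ.op e⟫_ℂ).re ≤
      (-Real.log y - 1) * ρ.diag e + y := by
    intro y hy
    have h1 := ρ.re_inner_cfc_mono Real.continuous_negMulLog
      (g := fun x => y + (-Real.log y - 1) * x) (by fun_prop) (fun x hx _ => by
        rcases hx.eq_or_lt with rfl | hx
        · simpa using hy.le
        · rw [Real.negMulLog]
          have h2 := Real.log_le_sub_one_of_pos (div_pos hy hx)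
          rw [Real.log_div hy.ne' hx.ne'] at h2
          have h3 := mul_le_mul_of_nonneg_left h2 hx.le
          have h4 : x * (y / x - 1) = y - x := by field_simp
          rw [h4] at h3
          nlinarith) e
    have e1 : cfc (fun x => y + (-Real.log y - 1) * x) ρ.op =
        algebraMap ℝ (K →L[ℂ] K) y + (-Real.log y - 1) • ρ.op := by
      rw [cfc_const_add y (fun x => (-Real.log y - 1) * x) ρ.op (by fun_prop)
        ρ.isPositive.isSelfAdjoint,
        cfc_const_mul _ (fun x => x) ρ.op (by fun_prop),
        cfc_id' ℝ ρ.op ρ.isPositive.isSelfAdjoint]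
    rw [e1] at h1
    refine h1.trans_eq ?_
    have e2 : (algebraMap ℝ (K →L[ℂ] K) y + (-Real.log y - 1) • ρ.op) e =
        (y : ℂ) • e + ((-Real.log y - 1 : ℝ) : ℂ) • ρ.op e := by
      rw [Algebra.algebraMap_eq_smul_one]
      simp [← Complex.coe_smul]
    rw [e2, inner_add_right, inner_smul_right, inner_smul_right, inner_self_eq_norm_sq_to_K, he,
      Complex.add_re, Complex.re_ofReal_mul, Complex.re_ofReal_mul, diag]
    simp [add_comm]
  -- There is no tangent at 0; if the diagonal element vanishes, the tangents at y bound the left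
  -- side by y, for arbitrarily small y.
  rcases (ρ.diag_nonneg e).eq_or_lt with h0 | h0
  · rw [← h0, Real.negMulLog_zero]
    refine le_of_forall_pos_le_add fun y hy => ?_
    have := key y hy
    rwa [← h0, mul_zero] at this
  · have := key _ h0
    rw [Real.negMulLog]
    linarith

theorem op_apply_of_eigenvector {e : K} (he : ‖e‖ = 1) (h : ∃ c : ℂ, ρ.op e = c • e) :
    ρ.op e = (ρ.diag e : ℂ) • e := by
  obtain ⟨c, hc⟩ := h
  have h1 : ⟪e, ρ.op e⟫_ℂ = c := by
    rw [hc, inner_smul_right, inner_self_eq_norm_sq_to_K, he]; simp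
  have h2 := inner_eq_ofReal ρ.isPositive e
  rw [h1] at h2
  rw [diag, h1, ← h2, hc]

/-- For the reverse bound, log(x/p) ≤ x/p - 1 gives η(x) ≥ (1 - log p) x - x²/p, with equality at x
= p. With p the eigenvalue, only a polynomial in ρ has to be evaluated on the eigenvector. -/
theorem re_inner_negMulLog_eq {e : K} (he : ‖e‖ = 1) (h : ∃ c : ℂ, ρ.op e = c • e) :
    (⟪e, cfc Real.negMulLog ρ.op e⟫_ℂ).re = Real.negMulLog (ρ.diag e) := by
  refine le_antisymm (ρ.re_inner_negMulLog_le he) ?_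
  rcases (ρ.diag_nonneg e).eq_or_lt with h0 | h0
  · rw [← h0, Real.negMulLog_zero]
    exact re_inner_nonneg ρ.isPositive_negMulLog e
  · set p := ρ.diag e with hp
    have hop := ρ.op_apply_of_eigenvector he h
    have h1 := ρ.re_inner_cfc_mono (g := Real.negMulLog)
      (f := fun x => (1 - Real.log p) * x + (-p⁻¹) * x ^ 2) (by fun_prop)
      Real.continuous_negMulLog (fun x hx _ => by
        rcases hx.eq_or_lt with rfl | hx
        · simp
        · rw [Real.negMulLog]
          have h2 := Real.log_le_sub_one_of_pos (div_pos hx h0)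
          rw [Real.log_div hx.ne' h0.ne'] at h2
          have h3 := mul_le_mul_of_nonneg_left h2 hx.le
          have h4 : x * (x / p - 1) = p⁻¹ * x ^ 2 - x := by field_simp
          rw [h4] at h3
          nlinarith) e
    refine le_trans (le_of_eq ?_) h1
    have e1 : cfc (fun x => (1 - Real.log p) * x + (-p⁻¹) * x ^ 2) ρ.op =
        (1 - Real.log p) • ρ.op + (-p⁻¹) • ρ.op ^ 2 := by
      rw [cfc_add ρ.op (fun x => (1 - Real.log p) * x) (fun x => (-p⁻¹) * x ^ 2) (by fun_prop)
        (by fun_prop), cfc_const_mul _ (fun x => x) ρ.op (by fun_prop),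
        cfc_const_mul _ (fun x => x ^ 2) ρ.op (by fun_prop),
        cfc_pow (fun x => x) 2 ρ.op (by fun_prop) ρ.isPositive.isSelfAdjoint,
        cfc_id' ℝ ρ.op ρ.isPositive.isSelfAdjoint]
    have e2 : ((1 - Real.log p) • ρ.op + (-p⁻¹) • ρ.op ^ 2) e =
        (((1 - Real.log p) * p + (-p⁻¹) * (p * p) : ℝ) : ℂ) • e := by
      have e3 : (ρ.op ^ 2) e = ((p : ℂ) * p) • e := by
        rw [pow_two, mul_apply_eq_comp, hop, map_smul, hop, smul_smul]
      rw [add_apply, smul_apply, smul_apply, e3, hop, ← Complex.coe_smul, ← Complex.coe_smul,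
        smul_smul, smul_smul, ← add_smul]
      push_cast; rfl
    rw [e1, e2, inner_smul_right, inner_self_eq_norm_sq_to_K, he, Complex.re_ofReal_mul,
      Real.negMulLog]
    simp
    field_simp
    ring

/-- The entropy is at most the entropy of the diagonal in any orthonormal basis. -/
theorem entropy_le_tsum {ι : Type*} (b : HilbertBasis ι ℂ K) :
    ρ.entropy ≤ ∑' i, ENNReal.ofReal (Real.negMulLog (ρ.diag (b i))) := by
  rw [entropy, posTrace_eq_tsum b ρ.isPositive_negMulLog]
  exact ENNReal.tsum_le_tsum fun i =>
    ENNReal.ofReal_le_ofReal (ρ.re_inner_negMulLog_le (b.orthonormal.1 i))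

theorem entropy_eq_tsum {ι : Type*} (b : HilbertBasis ι ℂ K)
    (h : ∀ i, ∃ c : ℂ, ρ.op (b i) = c • b i) :
    ρ.entropy = ∑' i, ENNReal.ofReal (Real.negMulLog (ρ.diag (b i))) := by
  rw [entropy, posTrace_eq_tsum b ρ.isPositive_negMulLog]
  simp_rw [ρ.re_inner_negMulLog_eq (b.orthonormal.1 _) (h _)]

/-- V carries an eigenbasis of ρ to an eigenbasis of V ρ V* with the same diagonal elements. -/
theorem entropy_conj (V : unitary (K →L[ℂ] K)) : (ρ.conj V).entropy = ρ.entropy := by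
  obtain ⟨ι, b, hb⟩ := ρ.exists_eigenbasis
  let c : HilbertBasis ι ℂ K :=
    HilbertBasis.ofRepr ((Unitary.linearIsometryEquiv V).symm.trans b.repr)
  have hc : ∀ i, c i = (V : K →L[ℂ] K) (b i) := fun i => by
    classical
    rw [← HilbertBasis.repr_symm_single, ← HilbertBasis.repr_symm_single]
    rfl
  have hop : ∀ i, (ρ.conj V).op (c i) = (V : K →L[ℂ] K) (ρ.op (b i)) := fun i => by
    have h1 : star (V : K →L[ℂ] K) ((V : K →L[ℂ] K) (b i)) = b i :=
      congrArg (fun A : K →L[ℂ] K => A (b i)) (Unitary.coe_star_mul_self V)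
    rw [hc]
    change (V : K →L[ℂ] K) (ρ.op (star (V : K →L[ℂ] K) ((V : K →L[ℂ] K) (b i)))) = _
    rw [h1]
  rw [ρ.entropy_eq_tsum b hb, (ρ.conj V).entropy_eq_tsum c fun i => ?_]
  · congr 1; ext i
    rw [diag, diag, hop, hc, Unitary.inner_map_map]
  · obtain ⟨a, ha⟩ := hb i
    exact ⟨a, by rw [hop, ha, hc, map_smul]⟩

/-- The convex combination `t ρ + (1 - t) σ` of two states. -/
def mix (σ : DensityOperator K) (t : ℝ) (h0 : 0 ≤ t) (h1 : t ≤ 1) : DensityOperator K where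
  op := (t : ℂ) • ρ.op + ((1 - t : ℝ) : ℂ) • σ.op
  isPositive := isPositive_of_inner_nonneg fun x => by
    have h2 := ρ.isPositive.inner_nonneg_right x
    have h3 := σ.isPositive.inner_nonneg_right x
    rw [add_apply, smul_apply, smul_apply, inner_add_right, inner_smul_right, inner_smul_right]
    have h4 : (0 : ℂ) ≤ (t : ℂ) := by exact_mod_cast h0
    have h5 : (0 : ℂ) ≤ ((1 - t : ℝ) : ℂ) := by exact_mod_cast sub_nonneg.2 h1
    positivity
  posTrace_eq_one := by
    have h2 : ∀ x : K, ENNReal.ofReal (⟪x, ((t : ℂ) • ρ.op + ((1 - t : ℝ) : ℂ) • σ.op) x⟫_ℂ).re =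
        ENNReal.ofReal t * ENNReal.ofReal (ρ.diag x) +
          ENNReal.ofReal (1 - t) * ENNReal.ofReal (σ.diag x) := fun x => by
      rw [add_apply, smul_apply, smul_apply, inner_add_right, inner_smul_right, inner_smul_right,
        Complex.add_re, Complex.re_ofReal_mul, Complex.re_ofReal_mul, ← ENNReal.ofReal_mul h0,
        ← ENNReal.ofReal_mul (sub_nonneg.2 h1), ← ENNReal.ofReal_add]
      · rfl
      · exact mul_nonneg h0 (ρ.diag_nonneg x)
      · exact mul_nonneg (sub_nonneg.2 h1) (σ.diag_nonneg x)
    rw [posTrace]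
    simp_rw [h2]
    rw [ENNReal.tsum_add, ENNReal.tsum_mul_left, ENNReal.tsum_mul_left, tsum_diag, tsum_diag,
      mul_one, mul_one, ← ENNReal.ofReal_add h0 (sub_nonneg.2 h1)]
    simp

theorem diag_mix (σ : DensityOperator K) (t : ℝ) (h0 : 0 ≤ t) (h1 : t ≤ 1) (x : K) :
    (ρ.mix σ t h0 h1).diag x = t * ρ.diag x + (1 - t) * σ.diag x := by
  change (⟪x, ((t : ℂ) • ρ.op + ((1 - t : ℝ) : ℂ) • σ.op) x⟫_ℂ).re = _
  rw [add_apply, smul_apply, smul_apply, inner_add_right, inner_smul_right, inner_smul_right,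
    Complex.add_re, Complex.re_ofReal_mul, Complex.re_ofReal_mul]
  rfl

/-- Concavity of the entropy. -/
theorem entropy_mix_ge (σ : DensityOperator K) (t : ℝ) (h0 : 0 ≤ t) (h1 : t ≤ 1) :
    ENNReal.ofReal t * ρ.entropy + ENNReal.ofReal (1 - t) * σ.entropy ≤
      (ρ.mix σ t h0 h1).entropy := by
  -- In an eigenbasis of the mixture its entropy equals that of its diagonal, while the entropies of
  -- ρ and σ are at most those of theirs; concavity of η then applies termwise.
  obtain ⟨ι, b, hb⟩ := (ρ.mix σ t h0 h1).exists_eigenbasis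
  rw [(ρ.mix σ t h0 h1).entropy_eq_tsum b hb]
  calc ENNReal.ofReal t * ρ.entropy + ENNReal.ofReal (1 - t) * σ.entropy
      ≤ ENNReal.ofReal t * ∑' i, ENNReal.ofReal (Real.negMulLog (ρ.diag (b i))) +
        ENNReal.ofReal (1 - t) * ∑' i, ENNReal.ofReal (Real.negMulLog (σ.diag (b i))) := by
        gcongr
        · exact ρ.entropy_le_tsum b
        · exact σ.entropy_le_tsum b
    _ = ∑' i, (ENNReal.ofReal t * ENNReal.ofReal (Real.negMulLog (ρ.diag (b i))) +
        ENNReal.ofReal (1 - t) * ENNReal.ofReal (Real.negMulLog (σ.diag (b i)))) := by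
        rw [ENNReal.tsum_add, ENNReal.tsum_mul_left, ENNReal.tsum_mul_left]
    _ ≤ _ := by
        refine ENNReal.tsum_le_tsum fun i => ?_
        have hn := fun τ : DensityOperator K =>
          Real.negMulLog_nonneg (τ.diag_nonneg (b i)) (τ.diag_le_one (b.orthonormal.1 i))
        rw [← ENNReal.ofReal_mul h0, ← ENNReal.ofReal_mul (sub_nonneg.2 h1),
          ← ENNReal.ofReal_add (mul_nonneg h0 (hn ρ)) (mul_nonneg (sub_nonneg.2 h1) (hn σ)),
          diag_mix]
        refine ENNReal.ofReal_le_ofReal ?_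
        exact Real.concaveOn_negMulLog.2 (ρ.diag_nonneg (b i)) (σ.diag_nonneg (b i)) h0
          (sub_nonneg.2 h1) (by ring)

end DensityOperator

/-- The inequality log s ≤ s - 1 at s = pq/w, multiplied by w. The term w is added on the left
rather than subtracted on the right, so that the inequality can be summed in [0, ∞]. -/
theorem ofReal_negMulLog_add_le {w p q : ℝ} (hw : 0 ≤ w) (hwp : w ≤ p) (hwq : w ≤ q)
    (hp : p ≤ 1) (hq : q ≤ 1) :
    ENNReal.ofReal (Real.negMulLog w) + ENNReal.ofReal w ≤
      ENNReal.ofReal w * ENNReal.ofReal (-Real.log p) +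
        ENNReal.ofReal w * ENNReal.ofReal (-Real.log q) + ENNReal.ofReal p * ENNReal.ofReal q := by
  rcases hw.eq_or_lt with rfl | hw'
  · simp
  have hp0 := hw'.trans_le hwp
  have hq0 := hw'.trans_le hwq
  have h1 : 0 ≤ -Real.log p := neg_nonneg.2 (Real.log_nonpos hp0.le hp)
  have h2 : 0 ≤ -Real.log q := neg_nonneg.2 (Real.log_nonpos hq0.le hq)
  rw [← ENNReal.ofReal_mul hw, ← ENNReal.ofReal_mul hw, ← ENNReal.ofReal_mul hp0.le,
    ← ENNReal.ofReal_add (Real.negMulLog_nonneg hw (hwp.trans hp)) hw,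
    ← ENNReal.ofReal_add (mul_nonneg hw h1) (mul_nonneg hw h2),
    ← ENNReal.ofReal_add (by positivity) (by positivity)]
  refine ENNReal.ofReal_le_ofReal ?_
  have h3 := Real.log_le_sub_one_of_pos (div_pos (mul_pos hp0 hq0) hw')
  rw [Real.log_div (mul_pos hp0 hq0).ne' hw'.ne', Real.log_mul hp0.ne' hq0.ne'] at h3
  have h4 := mul_le_mul_of_nonneg_left h3 hw
  have h5 : w * (p * q / w - 1) = p * q - w := by field_simp
  rw [h5] at h4
  rw [Real.negMulLog]
  linarith

variable {L : Type u} [NormedAddCommGroup L] [InnerProductSpace ℂ L] [CompleteSpace L]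

namespace DensityOperator

theorem diag_tensor (ρ : DensityOperator K) (σ : DensityOperator L) (x : K) (y : L) :
    (ρ.tensor σ).diag (pureTensor x y) = ρ.diag x * σ.diag y := by
  change (⟪pureTensor x y, opTensor ρ.op σ.op (pureTensor x y)⟫_ℂ).re = _
  rw [opTensor_pure, inner_pure, inner_eq_ofReal ρ.isPositive, inner_eq_ofReal σ.isPositive,
    ← Complex.ofReal_mul]
  rfl

/-- Additivity of the entropy on product states. -/
theorem entropy_tensor (ρ : DensityOperator K) (σ : DensityOperator L) :
    (ρ.tensor σ).entropy = ρ.entropy + σ.entropy := by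
  obtain ⟨ι, b, hb⟩ := ρ.exists_eigenbasis
  obtain ⟨κ, c, hc⟩ := σ.exists_eigenbasis
  have hbc : ∀ p, ∃ a : ℂ, (ρ.tensor σ).op (tensorBasis b c p) = a • tensorBasis b c p := by
    rintro ⟨i, j⟩
    obtain ⟨x, hx⟩ := hb i
    obtain ⟨y, hy⟩ := hc j
    refine ⟨x * y, ?_⟩
    rw [tensorBasis_apply]
    change opTensor ρ.op σ.op _ = _
    rw [opTensor_pure, hx, hy, pure_smul_left, pure_smul_right, smul_smul]
  rw [(ρ.tensor σ).entropy_eq_tsum _ hbc, ρ.entropy_eq_tsum b hb, σ.entropy_eq_tsum c hc,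
    ENNReal.tsum_prod']
  have e : ∀ i j, ENNReal.ofReal (Real.negMulLog ((ρ.tensor σ).diag (tensorBasis b c (i, j)))) =
      ENNReal.ofReal (Real.negMulLog (ρ.diag (b i))) * ENNReal.ofReal (σ.diag (c j)) +
        ENNReal.ofReal (ρ.diag (b i)) * ENNReal.ofReal (Real.negMulLog (σ.diag (c j))) := by
    intro i j
    have h1 := Real.negMulLog_nonneg (ρ.diag_nonneg (b i)) (ρ.diag_le_one (b.orthonormal.1 i))
    have h2 := Real.negMulLog_nonneg (σ.diag_nonneg (c j)) (σ.diag_le_one (c.orthonormal.1 j))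
    rw [tensorBasis_apply, diag_tensor, Real.negMulLog_mul, ← ENNReal.ofReal_mul h1,
      ← ENNReal.ofReal_mul (ρ.diag_nonneg _), ← ENNReal.ofReal_add
        (mul_nonneg h1 (σ.diag_nonneg _)) (mul_nonneg (ρ.diag_nonneg _) h2)]
    congr 1; ring
  simp_rw [e, ENNReal.tsum_add, ENNReal.tsum_mul_left, ENNReal.tsum_mul_right, tsum_diag, one_mul,
    mul_one]

/-- The sum is the trace of the compression of ω along y ↦ x ⊗ y, so it does not depend on the basis
`c`; in the basis defining the partial trace it is the diagonal element of the marginal. -/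
theorem tsum_diag_left (ω : DensityOperator (HilbertTensor K L)) {κ : Type*}
    (c : HilbertBasis κ ℂ L) (x : K) :
    ∑' j, ENNReal.ofReal (ω.diag (pureTensor x (c j))) = ENNReal.ofReal (ω.fst.diag x) := by
  have hp := isPositive_sandwich (tensorLeft (L := L) x) ω.isPositive
  have h1 : ∑' j, ENNReal.ofReal (ω.diag (pureTensor x (c j))) =
      posTrace (sandwich (tensorLeft (L := L) x) (tensorLeft x) ω.op) := by
    rw [posTrace_eq_tsum c hp]
    simp_rw [inner_sandwich]
    rfl
  have h2 := Complex.hasSum_re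
    ((isIsometricSum_tensorRight (K := K) (stdBasis L)).hasSum_inner_partialTrace
    ω.toTraceClass x x)
  rw [h1, posTrace]
  simp_rw [inner_sandwich]
  refine (ENNReal.ofReal_tsum_of_nonneg (fun j => ω.diag_nonneg (pureTensor x (stdBasis L j)))
    h2.summable).symm.trans ?_
  exact congrArg _ h2.tsum_eq

theorem tsum_diag_right (ω : DensityOperator (HilbertTensor K L)) {ι : Type*}
    (b : HilbertBasis ι ℂ K) (y : L) :
    ∑' i, ENNReal.ofReal (ω.diag (pureTensor (b i) y)) = ENNReal.ofReal (ω.snd.diag y) := by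
  have hp := isPositive_sandwich (tensorRight (K := K) y) ω.isPositive
  have h1 : ∑' i, ENNReal.ofReal (ω.diag (pureTensor (b i) y)) =
      posTrace (sandwich (tensorRight (K := K) y) (tensorRight y) ω.op) := by
    rw [posTrace_eq_tsum b hp]
    simp_rw [inner_sandwich]
    rfl
  have h2 := Complex.hasSum_re
    ((isIsometricSum_tensorLeft (L := L) (stdBasis K)).hasSum_inner_partialTrace
    ω.toTraceClass y y)
  rw [h1, posTrace]
  simp_rw [inner_sandwich]
  refine (ENNReal.ofReal_tsum_of_nonneg (fun j => ω.diag_nonneg (pureTensor (stdBasis K j) y))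
    h2.summable).symm.trans ?_
  exact congrArg _ h2.tsum_eq

/-- Subadditivity of the entropy. -/
theorem entropy_le_add (ω : DensityOperator (HilbertTensor K L)) :
    ω.entropy ≤ ω.fst.entropy + ω.snd.entropy := by
  obtain ⟨ι, b, hb⟩ := ω.fst.exists_eigenbasis
  obtain ⟨κ, c, hc⟩ := ω.snd.exists_eigenbasis
  set w : ι → κ → ℝ := fun i j => ω.diag (pureTensor (b i) (c j)) with hw
  have hr : ∀ i, ∑' j, ENNReal.ofReal (w i j) = ENNReal.ofReal (ω.fst.diag (b i)) := fun i =>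
    ω.tsum_diag_left c (b i)
  have hs : ∀ j, ∑' i, ENNReal.ofReal (w i j) = ENNReal.ofReal (ω.snd.diag (c j)) := fun j =>
    ω.tsum_diag_right b (c j)
  have hlog : ∀ p : ℝ, 0 ≤ p → ENNReal.ofReal p * ENNReal.ofReal (-Real.log p) =
      ENNReal.ofReal (Real.negMulLog p) := fun p hp => by
    rw [← ENNReal.ofReal_mul hp, Real.negMulLog]; congr 1; ring
  have hone : ∑' i, ∑' j, ENNReal.ofReal (w i j) = 1 := by
    simp_rw [hr, tsum_diag]
  -- The summand 1 is Σ wᵢⱼ on the left and Σ pᵢ qⱼ on the right, where pᵢ and qⱼ are the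
  -- eigenvalues of the marginals; being finite, it cancels.
  have key : ω.entropy + 1 ≤ ω.fst.entropy + ω.snd.entropy + 1 := by
    calc ω.entropy + 1
        ≤ ∑' i, ∑' j, ENNReal.ofReal (Real.negMulLog (w i j)) + 1 := by
          gcongr
          refine (ω.entropy_le_tsum (tensorBasis b c)).trans_eq ?_
          rw [ENNReal.tsum_prod']
          simp_rw [tensorBasis_apply, hw]
      _ = ∑' i, ∑' j, (ENNReal.ofReal (Real.negMulLog (w i j)) + ENNReal.ofReal (w i j)) := by
          simp_rw [ENNReal.tsum_add, hone]
      _ ≤ ∑' i, ∑' j, (ENNReal.ofReal (w i j) * ENNReal.ofReal (-Real.log (ω.fst.diag (b i))) +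
            ENNReal.ofReal (w i j) * ENNReal.ofReal (-Real.log (ω.snd.diag (c j))) +
            ENNReal.ofReal (ω.fst.diag (b i)) * ENNReal.ofReal (ω.snd.diag (c j))) := by
          refine ENNReal.tsum_le_tsum fun i => ENNReal.tsum_le_tsum fun j => ?_
          refine ofReal_negMulLog_add_le (ω.diag_nonneg _) ?_ ?_
            (ω.fst.diag_le_one (b.orthonormal.1 i)) (ω.snd.diag_le_one (c.orthonormal.1 j))
          · rw [← ENNReal.ofReal_le_ofReal_iff (ω.fst.diag_nonneg _), ← hr]
            exact ENNReal.le_tsum j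
          · rw [← ENNReal.ofReal_le_ofReal_iff (ω.snd.diag_nonneg _), ← hs]
            exact ENNReal.le_tsum (f := fun i => ENNReal.ofReal (w i j)) i
      _ = ω.fst.entropy + ω.snd.entropy + 1 := by
          simp_rw [ENNReal.tsum_add]
          rw [ENNReal.tsum_comm (f := fun i j => ENNReal.ofReal (w i j) *
            ENNReal.ofReal (-Real.log (ω.snd.diag (c j))))]
          simp_rw [ENNReal.tsum_mul_right, ENNReal.tsum_mul_left, ENNReal.tsum_mul_right, hr, hs,
            tsum_diag, hlog _ (ω.fst.diag_nonneg _), hlog _ (ω.snd.diag_nonneg _)]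
          rw [ω.fst.entropy_eq_tsum b hb, ω.snd.entropy_eq_tsum c hc, mul_one]
  exact (ENNReal.add_le_add_iff_right ENNReal.one_ne_top).1 key

end DensityOperator

end Entropy

/-! ### Strong sums of orthogonal projections -/

section ProjectionSum

variable {M : Type u} [NormedAddCommGroup M] [InnerProductSpace ℂ M] [CompleteSpace M]

theorem inner_starProjection_left {P : M →L[ℂ] M} (hP : IsStarProjection P) (x y : M) :
    ⟪P x, y⟫_ℂ = ⟪x, P y⟫_ℂ := by
  conv_lhs => rw [← hP.isSelfAdjoint.star_eq]
  exact inner_star_left P x y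

theorem norm_sq_starProjection {P : M →L[ℂ] M} (hP : IsStarProjection P) (x : M) :
    ⟪x, P x⟫_ℂ = ((‖P x‖ ^ 2 : ℝ) : ℂ) := by
  have h : P (P x) = P x := congrArg (fun A : M →L[ℂ] M => A x) hP.isIdempotentElem.eq
  rw [← h, ← inner_starProjection_left hP, inner_self_eq_norm_sq_to_K, h]
  norm_cast

theorem norm_starProjection_apply_le {P : M →L[ℂ] M} (hP : IsStarProjection P) (x : M) :
    ‖P x‖ ≤ ‖x‖ := by
  have h1 := norm_inner_le_norm (𝕜 := ℂ) x (P x)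
  rw [norm_sq_starProjection hP, Complex.norm_real, Real.norm_of_nonneg (by positivity)] at h1
  rcases (norm_nonneg (P x)).eq_or_lt with h0 | h0
  · rw [← h0]; positivity
  · nlinarith

theorem isStarProjection_zero : IsStarProjection (0 : M →L[ℂ] M) := .zero _

theorem isStarProjection_one_sub {P : M →L[ℂ] M} (hP : IsStarProjection P) :
    IsStarProjection (1 - P) := hP.one_sub

/-- A sequence of mutually orthogonal projections has a strong sum, which is a projection. -/
theorem exists_hasSum_starProjection {P : ℕ → M →L[ℂ] M} (hP : ∀ i, IsStarProjection (P i))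
    (h0 : ∀ i j, i ≠ j → P i * P j = 0) :
    ∃ Q : M →L[ℂ] M, IsStarProjection Q ∧ ∀ z, HasSum (fun i => P i z) (Q z) := by
  have hS : ∀ s : Finset ℕ, IsStarProjection (∑ i ∈ s, P i) := fun s => by
    refine ⟨?_, ?_⟩
    · change (∑ i ∈ s, P i) * (∑ i ∈ s, P i) = _
      rw [Finset.sum_mul_sum]
      refine Finset.sum_congr rfl fun i hi => ?_
      rw [Finset.sum_eq_single_of_mem i hi fun j _ hj => h0 i j hj.symm]
      exact (hP i).isIdempotentElem.eq
    · exact isSelfAdjoint_sum s fun i _ => (hP i).isSelfAdjoint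
  have hz : ∀ (i j : ℕ) (z : M), i ≠ j → P i (P j z) = 0 := fun i j z hij =>
    congrArg (fun A : M →L[ℂ] M => A z) (h0 i j hij)
  have hi : ∀ (i : ℕ) (z : M), P i (P i z) = P i z := fun i z =>
    congrArg (fun A : M →L[ℂ] M => A z) (hP i).isIdempotentElem.eq
  have hle : ∀ (s : Finset ℕ) (z : M), ‖∑ i ∈ s, P i z‖ ≤ ‖z‖ := fun s z => by
    simpa using norm_starProjection_apply_le (hS s) z
  -- The vectors `P i z` are orthogonal, and each finite sum of their squared norms is ‖Sz‖² ≤ ‖z‖²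
  -- for the projection S = Σ Pᵢ.
  have hsum : ∀ z, Summable fun i => P i z := fun z => by
    have ho : OrthogonalFamily ℂ (fun i => LinearMap.range (P i : M →ₗ[ℂ] M))
        fun i => (LinearMap.range (P i : M →ₗ[ℂ] M)).subtypeₗᵢ := by
      rintro i j hij ⟨_, a, rfl⟩ ⟨_, b, rfl⟩
      change ⟪P i a, P j b⟫_ℂ = 0
      rw [inner_starProjection_left (hP i), hz i j b hij, inner_zero_right]
    refine (ho.summable_iff_norm_sq_summable fun i => ⟨P i z, z, rfl⟩).2 ?_
    refine summable_of_sum_le (c := ‖z‖ ^ 2) (fun i => by positivity) fun s => ?_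
    have h1 := norm_sq_starProjection (hS s) z
    have h2 : ⟪z, (∑ i ∈ s, P i) z⟫_ℂ = ((∑ i ∈ s, ‖P i z‖ ^ 2 : ℝ) : ℂ) := by
      rw [sum_apply, inner_sum, Complex.ofReal_sum]
      exact Finset.sum_congr rfl fun i _ => norm_sq_starProjection (hP i) z
    rw [h2] at h1
    refine (Complex.ofReal_injective h1).trans_le ?_
    gcongr
    exact norm_starProjection_apply_le (hS s) z
  let Q : M →L[ℂ] M := LinearMap.mkContinuous
    { toFun := fun z => ∑' i, P i z
      map_add' := fun x y => by
        simp only [map_add]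
        exact (hsum x).tsum_add (hsum y)
      map_smul' := fun c x => by
        simp only [map_smul, RingHom.id_apply]
        exact (hsum x).tsum_const_smul c } 1
    (fun z => by
      rw [one_mul]
      exact le_of_tendsto (hsum z).hasSum.norm (Eventually.of_forall fun s => hle s z))
  have hQ : ∀ z, HasSum (fun i => P i z) (Q z) := fun z => (hsum z).hasSum
  refine ⟨Q, ⟨?_, ?_⟩, hQ⟩
  · refine ContinuousLinearMap.ext fun z => ?_
    refine (hQ (Q z)).unique ?_
    -- Orthogonality leaves a single term in Pᵢ Q = Σⱼ Pᵢ Pⱼ; summing over i gives Q² = Q.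
    have : ∀ i, P i (Q z) = P i z := fun i => by
      refine ((hQ z).mapL (P i)).unique ?_
      have h3 := hasSum_single (f := fun j => P i (P j z)) i fun j hj => hz i j z hj.symm
      rwa [hi] at h3
    simp_rw [this]
    exact hQ z
  · refine ContinuousLinearMap.ext fun y => ext_inner_left ℂ fun x => ?_
    rw [inner_star_right]
    refine ((hQ x).mapL ((innerSL ℂ).flip y)).unique ?_
    have := (hQ y).mapL (innerSL ℂ x)
    simp only [innerSL_apply_apply, ← inner_starProjection_left (hP _)] at this
    exact this

end ProjectionSum

/-! ### Product spectral measures and the energy of composite systems -/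

section Product

variable {K : Type u} [NormedAddCommGroup K] [InnerProductSpace ℂ K] [CompleteSpace K]
  {L : Type u} [NormedAddCommGroup L] [InnerProductSpace ℂ L] [CompleteSpace L]
  {Ω : Type v} [MeasurableSpace Ω] {Ω' : Type w} [MeasurableSpace Ω']

namespace SpectralMeasure

instance (E : SpectralMeasure Ω K) (x : K) : IsFiniteMeasure (E.scalarMeasure x) :=
  ⟨by rw [E.scalarMeasure_apply x .univ]; exact ENNReal.ofReal_lt_top⟩

theorem scalarMeasure_real (E : SpectralMeasure Ω K) (x : K) {s : Set Ω} (hs : MeasurableSet s) :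
    (((E.scalarMeasure x).real s : ℝ) : ℂ) = ⟪x, E.proj s x⟫_ℂ := by
  rw [E.inner_proj x hs, Measure.real, E.scalarMeasure_apply x hs,
    ENNReal.toReal_ofReal (by positivity)]

theorem scalarMeasure_proj (E : SpectralMeasure Ω K) (x : K) {s : Set Ω} (hs : MeasurableSet s) :
    E.scalarMeasure (E.proj s x) = (E.scalarMeasure x).restrict s := by
  ext t ht
  rw [Measure.restrict_apply ht, E.scalarMeasure_apply _ ht, E.scalarMeasure_apply _ (ht.inter hs),
    E.proj_inter t s ht hs]
  rfl

/-- `P` is the value at `A` of the product of `E` and `F`, tested on product vectors. -/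
structure IsProdValue (E : SpectralMeasure Ω K) (F : SpectralMeasure Ω' L) (A : Set (Ω × Ω'))
    (P : HilbertTensor K L →L[ℂ] HilbertTensor K L) : Prop where
  form : ∀ x y, ⟪pureTensor x y, P (pureTensor x y)⟫_ℂ =
    ((((E.scalarMeasure x).prod (F.scalarMeasure y)).real A : ℝ) : ℂ)
  commute : ∀ s t, MeasurableSet s → MeasurableSet t →
    Commute P (opTensor (E.proj s) (F.proj t))

variable {E : SpectralMeasure Ω K} {F : SpectralMeasure Ω' L}

theorem isStarProjection_opTensor {P : K →L[ℂ] K} {Q : L →L[ℂ] L} (hP : IsStarProjection P)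
    (hQ : IsStarProjection Q) : IsStarProjection (opTensor P Q) where
  isIdempotentElem := by
    change _ * _ = _
    rw [← opTensor_mul, hP.isIdempotentElem.eq, hQ.isIdempotentElem.eq]
  isSelfAdjoint := by
    change star _ = _
    rw [star_opTensor, hP.isSelfAdjoint.star_eq, hQ.isSelfAdjoint.star_eq]

namespace IsProdValue

theorem unique {A : Set (Ω × Ω')} {P Q : HilbertTensor K L →L[ℂ] HilbertTensor K L}
    (hP : IsProdValue E F A P) (hQ : IsProdValue E F A Q) : P = Q :=
  clm_ext_quad_pure fun x y => by rw [hP.form, hQ.form]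

theorem proj_commute (E : SpectralMeasure Ω K) {s t : Set Ω} (hs : MeasurableSet s)
    (ht : MeasurableSet t) : E.proj s * E.proj t = E.proj t * E.proj s := by
  rw [← E.proj_inter s t hs ht, Set.inter_comm, E.proj_inter t s ht hs]

/-- The rectangle projection R commutes with Q, so RQ = RQR. The form of RQR at x ⊗ y is that of Q
at E(s)x ⊗ F(t)y, and the scalar measures of these vectors are restrictions to s and t. -/
theorem rect_mul {s : Set Ω} {t : Set Ω'} (hs : MeasurableSet s) (ht : MeasurableSet t)
    {B : Set (Ω × Ω')} (hB : MeasurableSet B) {Q : HilbertTensor K L →L[ℂ] HilbertTensor K L}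
    (hQ : IsProdValue E F B Q) :
    IsProdValue E F ((s ×ˢ t) ∩ B) (opTensor (E.proj s) (F.proj t) * Q) where
  form x y := by
    have hR := isStarProjection_opTensor (E.isStarProjection s hs) (F.isStarProjection t ht)
    have h1 : opTensor (E.proj s) (F.proj t) * Q = opTensor (E.proj s) (F.proj t) * Q *
        opTensor (E.proj s) (F.proj t) := by
      rw [mul_assoc, (hQ.commute s t hs ht).eq, ← mul_assoc, hR.isIdempotentElem.eq]
    rw [h1, mul_apply_eq_comp, mul_apply_eq_comp, ← inner_starProjection_left hR, opTensor_pure,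
      hQ.form, E.scalarMeasure_proj x hs, F.scalarMeasure_proj y ht, Measure.prod_restrict,
      measureReal_restrict_apply hB, Set.inter_comm]
  commute s' t' hs' ht' := by
    refine Commute.mul_left ?_ (hQ.commute s' t' hs' ht')
    change _ * _ = _ * _
    rw [← opTensor_mul, ← opTensor_mul, proj_commute E hs hs', proj_commute F ht ht']

theorem univ : IsProdValue E F Set.univ 1 where
  form x y := by
    rw [← Set.univ_prod_univ, Measure.real, Measure.prod_prod, ENNReal.toReal_mul,
      Complex.ofReal_mul]
    change _ = (((E.scalarMeasure x).real Set.univ : ℝ) : ℂ) *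
      (((F.scalarMeasure y).real Set.univ : ℝ) : ℂ)
    rw [E.scalarMeasure_real x .univ, F.scalarMeasure_real y .univ, E.proj_univ, F.proj_univ,
      one_apply_eq_self, one_apply_eq_self, one_apply_eq_self, inner_pure]
  commute _ _ _ _ := Commute.one_left _

theorem empty : IsProdValue E F ∅ 0 where
  form x y := by simp
  commute _ _ _ _ := Commute.zero_left _

theorem diff {A B : Set (Ω × Ω')} (hA : MeasurableSet A) (hAB : A ⊆ B)
    {P Q : HilbertTensor K L →L[ℂ] HilbertTensor K L} (hP : IsProdValue E F A P)
    (hQ : IsProdValue E F B Q) : IsProdValue E F (B \ A) (Q - P) where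
  form x y := by
    rw [sub_apply, inner_sub_right, hP.form, hQ.form, measureReal_sdiff hAB hA, Complex.ofReal_sub]
  commute s t hs ht := (hQ.commute s t hs ht).sub_left (hP.commute s t hs ht)

theorem iUnion {f : ℕ → Set (Ω × Ω')} (hf : ∀ i, MeasurableSet (f i))
    (hd : Pairwise (Function.onFun Disjoint f))
    {P : ℕ → HilbertTensor K L →L[ℂ] HilbertTensor K L} (hP : ∀ i, IsProdValue E F (f i) (P i))
    {Q : HilbertTensor K L →L[ℂ] HilbertTensor K L}
    (hQ : ∀ z, HasSum (fun i => P i z) (Q z)) : IsProdValue E F (⋃ i, f i) Q where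
  form x y := by
    refine ((hQ (pureTensor x y)).mapL (innerSL ℂ (pureTensor x y))).unique ?_
    set m := (E.scalarMeasure x).prod (F.scalarMeasure y)
    have h1 : HasSum (fun i => m.real (f i)) (m.real (⋃ i, f i)) := by
      have h2 := ENNReal.hasSum_toReal (f := fun i => m (f i)) (by
        rw [← measure_iUnion hd hf]; exact measure_ne_top _ _)
      rwa [← ENNReal.tsum_toReal_eq (fun i => measure_ne_top _ _), ← measure_iUnion hd hf] at h2
    have h3 := Complex.hasSum_ofReal.2 h1
    have h4 : ∀ i, ((m.real (f i) : ℝ) : ℂ) = ⟪pureTensor x y, P i (pureTensor x y)⟫_ℂ :=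
      fun i => ((hP i).form x y).symm
    simp_rw [h4] at h3
    exact h3
  commute s t hs ht := ContinuousLinearMap.ext fun z => by
    change Q (opTensor (E.proj s) (F.proj t) z) = opTensor (E.proj s) (F.proj t) (Q z)
    refine (hQ _).unique ?_
    have h1 := (hQ z).mapL (opTensor (E.proj s) (F.proj t))
    have h2 : ∀ i, P i (opTensor (E.proj s) (F.proj t) z) =
      opTensor (E.proj s) (F.proj t) (P i z) := fun i =>
        congrArg (fun A : HilbertTensor K L →L[ℂ] HilbertTensor K L => A z)
          ((hP i).commute s t hs ht).eq
    simp_rw [h2]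
    exact h1

end IsProdValue

variable (E F) in
-- π-λ induction starting from rectangles. The induction carries multiplicativity against every
-- measurable B: this makes the projections of disjoint sets orthogonal, so that a countable
-- disjoint union has a strong sum of projections as its value.
theorem exists_isProdValue (A : Set (Ω × Ω')) (hA : MeasurableSet A) :
    ∃ P, IsStarProjection P ∧ IsProdValue E F A P ∧ ∀ B Q, MeasurableSet B →
      IsProdValue E F B Q → IsProdValue E F (A ∩ B) (P * Q) := by
  induction A, hA using MeasurableSpace.induction_on_inter generateFrom_prod.symm
    isPiSystem_prod with
  | empty =>
    refine ⟨0, isStarProjection_zero, .empty, fun B Q hB hQ => ?_⟩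
    rw [Set.empty_inter, zero_mul]
    exact .empty
  | basic A hA =>
    obtain ⟨s, hs, t, ht, rfl⟩ := hA
    refine ⟨opTensor (E.proj s) (F.proj t), isStarProjection_opTensor (E.isStarProjection s hs)
      (F.isStarProjection t ht), ?_, fun B Q hB hQ => hQ.rect_mul hs ht hB⟩
    simpa using IsProdValue.univ.rect_mul (E := E) (F := F) hs ht .univ
  | compl A hA ih =>
    obtain ⟨P, hP, h1, h2⟩ := ih
    refine ⟨1 - P, isStarProjection_one_sub hP, ?_, fun B Q hB hQ => ?_⟩
    · rw [Set.compl_eq_univ_sdiff]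
      exact h1.diff hA (Set.subset_univ _) .univ
    · have h3 := (h2 B Q hB hQ).diff (hA.inter hB) Set.inter_subset_right hQ
      rw [sub_mul, one_mul]
      convert h3 using 1
      ext p
      simp only [Set.mem_inter_iff, Set.mem_compl_iff, Set.mem_sdiff]
      tauto
  | iUnion f hd hf ih =>
    choose P hP h1 h2 using ih
    have h0 : ∀ i j, i ≠ j → P i * P j = 0 := fun i j hij => by
      have h3 := h2 i (f j) (P j) (hf j) (h1 j)
      rw [Set.disjoint_iff_inter_eq_empty.1 (hd hij)] at h3
      exact h3.unique .empty
    obtain ⟨Q, hQ, hsum⟩ := exists_hasSum_starProjection hP h0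
    refine ⟨Q, hQ, .iUnion hf hd h1 hsum, fun B R hB hR => ?_⟩
    rw [Set.iUnion_inter]
    refine .iUnion (fun i => (hf i).inter hB) (fun i j hij => ?_)
      (fun i => h2 i B R hB hR) (fun z => hsum (R z))
    exact (hd hij).mono Set.inter_subset_left Set.inter_subset_left

variable (E F) in
open Classical in
/-- The product of two spectral measures. -/
def product : SpectralMeasure (Ω × Ω') (HilbertTensor K L) where
  proj A := if hA : MeasurableSet A then (exists_isProdValue E F A hA).choose else 0
  isStarProjection A hA := by
    rw [dif_pos hA]; exact (exists_isProdValue E F A hA).choose_spec.1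
  proj_univ := by
    rw [dif_pos .univ]
    exact (exists_isProdValue E F _ .univ).choose_spec.2.1.unique .univ
  proj_inter A B hA hB := by
    rw [dif_pos hA, dif_pos hB, dif_pos (hA.inter hB)]
    exact (exists_isProdValue E F _ (hA.inter hB)).choose_spec.2.1.unique
      ((exists_isProdValue E F A hA).choose_spec.2.2 B _ hB
        (exists_isProdValue E F B hB).choose_spec.2.1)
  hasSum_inner z f hf hd := by
    have hfi : ∀ i, (if hA : MeasurableSet (f i) then (exists_isProdValue E F (f i) hA).choose
        else 0) = (exists_isProdValue E F (f i) (hf i)).choose := fun i => dif_pos (hf i)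
    simp_rw [hfi]
    rw [dif_pos (.iUnion hf)]
    have hs := fun i => (exists_isProdValue E F (f i) (hf i)).choose_spec
    have h0 : ∀ i j, i ≠ j → (exists_isProdValue E F (f i) (hf i)).choose *
        (exists_isProdValue E F (f j) (hf j)).choose = 0 := fun i j hij => by
      have h3 := (hs i).2.2 (f j) _ (hf j) (hs j).2.1
      rw [Set.disjoint_iff_inter_eq_empty.1 (hd hij)] at h3
      exact h3.unique .empty
    obtain ⟨Q, -, hsum⟩ := exists_hasSum_starProjection (fun i => (hs i).1) h0
    rw [(exists_isProdValue E F _ (.iUnion hf)).choose_spec.2.1.unique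
      (.iUnion hf hd (fun i => (hs i).2.1) hsum)]
    exact (hsum z).mapL (innerSL ℂ z)

variable (E F) in
-- `product` is a witness for the existence required in the definition of `prod`, so the default
-- value there never occurs.
theorem prod_proj [Nonempty (Ω × Ω')] {s : Set Ω} {t : Set Ω'} (hs : MeasurableSet s)
    (ht : MeasurableSet t) : (E.prod F).proj (s ×ˢ t) = opTensor (E.proj s) (F.proj t) := by
  have h : ∃ G : SpectralMeasure (Ω × Ω') (HilbertTensor K L), ∀ s t, MeasurableSet s →
      MeasurableSet t → G.proj (s ×ˢ t) = opTensor (E.proj s) (F.proj t) := by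
    refine ⟨product E F, fun s t hs ht => ?_⟩
    have h1 : (product E F).proj (s ×ˢ t) = (exists_isProdValue E F _ (hs.prod ht)).choose :=
      dif_pos (hs.prod ht)
    rw [h1]
    refine (exists_isProdValue E F _ (hs.prod ht)).choose_spec.2.1.unique ?_
    simpa using IsProdValue.univ.rect_mul (E := E) (F := F) hs ht .univ
  rw [prod, dif_pos h]
  exact h.choose_spec s t hs ht

/-- Cyclicity turns Tr √ρ P √ρ into Tr P ρ P, which is free of the square root and can be computed
in any basis. -/
theorem posTrace_sqrt_conj (ρ : DensityOperator K) {P : K →L[ℂ] K} (hP : IsStarProjection P)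
    {ι : Type*} (b : HilbertBasis ι ℂ K) :
    posTrace (CFC.sqrt ρ.op * P * CFC.sqrt ρ.op) =
      ∑' i, ENNReal.ofReal (ρ.diag (P (b i))) := by
  obtain ⟨h1, h2⟩ := sqrt_props ρ.isPositive
  have e1 : CFC.sqrt ρ.op * P * CFC.sqrt ρ.op = star (P * CFC.sqrt ρ.op) * (P * CFC.sqrt ρ.op) := by
    rw [star_mul, h1, hP.isSelfAdjoint.star_eq, mul_assoc, mul_assoc, ← mul_assoc P P,
      hP.isIdempotentElem.eq]
  have e2 : P * CFC.sqrt ρ.op * star (P * CFC.sqrt ρ.op) = star P * ρ.op * P := by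
    rw [star_mul, h1, hP.isSelfAdjoint.star_eq, mul_assoc, ← mul_assoc (CFC.sqrt ρ.op), h2,
      mul_assoc]
  have e3 : (star P * ρ.op * P).IsPositive := ρ.isPositive.adjoint_conj P
  rw [e1, posTrace_star_mul_self_comm, e2, posTrace_eq_tsum b e3]
  congr 1; ext i
  rw [mul_apply_eq_comp, mul_apply_eq_comp, inner_star_right]
  rfl

theorem distribution_eq_tsum (E : SpectralMeasure Ω K) (ρ : DensityOperator K) {s : Set Ω}
    (hs : MeasurableSet s) {ι : Type*} (b : HilbertBasis ι ℂ K) :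
    E.distribution ρ s = ∑' i, ENNReal.ofReal (ρ.diag (E.proj s (b i))) := by
  rw [E.distribution_apply ρ hs, posTrace_sqrt_conj ρ (E.isStarProjection s hs) b]

theorem distribution_map (E : SpectralMeasure Ω K) {f : Ω → Ω'} (hf : Measurable f)
    (ρ : DensityOperator K) : (E.map f hf).distribution ρ = (E.distribution ρ).map f := by
  ext s hs
  rw [Measure.map_apply hf hs, distribution_apply _ _ hs, distribution_apply _ _ (hf hs)]
  rfl

variable (E F) in
-- In a product basis, Tr ω(E(s) ⊗ I) summed over the second index gives the diagonal elements of
-- the marginal at E(s)eᵢ.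
theorem map_fst_distribution_prod [Nonempty (Ω × Ω')] (ω : DensityOperator (HilbertTensor K L)) :
    ((E.prod F).distribution ω).map Prod.fst = E.distribution ω.fst := by
  ext s hs
  rw [Measure.map_apply measurable_fst hs, ← Set.prod_univ,
    distribution_eq_tsum _ _ (hs.prod .univ) (tensorBasis (stdBasis K) (stdBasis L)),
    distribution_eq_tsum _ _ hs (stdBasis K), ENNReal.tsum_prod', prod_proj E F hs .univ]
  simp_rw [tensorBasis_apply, opTensor_pure, F.proj_univ, one_apply_eq_self, ω.tsum_diag_left]

variable (E F) in
theorem map_snd_distribution_prod [Nonempty (Ω × Ω')] (ω : DensityOperator (HilbertTensor K L)) :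
    ((E.prod F).distribution ω).map Prod.snd = F.distribution ω.snd := by
  ext s hs
  rw [Measure.map_apply measurable_snd hs, ← Set.univ_prod,
    distribution_eq_tsum _ _ (MeasurableSet.univ.prod hs) (tensorBasis (stdBasis K) (stdBasis L)),
    distribution_eq_tsum _ _ hs (stdBasis L), ENNReal.tsum_prod', prod_proj E F .univ hs,
    ENNReal.tsum_comm]
  simp_rw [tensorBasis_apply, opTensor_pure, E.proj_univ, one_apply_eq_self, ω.tsum_diag_right]

/-- The energy of a composite system is the sum of the energies of its parts. -/
theorem energy_tensorSum (E : SpectralMeasure ℝ≥0 K) (F : SpectralMeasure ℝ≥0 L)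
    (ω : DensityOperator (HilbertTensor K L)) :
    (E.tensorSum F).energy ω = E.energy ω.fst + F.energy ω.snd := by
  have h : Measurable fun t : ℝ≥0 => (t : ℝ≥0∞) := measurable_coe_nnreal_ennreal
  rw [energy, energy, energy, tensorSum, distribution_map, lintegral_map h (by fun_prop),
    ← map_fst_distribution_prod E F, ← map_snd_distribution_prod E F,
    lintegral_map h measurable_fst, lintegral_map h measurable_snd,
    ← lintegral_add_left (measurable_fst.coe_nnreal_ennreal)]
  simp

/-- The energy is an affine function of the state. -/
theorem energy_mix (E : SpectralMeasure ℝ≥0 K) (ρ σ : DensityOperator K) (t : ℝ) (h0 : 0 ≤ t)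
    (h1 : t ≤ 1) : E.energy (ρ.mix σ t h0 h1) =
      ENNReal.ofReal t * E.energy ρ + ENNReal.ofReal (1 - t) * E.energy σ := by
  have h : E.distribution (ρ.mix σ t h0 h1) = ENNReal.ofReal t • E.distribution ρ +
      ENNReal.ofReal (1 - t) • E.distribution σ := by
    ext s hs
    rw [Measure.add_apply, Measure.smul_apply, Measure.smul_apply, smul_eq_mul, smul_eq_mul]
    simp_rw [E.distribution_eq_tsum _ hs (stdBasis K)]
    rw [← ENNReal.tsum_mul_left, ← ENNReal.tsum_mul_left, ← ENNReal.tsum_add]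
    congr 1; ext i
    rw [DensityOperator.diag_mix, ← ENNReal.ofReal_mul h0, ← ENNReal.ofReal_mul (sub_nonneg.2 h1),
      ← ENNReal.ofReal_add (mul_nonneg h0 (ρ.diag_nonneg _))
        (mul_nonneg (sub_nonneg.2 h1) (σ.diag_nonneg _))]
  rw [energy, h, lintegral_add_measure, lintegral_smul_measure, lintegral_smul_measure]
  rfl

end SpectralMeasure

end Product

/-! ### Ensembles: transfer to a standard Borel space and products -/

section Ensembles

variable {K : Type u} [NormedAddCommGroup K] [InnerProductSpace ℂ K] [CompleteSpace K]

/-- A family of states is measurable if its matrix elements between the vectors of a total set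
are. -/
theorem DensityOperator.measurable_of_dense {X : Type*} [MeasurableSpace X]
    {f : X → DensityOperator K} {S : Set K} (hS : Dense (Submodule.span ℂ S : Set K))
    (h : ∀ x ∈ S, ∀ y ∈ S, Measurable fun t => ⟪x, (f t).op y⟫_ℂ) : Measurable f := by
  -- Measurability passes to the span by linearity and to its closure by sequential limits. It is
  -- used once in each argument of ⟨x, ρ y⟩; the scalar `a` is left free because the first argument
  -- is conjugate linear.
  have extend : ∀ F : K → X → ℂ, F 0 = 0 → (∀ x y, F (x + y) = F x + F y) →
      (∀ (c : ℂ) x, ∃ a : ℂ, F (c • x) = fun t => a * F x t) →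
      (∀ t, Continuous fun x => F x t) → (∀ x ∈ S, Measurable (F x)) → ∀ x, Measurable (F x) := by
    intro F h0 hadd hsmul hcont hF x
    have h1 : ∀ y ∈ Submodule.span ℂ S, Measurable (F y) := fun y hy => by
      induction hy using Submodule.span_induction with
      | mem y hy => exact hF y hy
      | zero => rw [h0]; exact measurable_const
      | add a b _ _ ha hb => rw [hadd]; exact ha.add hb
      | smul c a _ ha =>
        obtain ⟨d, hd⟩ := hsmul c a
        rw [hd]; exact ha.const_mul d
    obtain ⟨y, hy, hlim⟩ := mem_closure_iff_seq_limit.1 (hS x)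
    exact measurable_of_tendsto_metrizable (fun n => h1 _ (hy n))
      (tendsto_pi_nhds.2 fun t => ((hcont t).tendsto x).comp hlim)
  rw [DensityOperator.measurable_iff]
  intro x y
  refine extend (fun x t => ⟪x, (f t).op y⟫_ℂ) (by ext; simp)
    (fun a b => by ext; exact inner_add_left _ _ _)
    (fun c a => ⟨starRingEnd ℂ c, by ext; exact inner_smul_left _ _ _⟩) (fun t => by fun_prop)
    (fun x hx => ?_) x
  exact extend (fun y t => ⟪x, (f t).op y⟫_ℂ) (by ext; simp)
    (fun a b => by ext; rw [map_add, inner_add_right]; rfl)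
    (fun c a => ⟨c, by ext; rw [map_smul, inner_smul_right]⟩) (fun t => by fun_prop)
    (fun y hy => h x hx y hy) y

variable [TopologicalSpace.SeparableSpace K]

theorem GeneralizedEnsemble.inner_average {X : Type v} [MeasurableSpace X]
    (μ : GeneralizedEnsemble K X) (x y : K) :
    ⟪x, μ.average.op y⟫_ℂ = ∫ t, ⟪x, (μ.state t).op y⟫_ℂ ∂μ.prob := by
  rw [← μ.average.isPositive.inner_left_eq_inner_right]
  simp_rw [← (μ.state _).isPositive.inner_left_eq_inner_right]
  exact μ.inner_averageForm x y

/-! ### States encoded as points of the space of complex matrices -/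

section MatrixElements

variable (K) in
-- The basis is indexed in the universe of `K`, whereas the capacity uses ensembles on spaces in
-- `Type`; numbering the basis places the matrices in ℕ → ℕ → ℂ. Numbers outside the range of `enc`
-- get the vector 0.
theorem exists_basis_sequence :
    ∃ (enc : stdIndex K → ℕ) (d : ℕ → K), ∀ i, d (enc i) = stdBasis K i := by
  obtain ⟨enc, henc⟩ := exists_injective_nat (stdIndex K)
  refine ⟨enc, Function.extend enc (stdBasis K) 0, fun i => henc.extend_apply _ _ i⟩

variable (K) in
/-- A numbering of the fixed orthonormal basis. -/
def basisIndex : stdIndex K → ℕ := (exists_basis_sequence K).choose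

variable (K) in
/-- A sequence which contains the fixed orthonormal basis. -/
def basisSeq : ℕ → K := (exists_basis_sequence K).choose_spec.choose

theorem basisSeq_basisIndex (i : stdIndex K) : basisSeq K (basisIndex K i) = stdBasis K i :=
  (exists_basis_sequence K).choose_spec.choose_spec i

/-- The matrix of a state. -/
def DensityOperator.matrix (ρ : DensityOperator K) (m n : ℕ) : ℂ :=
  ⟪basisSeq K m, ρ.op (basisSeq K n)⟫_ℂ

variable (K) in
/-- The matrices of states. -/
def stateMatrices : Set (ℕ → ℕ → ℂ) :=
  {x | PosSemidefMatrix (fun i j => x (basisIndex K i) (basisIndex K j)) ∧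
    ∑' i, ENNReal.ofReal (x (basisIndex K i) (basisIndex K i)).re = 1}

variable (K) in
-- Semidefiniteness consists of uncountably many conditions, each of them closed, so the
-- intersection is closed; the trace condition is about a measurable series.
theorem measurableSet_stateMatrices : MeasurableSet (stateMatrices K) := by
  refine MeasurableSet.inter ?_ ?_
  · have h : {x : ℕ → ℕ → ℂ | PosSemidefMatrix fun i j => x (basisIndex K i) (basisIndex K j)} =
        ⋂ (s : Finset (stdIndex K)) (v : stdIndex K → ℂ), {x : ℕ → ℕ → ℂ | 0 ≤ ∑ i ∈ s, ∑ j ∈ s,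
          starRingEnd ℂ (v i) * (x (basisIndex K i) (basisIndex K j) * v j)} := by
      ext x; simp [PosSemidefMatrix]
    refine IsClosed.measurableSet ?_
    change IsClosed {x : ℕ → ℕ → ℂ |
      PosSemidefMatrix fun i j => x (basisIndex K i) (basisIndex K j)}
    rw [h]
    refine isClosed_iInter fun s => isClosed_iInter fun v => ?_
    exact isClosed_le continuous_const (by fun_prop)
  · refine measurableSet_eq_fun (Measurable.tsum fun i => ?_) measurable_const
    exact (Complex.measurable_re.comp (by fun_prop)).ennreal_ofReal

theorem DensityOperator.matrix_mem (ρ : DensityOperator K) : ρ.matrix ∈ stateMatrices K := by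
  refine ⟨fun s v => ?_, ?_⟩
  · simp only [matrix, basisSeq_basisIndex]
    have h := ρ.isPositive.inner_nonneg_right (∑ i ∈ s, v i • stdBasis K i)
    simp only [map_sum, map_smul, sum_inner, inner_sum, inner_smul_left, inner_smul_right] at h
    refine h.trans_eq ?_
    simp only [Finset.mul_sum]
    rw [Finset.sum_comm]
    exact Finset.sum_congr rfl fun i _ => Finset.sum_congr rfl fun j _ => by ring
  · simp only [matrix, basisSeq_basisIndex]
    exact ρ.posTrace_eq_one

theorem exists_state_of_mem {x : ℕ → ℕ → ℂ} (hx : x ∈ stateMatrices K) :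
    ∃ ρ : DensityOperator K, ∀ i j, ⟪stdBasis K i, ρ.op (stdBasis K j)⟫_ℂ =
      x (basisIndex K i) (basisIndex K j) := by
  obtain ⟨h1, h2⟩ := hx
  have hs : Summable fun i => (x (basisIndex K i) (basisIndex K i)).re := by
    have := ENNReal.summable_toReal (h2.trans_ne ENNReal.one_ne_top)
    refine this.congr fun i => ?_
    rw [ENNReal.toReal_ofReal (Complex.nonneg_iff.1 (h1.diag i)).1]
  obtain ⟨T, hT, hTx⟩ := h1.exists_isPositive hs (stdBasis K)
  refine ⟨⟨T, hT, ?_⟩, hTx⟩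
  rw [posTrace]
  simp_rw [hTx]
  exact h2

open Classical in
/-- The state with a given matrix (and `ρ` if there is none). -/
def stateOfMatrix (ρ : DensityOperator K) (x : ℕ → ℕ → ℂ) : DensityOperator K :=
  if hx : x ∈ stateMatrices K then (exists_state_of_mem hx).choose else ρ

theorem stateOfMatrix_matrix (ρ σ : DensityOperator K) : stateOfMatrix ρ σ.matrix = σ := by
  rw [stateOfMatrix, dif_pos σ.matrix_mem]
  refine DensityOperator.ext_op (clm_ext_basis (stdBasis K) fun i j => ?_)
  rw [(exists_state_of_mem σ.matrix_mem).choose_spec, DensityOperator.matrix, basisSeq_basisIndex,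
    basisSeq_basisIndex]

theorem measurable_stateOfMatrix (ρ : DensityOperator K) : Measurable (stateOfMatrix ρ) := by
  classical
  refine DensityOperator.measurable_of_dense (S := Set.range (stdBasis K)) ?_ ?_
  · exact Submodule.dense_iff_topologicalClosure_eq_top.2 (stdBasis K).dense_span
  · rintro _ ⟨i, rfl⟩ _ ⟨j, rfl⟩
    have h : (fun x => ⟪stdBasis K i, (stateOfMatrix ρ x).op (stdBasis K j)⟫_ℂ) =
        (stateMatrices K).piecewise (fun x => x (basisIndex K i) (basisIndex K j))
          (fun _ => ⟪stdBasis K i, ρ.op (stdBasis K j)⟫_ℂ) := by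
      ext x
      by_cases hx : x ∈ stateMatrices K
      · rw [Set.piecewise_eq_of_mem _ _ _ hx, stateOfMatrix, dif_pos hx,
          (exists_state_of_mem hx).choose_spec]
      · rw [Set.piecewise_eq_of_notMem _ _ _ hx, stateOfMatrix, dif_neg hx]
    rw [h]
    refine Measurable.piecewise (measurableSet_stateMatrices K) ?_ measurable_const
    exact (measurable_pi_apply _).comp (measurable_pi_apply _)

end MatrixElements

/-- An ensemble on an arbitrary measurable space obeys the bound by the `χ`-capacity, which is
defined by ensembles on standard Borel spaces. -/
theorem chi_le_chiCapacity (Φ : QuantumChannel K) (E : SpectralMeasure ℝ≥0 K) (c : ℝ)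
    {Y : Type v} [MeasurableSpace Y] (ν : GeneralizedEnsemble K Y)
    (hν : ν.average ∈ constrainedStates E c) : chi Φ ν ≤ chiCapacity Φ E c := by
  let g : Y → ℕ → ℕ → ℂ := fun y => (ν.state y).matrix
  have hg : Measurable g := measurable_pi_lambda _ fun m => measurable_pi_lambda _ fun n =>
    DensityOperator.measurable_iff.1 ν.measurable_state _ _
  have hgs : ∀ y, stateOfMatrix ν.average (g y) = ν.state y := fun y => stateOfMatrix_matrix _ _
  -- The push-forward of `ν` under the matrix map. The average state is only a default for matrices
  -- that belong to no state, and these have measure zero.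
  let μ : GeneralizedEnsemble K (ℕ → ℕ → ℂ) :=
    { prob := ν.prob.map g
      isProbabilityMeasure := Measure.isProbabilityMeasure_map hg.aemeasurable
      state := stateOfMatrix ν.average
      measurable_state := measurable_stateOfMatrix _ }
  have havg : μ.average = ν.average := DensityOperator.ext_op <|
    ContinuousLinearMap.ext fun y => ext_inner_left ℂ fun x => by
      rw [μ.inner_average, ν.inner_average]
      refine (integral_map hg.aemeasurable
        (DensityOperator.measurable_iff.1 μ.measurable_state x y).aestronglyMeasurable).trans ?_
      refine integral_congr_ae (ae_of_all _ fun t => ?_)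
      change ⟪x, (stateOfMatrix ν.average (g t)).op y⟫_ℂ = _
      rw [hgs]
  have hle : chi Φ ν ≤ chi Φ μ := by
    rw [chi, chi, havg]
    refine EReal.sub_le_sub le_rfl (EReal.coe_ennreal_le_coe_ennreal_iff.2 ?_)
    -- This inequality needs no measurability of the output entropy, and it goes in the required
    -- direction because the integral enters χ with a minus sign.
    refine (lintegral_map_le _ g).trans_eq ?_
    refine lintegral_congr fun y => ?_
    change Φ.outputEntropy (stateOfMatrix ν.average (g y)) = _
    rw [hgs]
  refine hle.trans ?_
  unfold chiCapacity
  exact le_iSup_of_le (ℕ → ℕ → ℂ) <| le_iSup_of_le inferInstance <|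
    le_iSup_of_le inferInstance <| le_iSup_of_le μ <| le_iSup_of_le (by rwa [havg]) le_rfl

variable {L : Type u} [NormedAddCommGroup L] [InnerProductSpace ℂ L] [CompleteSpace L]
  [TopologicalSpace.SeparableSpace L]

namespace GeneralizedEnsemble

variable {X : Type v} [MeasurableSpace X] {Y : Type w} [MeasurableSpace Y]

/-- The product of two ensembles. -/
def prod (μ : GeneralizedEnsemble K X) (ν : GeneralizedEnsemble L Y) :
    GeneralizedEnsemble (HilbertTensor K L) (X × Y) where
  prob := μ.prob.prod ν.prob
  state p := (μ.state p.1).tensor (ν.state p.2)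
  measurable_state := by
    refine DensityOperator.measurable_of_dense (dense_span_pureTensors K L) ?_
    rintro _ ⟨⟨x, y⟩, rfl⟩ _ ⟨⟨x', y'⟩, rfl⟩
    change Measurable fun p : X × Y => ⟪pureTensor x y,
      opTensor (μ.state p.1).op (ν.state p.2).op (pureTensor x' y')⟫_ℂ
    simp_rw [opTensor_pure, inner_pure]
    exact ((DensityOperator.measurable_iff.1 μ.measurable_state x x').comp measurable_fst).mul
      ((DensityOperator.measurable_iff.1 ν.measurable_state y y').comp measurable_snd)

theorem average_prod (μ : GeneralizedEnsemble K X) (ν : GeneralizedEnsemble L Y) :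
    (μ.prod ν).average = μ.average.tensor ν.average := by
  refine DensityOperator.ext_op (clm_ext_inner_pure fun x y x' y' => ?_)
  rw [inner_average]
  change ∫ p : X × Y, ⟪pureTensor x y, opTensor (μ.state p.1).op (ν.state p.2).op
    (pureTensor x' y')⟫_ℂ ∂(μ.prob.prod ν.prob) = ⟪pureTensor x y,
      opTensor μ.average.op ν.average.op (pureTensor x' y')⟫_ℂ
  simp_rw [opTensor_pure, inner_pure, inner_average]
  exact integral_prod_mul (fun p => ⟪x, (μ.state p).op x'⟫_ℂ) fun q => ⟪y, (ν.state q).op y'⟫_ℂ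

end GeneralizedEnsemble

end Ensembles

/-! ### The upper bound on χ and the optimality criterion -/

section Capacity

variable {K : Type u} [NormedAddCommGroup K] [InnerProductSpace ℂ K] [CompleteSpace K]

theorem QuantumChannel.apply_mix (Φ : QuantumChannel K) (ρ σ : DensityOperator K) (t : ℝ)
    (h0 : 0 ≤ t) (h1 : t ≤ 1) :
    Φ.apply (ρ.mix σ t h0 h1) = (Φ.apply ρ).mix (Φ.apply σ) t h0 h1 := by
  refine DensityOperator.ext_op ?_
  have h : (ρ.mix σ t h0 h1).toTraceClass =
      (t : ℂ) • ρ.toTraceClass + ((1 - t : ℝ) : ℂ) • σ.toTraceClass := rfl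
  change (Φ.toLinearMap (ρ.mix σ t h0 h1).toTraceClass : K →L[ℂ] K) =
    (t : ℂ) • (Φ.toLinearMap ρ.toTraceClass : K →L[ℂ] K) +
      ((1 - t : ℝ) : ℂ) • (Φ.toLinearMap σ.toTraceClass : K →L[ℂ] K)
  rw [h, map_add, map_smul, map_smul]
  rfl

variable [TopologicalSpace.SeparableSpace K]

theorem chi_le (Φ : QuantumChannel K) {X : Type v} [MeasurableSpace X]
    (μ : GeneralizedEnsemble K X) {a b : ℝ≥0∞} (ha : Φ.outputEntropy μ.average ≤ a)
    (hb : ∀ ρ, b ≤ Φ.outputEntropy ρ) : chi Φ μ ≤ (a : EReal) - (b : EReal) := by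
  refine EReal.sub_le_sub (EReal.coe_ennreal_le_coe_ennreal_iff.2 ha)
    (EReal.coe_ennreal_le_coe_ennreal_iff.2 ?_)
  calc b = ∫⁻ _, b ∂μ.prob := by simp
    _ ≤ _ := lintegral_mono fun x => hb _

/-- An ensemble of states with minimal output entropy whose average has maximal output entropy
under the constraint is optimal. -/
theorem chiCapacity_eq_of_optimal (Φ : QuantumChannel K) (E : SpectralMeasure ℝ≥0 K) (c : ℝ)
    {Y : Type v} [MeasurableSpace Y] (ν : GeneralizedEnsemble K Y) {b : ℝ≥0∞}
    (hν : ν.average ∈ constrainedStates E c)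
    (hmax : ∀ ρ ∈ constrainedStates E c, Φ.outputEntropy ρ ≤ Φ.outputEntropy ν.average)
    (hstate : ∀ y, Φ.outputEntropy (ν.state y) = b) (hmin : ∀ ρ, b ≤ Φ.outputEntropy ρ) :
    chi Φ ν = chiCapacity Φ E c ∧
      chiCapacity Φ E c = (Φ.outputEntropy ν.average : EReal) - (b : EReal) := by
  have h1 : chi Φ ν = (Φ.outputEntropy ν.average : EReal) - (b : EReal) := by
    rw [chi]; simp [hstate]
  have h2 : chiCapacity Φ E c ≤ (Φ.outputEntropy ν.average : EReal) - (b : EReal) := by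
    unfold chiCapacity
    exact iSup_le fun X => iSup_le fun _ => iSup_le fun _ => iSup_le fun μ => iSup_le fun hμ =>
      chi_le Φ μ (hmax _ hμ) hmin
  have h3 := chi_le_chiCapacity Φ E c ν hν
  have h4 := le_antisymm h2 (h1 ▸ h3)
  exact ⟨h1.trans h4.symm, h4⟩

end Capacity

/-! ### Output entropy and energy of bipartite systems -/

section Tensor

variable {K : Type u} [NormedAddCommGroup K] [InnerProductSpace ℂ K] [CompleteSpace K]
  {L : Type u} [NormedAddCommGroup L] [InnerProductSpace ℂ L] [CompleteSpace L]

theorem QuantumChannel.outputEntropy_tensor (Φ : QuantumChannel K) (Ψ : QuantumChannel L)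
    (ρ : DensityOperator K) (σ : DensityOperator L) :
    (Φ.tensor Ψ).outputEntropy (ρ.tensor σ) = Φ.outputEntropy ρ + Ψ.outputEntropy σ := by
  rw [outputEntropy, tensor_apply_tensor, DensityOperator.entropy_tensor]; rfl

theorem QuantumChannel.outputEntropy_tensor_le (Φ : QuantumChannel K) (Ψ : QuantumChannel L)
    (ω : DensityOperator (HilbertTensor K L)) :
    (Φ.tensor Ψ).outputEntropy ω ≤ Φ.outputEntropy ω.fst + Ψ.outputEntropy ω.snd := by
  refine ((Φ.tensor Ψ).apply ω).entropy_le_add.trans_eq ?_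
  rw [fst_tensor_apply, snd_tensor_apply]; rfl

theorem SpectralMeasure.energy_tensor (E : SpectralMeasure ℝ≥0 K) (F : SpectralMeasure ℝ≥0 L)
    (ρ : DensityOperator K) (σ : DensityOperator L) :
    (E.tensorSum F).energy (ρ.tensor σ) = E.energy ρ + F.energy σ := by
  rw [energy_tensorSum, DensityOperator.fst_tensor, DensityOperator.snd_tensor]

end Tensor

/-! ### Tensor powers: maximal output entropy and product ensembles -/

section Powers

variable {K : Type u} [NormedAddCommGroup K] [InnerProductSpace ℂ K] [CompleteSpace K]
  [TopologicalSpace.SeparableSpace K]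

/-- The output entropy of a state of `n + 1` copies is bounded by `n + 1` times the output entropy
of a state of one copy with the same mean energy per copy. -/
theorem exists_outputEntropy_tensorPow_le (Φ : QuantumChannel K) (E : SpectralMeasure ℝ≥0 K) :
    ∀ (n : ℕ) (ω : DensityOperator (tensorPower K (n + 1)).carrier), ∃ τ : DensityOperator K,
      (Φ.tensorPow (n + 1)).outputEntropy ω ≤ ((n + 1 : ℕ) : ℝ≥0∞) * Φ.outputEntropy τ ∧
      ((n + 1 : ℕ) : ℝ≥0∞) * E.energy τ = (E.tensorPow (n + 1)).energy ω
  | 0, ω => ⟨ω, by simp; exact le_rfl, by simp; rfl⟩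
  | n + 1, ω => by
    -- By definition the power with exponent n + 2 is the tensor product of the power n + 1 with one
    -- more copy of K.
    let ω' : DensityOperator (HilbertTensor (tensorPower K (n + 1)).carrier K) := ω
    obtain ⟨τ, h1, h2⟩ := exists_outputEntropy_tensorPow_le Φ E n ω'.fst
    -- `τ` stands for n + 1 copies and the last marginal for one, so they are mixed with weights (n
    -- + 1)/(n + 2) and 1/(n + 2); the induction thus produces the mean of all one-copy marginals.
    have ht0 : (0 : ℝ) ≤ (n + 1 : ℕ) / (n + 1 + 1 : ℕ) := by positivity
    have ht1 : ((n + 1 : ℕ) : ℝ) / (n + 1 + 1 : ℕ) ≤ 1 := by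
      rw [div_le_one (by positivity)]; push_cast; linarith
    have e1 : ((n + 1 + 1 : ℕ) : ℝ≥0∞) * ENNReal.ofReal ((n + 1 : ℕ) / (n + 1 + 1 : ℕ)) =
        ((n + 1 : ℕ) : ℝ≥0∞) := by
      rw [← ENNReal.ofReal_natCast, ← ENNReal.ofReal_mul (by positivity),
        mul_div_cancel₀ _ (by positivity), ENNReal.ofReal_natCast]
    have e2 : ((n + 1 + 1 : ℕ) : ℝ≥0∞) *
        ENNReal.ofReal (1 - ((n + 1 : ℕ) : ℝ) / (n + 1 + 1 : ℕ)) = 1 := by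
      rw [← ENNReal.ofReal_natCast, ← ENNReal.ofReal_mul (by positivity), mul_sub,
        mul_div_cancel₀ _ (by positivity)]
      push_cast
      simp
    refine ⟨τ.mix ω'.snd _ ht0 ht1, ?_, ?_⟩
    · calc (Φ.tensorPow (n + 1 + 1)).outputEntropy ω
          ≤ (Φ.tensorPow (n + 1)).outputEntropy ω'.fst + Φ.outputEntropy ω'.snd :=
            (Φ.tensorPow (n + 1)).outputEntropy_tensor_le Φ ω'
        _ ≤ ((n + 1 : ℕ) : ℝ≥0∞) * Φ.outputEntropy τ + 1 * Φ.outputEntropy ω'.snd := by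
            rw [one_mul]; gcongr
        _ = ((n + 1 + 1 : ℕ) : ℝ≥0∞) * (ENNReal.ofReal ((n + 1 : ℕ) / (n + 1 + 1 : ℕ)) *
              Φ.outputEntropy τ + ENNReal.ofReal (1 - ((n + 1 : ℕ) : ℝ) / (n + 1 + 1 : ℕ)) *
              Φ.outputEntropy ω'.snd) := by
            rw [mul_add, ← mul_assoc, ← mul_assoc, e1, e2]
        _ ≤ _ := by
            gcongr
            refine (DensityOperator.entropy_mix_ge _ _ _ ht0 ht1).trans_eq ?_
            rw [← QuantumChannel.apply_mix]
            rfl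
    · rw [SpectralMeasure.energy_mix, mul_add, ← mul_assoc, ← mul_assoc, e1, e2, one_mul, h2]
      exact ((E.tensorPow (n + 1)).energy_tensorSum E ω').symm

/-- The powers of an ensemble. -/
theorem exists_ensemble_tensorPow (Φ : QuantumChannel K) (E : SpectralMeasure ℝ≥0 K)
    {Y : Type v} [MeasurableSpace Y] (ν : GeneralizedEnsemble K Y) {b : ℝ≥0∞}
    (hν : ∀ y, Φ.outputEntropy (ν.state y) = b) :
    ∀ n : ℕ, ∃ (Z : Type v) (_ : MeasurableSpace Z)
      (κ : GeneralizedEnsemble (tensorPower K (n + 1)).carrier Z),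
      (∀ z, (Φ.tensorPow (n + 1)).outputEntropy (κ.state z) = ((n + 1 : ℕ) : ℝ≥0∞) * b) ∧
      (Φ.tensorPow (n + 1)).outputEntropy κ.average =
        ((n + 1 : ℕ) : ℝ≥0∞) * Φ.outputEntropy ν.average ∧
      (E.tensorPow (n + 1)).energy κ.average = ((n + 1 : ℕ) : ℝ≥0∞) * E.energy ν.average
  | 0 => ⟨Y, inferInstance, ν, fun y => (hν y).trans (by simp), by simp; rfl, by simp; rfl⟩
  | n + 1 => by
    obtain ⟨Z, _, κ, h1, h2, h3⟩ := exists_ensemble_tensorPow Φ E ν hν n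
    have hs : ∀ a : ℝ≥0∞, ((n + 1 + 1 : ℕ) : ℝ≥0∞) * a = ((n + 1 : ℕ) : ℝ≥0∞) * a + a :=
      fun a => by rw [Nat.cast_succ, add_mul, one_mul]
    refine ⟨Z × Y, inferInstance, κ.prod ν, fun p => ?_, ?_, ?_⟩
    · rw [hs, ← h1 p.1, ← hν p.2]
      exact (Φ.tensorPow (n + 1)).outputEntropy_tensor Φ _ _
    · rw [hs, ← h2]
      refine (congrArg ((Φ.tensorPow (n + 1)).tensor Φ).outputEntropy
        (GeneralizedEnsemble.average_prod κ ν)).trans ?_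
      exact (Φ.tensorPow (n + 1)).outputEntropy_tensor Φ _ _
    · rw [hs, ← h3]
      refine (congrArg ((E.tensorPow (n + 1)).tensorSum E).energy
        (GeneralizedEnsemble.average_prod κ ν)).trans ?_
      exact (E.tensorPow (n + 1)).energy_tensor E _ _

/-- As `b` is finite, ∞ - ∞ does not occur; for a = ∞ both sides are ⊤, and otherwise this is
distributivity in ℝ. -/
theorem natCast_mul_sub {a b : ℝ≥0∞} (hb : b ≠ ∞) {n : ℕ} (hn : 1 ≤ n) :
    (((n : ℝ≥0∞) * a : ℝ≥0∞) : EReal) - (((n : ℝ≥0∞) * b : ℝ≥0∞) : EReal) =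
      (n : EReal) * ((a : EReal) - (b : EReal)) := by
  lift b to ℝ≥0 using hb
  have hn0 : (0 : ℝ) < n := by exact_mod_cast hn
  have hcast : (n : EReal) = ((n : ℝ) : EReal) := rfl
  rcases eq_or_ne a ∞ with rfl | ha
  · rw [ENNReal.mul_top (by exact_mod_cast hn0.ne')]
    have : ((n : ℝ≥0∞) * b) = ((n * b : ℝ≥0) : ℝ≥0∞) := by push_cast; rfl
    rw [this, EReal.coe_ennreal_top]
    change (⊤ : EReal) - (((n * b : ℝ≥0) : ℝ) : EReal) = _ * (⊤ - ((b : ℝ) : EReal))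
    rw [EReal.top_sub_coe, EReal.top_sub_coe, hcast, EReal.coe_mul_top_of_pos hn0]
  · lift a to ℝ≥0 using ha
    have h : ∀ x : ℝ≥0, ((n : ℝ≥0∞) * x) = ((n * x : ℝ≥0) : ℝ≥0∞) := fun x => by push_cast; rfl
    rw [h, h]
    change (((n * a : ℝ≥0) : ℝ) : EReal) - (((n * b : ℝ≥0) : ℝ) : EReal) =
      ((n : ℝ) : EReal) * (((a : ℝ) : EReal) - ((b : ℝ) : EReal))
    rw [← EReal.coe_sub, ← EReal.coe_sub, ← EReal.coe_mul, mul_sub, NNReal.coe_mul, NNReal.coe_mul,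
      NNReal.coe_natCast]

/-- The product ensemble meets the optimality criterion: its states are minimal by `hmin`, and the
output entropy of an admissible ω is at most n times that of a one-copy state τ, which satisfies the
constraint `c` after n is cancelled from the energies. -/
theorem chiCapacity_tensorPow (Φ : QuantumChannel K) (E : SpectralMeasure ℝ≥0 K) (c : ℝ)
    {Y : Type v} [MeasurableSpace Y] (ν : GeneralizedEnsemble K Y) {b : ℝ≥0∞}
    (hν : ν.average ∈ constrainedStates E c)
    (hmax : ∀ ρ ∈ constrainedStates E c, Φ.outputEntropy ρ ≤ Φ.outputEntropy ν.average)
    (hstate : ∀ y, Φ.outputEntropy (ν.state y) = b) (hb : b ≠ ∞) {n : ℕ} (hn : 1 ≤ n)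
    (hmin : ∀ ρ, (n : ℝ≥0∞) * b ≤ (Φ.tensorPow n).outputEntropy ρ) :
    chiCapacity (Φ.tensorPow n) (E.tensorPow n) (n * c) =
      (n : EReal) * ((Φ.outputEntropy ν.average : EReal) - (b : EReal)) := by
  obtain ⟨n, rfl⟩ := Nat.exists_eq_succ_of_ne_zero (by omega : n ≠ 0)
  obtain ⟨Z, _, κ, h1, h2, h3⟩ := exists_ensemble_tensorPow Φ E ν hstate n
  have hc : ENNReal.ofReal ((n + 1 : ℕ) * c) = ((n + 1 : ℕ) : ℝ≥0∞) * ENNReal.ofReal c := by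
    rw [ENNReal.ofReal_mul (by positivity), ENNReal.ofReal_natCast]
  have h4 : κ.average ∈ constrainedStates (E.tensorPow (n + 1)) ((n + 1 : ℕ) * c) := by
    change (E.tensorPow (n + 1)).energy κ.average ≤ _
    rw [h3, hc]
    gcongr
    exact hν
  rw [← natCast_mul_sub hb hn, ← h2]
  refine (chiCapacity_eq_of_optimal (Φ.tensorPow (n + 1)) (E.tensorPow (n + 1)) ((n + 1 : ℕ) * c) κ
    h4 (fun ω hω => ?_) h1 hmin).2
  obtain ⟨τ, h5, h6⟩ := exists_outputEntropy_tensorPow_le Φ E n ω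
  rw [h2]
  refine h5.trans ?_
  gcongr
  refine hmax τ ?_
  change (E.tensorPow (n + 1)).energy ω ≤ _ at hω
  rw [← h6, hc] at hω
  exact (ENNReal.mul_le_mul_iff_right (by simp) (ENNReal.natCast_ne_top _)).1 hω

end Powers

end QInfo

end

/-! ### Covariant channels: the capacity, its optimal ensemble and additivity -/

theorem proposition1 {𝓗 : Type*} [NormedAddCommGroup 𝓗] [InnerProductSpace ℂ 𝓗]
    [CompleteSpace 𝓗] [TopologicalSpace.SeparableSpace 𝓗]
    (Φ : QuantumChannel 𝓗)
    (H : 𝓗 →ₗ.[ℂ] 𝓗) (hH : IsSelfAdjoint H) (hHpos : ∀ x : H.domain, 0 ≤ (⟪(x : 𝓗), H x⟫_ℂ).re)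
    (E : ℝ) (hE : 0 < E)
    (hfin : Φ.minOutputEntropy ≠ ⊤)
    (ρE ρ0 : DensityOperator 𝓗)
    (h1 : ρE ∈ constrainedStates (spectralMeasure H) E ∧
      ∀ ρ ∈ constrainedStates (spectralMeasure H) E, Φ.outputEntropy ρ ≤ Φ.outputEntropy ρE)
    (h2 : ∀ ρ : DensityOperator 𝓗, Φ.outputEntropy ρ0 ≤ Φ.outputEntropy ρ)
    {G : Type*} [Group G] [TopologicalSpace G] [IsTopologicalGroup G] [MeasurableSpace G]
    [BorelSpace G]
    (V : ProjectiveUnitaryRep 𝓗 G) (U : G → unitary (𝓗 →L[ℂ] 𝓗)) (hcov : Φ.IsCovariant V U)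
    (π : Measure G) [IsProbabilityMeasure π]
    (h3 : ρE = (V.orbitEnsemble π ρ0).average) :
    (chiCapacity Φ (spectralMeasure H) E =
        ((⨆ ρ ∈ constrainedStates (spectralMeasure H) E, Φ.outputEntropy ρ : ℝ≥0∞) : EReal) -
          ((⨅ ρ, Φ.outputEntropy ρ : ℝ≥0∞) : EReal) ∧
      chiCapacity Φ (spectralMeasure H) E =
        (Φ.outputEntropy ρE : EReal) - (Φ.outputEntropy ρ0 : EReal) ∧
      (V.orbitEnsemble π ρ0).average ∈ constrainedStates (spectralMeasure H) E ∧
      chi Φ (V.orbitEnsemble π ρ0) = chiCapacity Φ (spectralMeasure H) E) ∧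
    ((∀ n : ℕ, 1 ≤ n → (Φ.tensorPow n).minOutputEntropy = n * Φ.minOutputEntropy) →
      (∀ n : ℕ, 1 ≤ n →
        chiCapacity (Φ.tensorPow n) ((spectralMeasure H).tensorPow n) (n * E) =
          (n : EReal) * chiCapacity Φ (spectralMeasure H) E) ∧
      IsClassicalCapacity Φ (spectralMeasure H) E (chiCapacity Φ (spectralMeasure H) E) ∧
      chiCapacity Φ (spectralMeasure H) E =
        (Φ.outputEntropy ρE : EReal) - (Φ.outputEntropy ρ0 : EReal)) := by
  obtain ⟨h1, hmax⟩ := h1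
  have hmin : (⨅ ρ, Φ.outputEntropy ρ) = Φ.outputEntropy ρ0 :=
    le_antisymm (iInf_le _ _) (le_iInf h2)
  have hsup : (⨆ ρ ∈ constrainedStates (spectralMeasure H) E, Φ.outputEntropy ρ) =
      Φ.outputEntropy ρE :=
    le_antisymm (iSup₂_le hmax) (le_iSup₂ (f := fun ρ _ => Φ.outputEntropy ρ) ρE h1)
  have hmin' : Φ.minOutputEntropy = Φ.outputEntropy ρ0 := hmin
  -- Covariance moves the conjugation to the output, where entropy is unitarily invariant.
  have hstate : ∀ g, Φ.outputEntropy ((V.orbitEnsemble π ρ0).state g) = Φ.outputEntropy ρ0 :=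
    fun g => by
      change (Φ.apply (ρ0.conj (V.V g))).entropy = _
      rw [hcov, DensityOperator.entropy_conj]
      rfl
  rw [h3] at h1 hmax
  obtain ⟨h4, h5⟩ := chiCapacity_eq_of_optimal Φ (spectralMeasure H) E (V.orbitEnsemble π ρ0) h1
    hmax hstate h2
  rw [← h3] at h5
  refine ⟨⟨by rw [hsup, hmin, h5], h5, h1, h4⟩, fun hadd => ?_⟩
  have h6 : ∀ n : ℕ, 1 ≤ n →
      chiCapacity (Φ.tensorPow n) ((spectralMeasure H).tensorPow n) (n * E) =
        (n : EReal) * chiCapacity Φ (spectralMeasure H) E := fun n hn => by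
    rw [h5, h3]
    refine chiCapacity_tensorPow Φ _ E (V.orbitEnsemble π ρ0) h1 hmax hstate (hmin' ▸ hfin) hn
      fun ρ => ?_
    rw [← hmin', ← hadd n hn]
    exact iInf_le _ _
  refine ⟨h6, ?_, h5⟩
  -- The sequence is constant from n = 1 on; n = 0 is left out because the factor n⁻¹ there is only
  -- a default value.
  refine tendsto_const_nhds.congr' ?_
  filter_upwards [eventually_ge_atTop 1] with n hn
  have hn0 : (n : ℝ) ≠ 0 := by exact_mod_cast (by omega : n ≠ 0)
  have hcast : (n : EReal) = ((n : ℝ) : EReal) := rfl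
  rw [h6 n hn, ← mul_assoc, hcast, ← EReal.coe_mul, inv_mul_cancel₀ hn0, EReal.coe_one, one_mul]
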